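/- **Theorem.** Let $\mathfrak g=\mathfrak v\oplus\mathfrak z$ be an H-type Lie algebra: $\mathfrak v\neq0$ and $\mathfrak z$ are finite-dimensional real inner product spaces, $[\cdot,\cdot]:\mathfrak v\times\mathfrak v\to\mathfrak z$ is bilinear and alternating, $\mathfrak z$ is central, and for every $\mu\in\mathfrak z$ the operator $J_\mu:\mathfrak v\to\mathfrak v$ defined by $\langle J_\mu V,W\rangle=\langle\mu,[V,W]\rangle$ satisfies $J_\mu^2=-|\mu|^2I$. (The duals $\mathfrak z^*,\mathfrak v^*$ are identified with $\mathfrak z,\mathfrak v$ through the inner products.) Let $G=\mathfrak v\times\mathfrak z$ be the corresponding H-type group, with product $(x,u)(x',u')=(x+x',\,u+u'+\tfrac12[x,x'])$ and Haar measure $dg=dx\,du$. For a unit vector $\nu\in\mathfrak v$ and $\lambda\in\mathfrak z\setminus\{0\}$ put $$\gamma_{\nu,\lambda}(s)=\Bigl(J_\lambda^{-1}e^{sJ_\lambda}\nu,\ \tfrac{s\lambda}{2|\lambda|^2}\Bigr),\qquad I_{\nu,\lambda}f(x,u)=\int_{\mathbb R}f\bigl((x,u)\gamma_{\nu,\lambda}(s)\bigr)\,ds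 ,$$ which for $f\in L^1(G)$ converges for almost every $(x,u)\in G$. Write $\dim\mathfrak v=2n$ and let $\mathcal F(\mathbb C^n)$ be the Bargmann–Fock space of holomorphic functions $F$ on $\mathbb C^n$ with $\pi^{-n}\int|F(\zeta)|^2e^{-|\zeta|^2}d\zeta<\infty$. For $\mu\in\mathfrak z\setminus\{0\}$ choose a linear isometry $R_\mu:\mathbb C^n=\mathbb R^{2n}\to\mathfrak v$ with $J_\mu R_\mu z=|\mu|R_\mu(iz)$, and let $\pi_\mu$ be the unitary representation of $G$ on $\mathcal F(\mathbb C^n)$ given, with $h=|\mu|$, $z=R_\mu^{-1}x$ and $t=\langle\mu,u\rangle/|\mu|$, by $$\pi_\mu(x,u)F(\zeta)=e^{iht-\sqrt{h/2}\,\zeta\cdot\bar z-\frac h4|z|^2}\,F\bigl(\zeta+\sqrt{h/2}\,z\bigr).$$ For $f\in L^1(G)$ let $\mathcal F(f)(\mu)=\int_Gf(g)\,\pi_\mu(g)^*\,dg$ (a weak operator integral) be the group Fourier transform. Let $f\in L^1(G)$ and $Z\subset\mathfrak z\setminus\{0\}$, and suppose that for all $\nu\in\mathfrak v$ with $|\nu|=1$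 and all $\lambda\in Z$ we have $I_{\nu,\lambda}f=0$ almost everywhere. 1. If $G$ is not the first Heisenberg group, that is, $(\dim\mathfrak v,\dim\mathfrak z)\neq(2,1)$, then $\mathcal F(f)(\mu)=0$ for every $\mu\in\mathfrak z\setminus\{0\}$ for which there are $\lambda\in Z$ and $k\in\mathbb Z$ with $\langle\lambda,\mu\rangle=2k|\lambda|^3$. 2. If $G$ is the first Heisenberg group, that is, $(\dim\mathfrak v,\dim\mathfrak z)=(2,1)$, then $\mathcal F(f)(\mu)=0$ for every $\mu\in\mathfrak z\setminus\{0\}$ for which there are $\lambda\in Z$ and an odd integer $k$ with $\langle\lambda,\mu\rangle=2k|\lambda|^3$. In both cases this holds for every admissible choice of $R_\mu$. -/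

import Mathlib

open MeasureTheory

noncomputable section

/-- For an alternating bilinear `[·,·] : 𝔳 × 𝔳 → 𝔷` and `μ ∈ 𝔷` (identified with `⟪μ, ·⟫ ∈ 𝔷*`), the
operator `J_μ : 𝔳 → 𝔳` with `⟪J_μ V, W⟫ = ⟪μ, [V, W]⟫ = ω_μ(V, W)`, see `inner_JOp`. -/
def JOp {𝔳 𝔷 : Type*} [NormedAddCommGroup 𝔳] [InnerProductSpace ℝ 𝔳] [FiniteDimensional ℝ 𝔳]
    [NormedAddCommGroup 𝔷] [InnerProductSpace ℝ 𝔷]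
    (B : 𝔳 →ₗ[ℝ] 𝔳 →ₗ[ℝ] 𝔷) (μ : 𝔷) : 𝔳 →L[ℝ] 𝔳 :=
  LinearMap.toContinuousLinearMap
    { toFun := fun V => (InnerProductSpace.toDual ℝ 𝔳).symm
        (LinearMap.toContinuousLinearMap ((innerSL ℝ μ).toLinearMap ∘ₗ B V))
      map_add' := fun V V' => by
        apply ext_inner_right ℝ
        intro W
        simp [inner_add_left, inner_add_right]
      map_smul' := fun c V => by
        apply ext_inner_right ℝ
        intro W
        simp [inner_smul_left, inner_smul_right] }

theorem inner_JOp {𝔳 𝔷 : Type*} [NormedAddCommGroup 𝔳] [InnerProductSpace ℝ 𝔳]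
    [FiniteDimensional ℝ 𝔳] [NormedAddCommGroup 𝔷] [InnerProductSpace ℝ 𝔷]
    (B : 𝔳 →ₗ[ℝ] 𝔳 →ₗ[ℝ] 𝔷) (μ : 𝔷) (V W : 𝔳) :
    inner ℝ (JOp B μ V) W = inner ℝ μ (B V W) := by
  simp [JOp]

/-- An H-type Lie algebra `𝔤 = 𝔳 ⊕ 𝔷` (orthogonal sum), given by its bracket `𝔳 × 𝔳 → 𝔷`; all brackets
with an element of `𝔷` vanish. Charges and frequencies in `𝔷*` and
velocities in `𝔳*` are identified with elements of `𝔷` and `𝔳` through the inner product. For `𝔳 ≠ 0`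
and `𝔷 ≠ 0` the H-type condition forces `[𝔳, 𝔳] = 𝔷` and makes `𝔷` exactly the centre. -/
structure HTypeAlgebra (𝔳 𝔷 : Type*) [NormedAddCommGroup 𝔳] [InnerProductSpace ℝ 𝔳]
    [FiniteDimensional ℝ 𝔳] [NormedAddCommGroup 𝔷] [InnerProductSpace ℝ 𝔷] where
  bracket : 𝔳 →ₗ[ℝ] 𝔳 →ₗ[ℝ] 𝔷
  bracket_self : ∀ V, bracket V V = 0
  J_sq : ∀ (μ : 𝔷) (V : 𝔳), JOp bracket μ (JOp bracket μ V) = -(‖μ‖ ^ 2) • V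

/-- The H-type group: `𝔳 × 𝔷` with the Baker-Campbell-Hausdorff (Dynkin) product. -/
def HTypeGroup {𝔳 𝔷 : Type*} [NormedAddCommGroup 𝔳] [InnerProductSpace ℝ 𝔳]
    [FiniteDimensional ℝ 𝔳] [NormedAddCommGroup 𝔷] [InnerProductSpace ℝ 𝔷]
    (_A : HTypeAlgebra 𝔳 𝔷) : Type _ := 𝔳 × 𝔷

namespace HTypeGroup

variable {𝔳 𝔷 : Type*} [NormedAddCommGroup 𝔳] [InnerProductSpace ℝ 𝔳]
  [FiniteDimensional ℝ 𝔳] [NormedAddCommGroup 𝔷] [InnerProductSpace ℝ 𝔷]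
  (A : HTypeAlgebra 𝔳 𝔷)

/-- The point with exponential coordinates `(x, u)`. -/
def mk (x : 𝔳) (u : 𝔷) : HTypeGroup A := (x, u)

instance : Mul (HTypeGroup A) :=
  ⟨fun p q => (p.1 + q.1, p.2 + q.2 + (1 / 2 : ℝ) • A.bracket p.1 q.1)⟩

instance : One (HTypeGroup A) := ⟨((0 : 𝔳), (0 : 𝔷))⟩

instance : Inv (HTypeGroup A) := ⟨fun p => (-p.1, -p.2)⟩

theorem mul_def (p q : HTypeGroup A) :
    p * q = (p.1 + q.1, p.2 + q.2 + (1 / 2 : ℝ) • A.bracket p.1 q.1) := rfl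

instance : Group (HTypeGroup A) :=
  Group.ofLeftAxioms
    (fun p q r => by
      refine Prod.ext ?_ ?_
      · exact add_assoc p.1 q.1 r.1
      · change p.2 + q.2 + (1 / 2 : ℝ) • A.bracket p.1 q.1 + r.2
            + (1 / 2 : ℝ) • A.bracket (p.1 + q.1) r.1
          = p.2 + (q.2 + r.2 + (1 / 2 : ℝ) • A.bracket q.1 r.1)
            + (1 / 2 : ℝ) • A.bracket p.1 (q.1 + r.1)
        simp only [map_add, LinearMap.add_apply, smul_add]
        abel)
    (fun p => by
      refine Prod.ext ?_ ?_
      · exact zero_add p.1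
      · change (0 : 𝔷) + p.2 + (1 / 2 : ℝ) • A.bracket 0 p.1 = p.2
        simp)
    (fun p => by
      refine Prod.ext ?_ ?_
      · exact neg_add_cancel p.1
      · change -p.2 + p.2 + (1 / 2 : ℝ) • A.bracket (-p.1) p.1 = 0
        simp [A.bracket_self])

/-- Haar measure on the group: Lebesgue measure of the Euclidean space `𝔳 ⊕ 𝔷`. -/
instance [MeasurableSpace 𝔳] [BorelSpace 𝔳] [FiniteDimensional ℝ 𝔷] [MeasurableSpace 𝔷]
    [BorelSpace 𝔷] : MeasureSpace (HTypeGroup A) :=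
  inferInstanceAs (MeasureSpace (𝔳 × 𝔷))

end HTypeGroup

namespace HTypeAlgebra

variable {𝔳 𝔷 : Type*} [NormedAddCommGroup 𝔳] [InnerProductSpace ℝ 𝔳]
  [FiniteDimensional ℝ 𝔳] [NormedAddCommGroup 𝔷] [InnerProductSpace ℝ 𝔷]
  (A : HTypeAlgebra 𝔳 𝔷)

/-- `J_μ` for the H-type algebra `A`. -/
def J (μ : 𝔷) : 𝔳 →L[ℝ] 𝔳 := JOp A.bracket μ

/-- The geodesic of charge `λ ≠ 0` and initial velocity `ν`, in guiding centre coordinates,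
`γ_{ν,λ}(s) = (J_λ⁻¹ e^{s J_λ} ν, s |ν|² λ / (2|λ|²))`. -/
def geodesic (ν : 𝔳) (lam : 𝔷) (s : ℝ) : HTypeGroup A :=
  HTypeGroup.mk A (Ring.inverse (A.J lam) (NormedSpace.exp (s • A.J lam) ν))
    ((s * ‖ν‖ ^ 2 / (2 * ‖lam‖ ^ 2)) • lam)

/-- The X-ray transform `I_{ν,λ} f (x,u) = ∫ f((x,u) γ_{ν,λ}(s)) ds`. For `f ∈ L¹(G)`, `λ ≠ 0`, the
integral converges absolutely for almost every `(x,u)`, and this is the continuous extension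
`L¹(G) → L¹(G/Γ_λ)` of the X-ray transform from `C_c^∞(G)`. -/
def xray (ν : 𝔳) (lam : 𝔷) (f : HTypeGroup A → ℂ) (g : HTypeGroup A) : ℂ :=
  ∫ s : ℝ, f (g * A.geodesic ν lam s)

end HTypeAlgebra

/-- The relation `ℜ` of compatible pairs `(λ, μ)` of nonzero charges and frequencies. -/
def compatible (𝔷 : Type*) [NormedAddCommGroup 𝔷] [InnerProductSpace ℝ 𝔷] : Set (𝔷 × 𝔷) :=
  {p | p.1 ≠ 0 ∧ p.2 ≠ 0 ∧ ∃ k : ℤ, inner ℝ p.1 p.2 = 2 * (k : ℝ) * ‖p.1‖ ^ 3}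

/-- The relation `ℜ_odd`: compatible pairs for which `k` is odd. -/
def compatibleOdd (𝔷 : Type*) [NormedAddCommGroup 𝔷] [InnerProductSpace ℝ 𝔷] : Set (𝔷 × 𝔷) :=
  {p | p.1 ≠ 0 ∧ p.2 ≠ 0 ∧ ∃ k : ℤ, Odd k ∧ inner ℝ p.1 p.2 = 2 * (k : ℝ) * ‖p.1‖ ^ 3}

/-- The Heisenberg algebra `ℂⁿ ⊕ ℝ` with `[z, w] = Im(z̄ · w)`. -/
def heisenberg (n : ℕ) : HTypeAlgebra (EuclideanSpace ℂ (Fin n)) ℝ where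
  bracket := LinearMap.mk₂ ℝ (fun z w => (inner ℂ z w).im)
    (fun z z' w => by simp)
    (fun c z w => by
      rw [← Complex.coe_smul, inner_smul_left]; simp)
    (fun z w w' => by simp)
    (fun c z w => by
      rw [← Complex.coe_smul, inner_smul_right]; simp)
  bracket_self := fun z => by
    exact inner_self_im (𝕜 := ℂ) z
  J_sq := by
    intro μ V
    have key : ∀ V : EuclideanSpace ℂ (Fin n), JOp (LinearMap.mk₂ ℝ
        (fun z w : EuclideanSpace ℂ (Fin n) => (inner ℂ z w).im)
        (fun z z' w => by simp)
        (fun c z w => by rw [← Complex.coe_smul, inner_smul_left]; simp)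
        (fun z w w' => by simp)
        (fun c z w => by rw [← Complex.coe_smul, inner_smul_right]; simp)) μ V
          = ((μ : ℂ) * Complex.I) • V := by
      intro V
      apply ext_inner_right ℝ
      intro W
      rw [inner_JOp]
      have h : ∀ a b : EuclideanSpace ℂ (Fin n), inner ℝ a b = (inner ℂ a b).re := by
        intro a b
        simp [PiLp.inner_apply, Complex.inner]
      rw [h, inner_smul_left]
      simp [mul_comm]
    rw [key, key, smul_smul]
    have : ((μ : ℂ) * Complex.I) * ((μ : ℂ) * Complex.I) = ((-(‖μ‖ ^ 2) : ℝ) : ℂ) := by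
      rw [Real.norm_eq_abs, sq_abs]
      push_cast
      linear_combination (μ : ℂ) ^ 2 * Complex.I_sq
    rw [this, Complex.coe_smul]


/-- Bargmann-Fock space `𝓕(ℂⁿ)`, as a space of functions: holomorphic `F` with
`∫ |F(ζ)|² e^{-|ζ|²} dζ < ∞`. -/
def fockSubmodule (n : ℕ) : Submodule ℂ (EuclideanSpace ℂ (Fin n) → ℂ) where
  carrier := {F | Differentiable ℂ F ∧
    Integrable (fun ζ => ‖F ζ‖ ^ 2 * Real.exp (-‖ζ‖ ^ 2))}
  zero_mem' := ⟨differentiable_const 0, by simp⟩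
  add_mem' := by
    rintro F G ⟨hF, hF'⟩ ⟨hG, hG'⟩
    refine ⟨hF.add hG, ?_⟩
    refine Integrable.mono' ((hF'.add hG').const_mul 2) ?_ (Filter.Eventually.of_forall ?_)
    · have h1 := hF.continuous
      have h2 := hG.continuous
      exact (((h1.add h2).norm.pow 2).mul (by fun_prop)).aestronglyMeasurable
    · intro ζ
      have h1 : ‖F ζ + G ζ‖ ≤ ‖F ζ‖ + ‖G ζ‖ := norm_add_le _ _
      have h2 : ‖F ζ + G ζ‖ ^ 2 ≤ 2 * (‖F ζ‖ ^ 2 + ‖G ζ‖ ^ 2) := by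
        nlinarith [sq_nonneg (‖F ζ‖ - ‖G ζ‖), norm_nonneg (F ζ + G ζ)]
      simp only [Pi.add_apply]
      rw [Real.norm_of_nonneg (by positivity)]
      nlinarith [Real.exp_pos (-‖ζ‖ ^ 2)]
  smul_mem' := by
    rintro c F ⟨hF, hF'⟩
    refine ⟨hF.const_smul c, ?_⟩
    refine (hF'.const_mul (‖c‖ ^ 2)).congr (Filter.Eventually.of_forall fun ζ => ?_)
    simp [mul_pow, mul_assoc]

/-- Bargmann-Fock space `𝓕(ℂⁿ)` with its Hilbert space inner product, see `fock_inner_def`. -/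
def Fock (n : ℕ) : Type := fockSubmodule n

namespace Fock

variable {n : ℕ}

instance : AddCommGroup (Fock n) := inferInstanceAs (AddCommGroup (fockSubmodule n))

instance : Module ℂ (Fock n) := inferInstanceAs (Module ℂ (fockSubmodule n))

/-- The holomorphic function underlying an element of Fock space. -/
def toFun (F : Fock n) : EuclideanSpace ℂ (Fin n) → ℂ := F.1

instance : CoeFun (Fock n) (fun _ => EuclideanSpace ℂ (Fin n) → ℂ) := ⟨toFun⟩

@[ext] theorem ext {F G : Fock n} (h : ∀ ζ, F ζ = G ζ) : F = G := Subtype.ext (funext h)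

@[simp] theorem add_apply (F G : Fock n) (ζ : EuclideanSpace ℂ (Fin n)) :
    (F + G) ζ = F ζ + G ζ := rfl

@[simp] theorem smul_apply (c : ℂ) (F : Fock n) (ζ : EuclideanSpace ℂ (Fin n)) :
    (c • F) ζ = c * F ζ := rfl

theorem differentiable (F : Fock n) : Differentiable ℂ F := F.2.1

theorem integrable (F : Fock n) :
    Integrable (fun ζ => ‖F ζ‖ ^ 2 * Real.exp (-‖ζ‖ ^ 2)) := F.2.2

/-- An element of Fock space from a holomorphic function of finite norm. -/
def mk (F : EuclideanSpace ℂ (Fin n) → ℂ) (hF : Differentiable ℂ F)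
    (hF' : Integrable (fun ζ => ‖F ζ‖ ^ 2 * Real.exp (-‖ζ‖ ^ 2))) : Fock n := ⟨F, hF, hF'⟩

@[simp] theorem mk_apply (F : EuclideanSpace ℂ (Fin n) → ℂ) (hF : Differentiable ℂ F)
    (hF' : Integrable (fun ζ => ‖F ζ‖ ^ 2 * Real.exp (-‖ζ‖ ^ 2)))
    (ζ : EuclideanSpace ℂ (Fin n)) : mk F hF hF' ζ = F ζ := rfl

theorem integrable_mul (F G : Fock n) :
    Integrable (fun ζ => starRingEnd ℂ (F ζ) * G ζ * (Real.exp (-‖ζ‖ ^ 2) : ℂ)) := by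
  refine Integrable.mono' (F.integrable.add G.integrable) ?_ (Filter.Eventually.of_forall ?_)
  · have h1 := F.differentiable.continuous
    have h2 := G.differentiable.continuous
    have h3 : Continuous fun ζ => starRingEnd ℂ (F ζ) := Complex.continuous_conj.comp h1
    exact Continuous.aestronglyMeasurable (by fun_prop)
  · intro ζ
    have h : ‖F ζ‖ * ‖G ζ‖ ≤ ‖F ζ‖ ^ 2 + ‖G ζ‖ ^ 2 := by
      nlinarith [sq_nonneg (‖F ζ‖ - ‖G ζ‖), sq_nonneg (‖F ζ‖ + ‖G ζ‖)]
    simp only [norm_mul, RCLike.norm_conj, Complex.norm_real, Real.norm_eq_abs, Real.abs_exp,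
      Pi.add_apply]
    nlinarith [Real.exp_pos (-‖ζ‖ ^ 2)]

theorem self_term (F : Fock n) (ζ : EuclideanSpace ℂ (Fin n)) :
    starRingEnd ℂ (F ζ) * F ζ * (Real.exp (-‖ζ‖ ^ 2) : ℂ)
      = ((‖F ζ‖ ^ 2 * Real.exp (-‖ζ‖ ^ 2) : ℝ) : ℂ) := by
  rw [mul_comm (starRingEnd ℂ (F ζ)), Complex.mul_conj, Complex.normSq_eq_norm_sq]
  push_cast
  ring

/-- `⟪F, G⟫ = π⁻ⁿ ∫ conj(F(ζ)) G(ζ) e^{-|ζ|²} dζ`. -/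
@[reducible] def core (n : ℕ) : InnerProductSpace.Core ℂ (Fock n) where
  inner F G := ((Real.pi ^ n)⁻¹ : ℝ) *
    ∫ ζ, starRingEnd ℂ (F ζ) * G ζ * (Real.exp (-‖ζ‖ ^ 2) : ℂ)
  conj_inner_symm F G := by
    change starRingEnd ℂ (_ * _) = _ * _
    rw [map_mul, Complex.conj_ofReal, ← integral_conj]
    congr 2
    funext ζ
    simp only [map_mul, Complex.conj_conj, Complex.conj_ofReal]
    ring
  re_inner_nonneg F := by
    simp_rw [self_term]
    rw [integral_complex_ofReal, ← Complex.ofReal_mul]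
    rw [RCLike.re_eq_complex_re, Complex.ofReal_re]
    have : 0 ≤ ∫ ζ, ‖F ζ‖ ^ 2 * Real.exp (-‖ζ‖ ^ 2) :=
      integral_nonneg fun ζ => by positivity
    positivity
  add_left F G H := by
    rw [← mul_add, ← integral_add (integrable_mul F H) (integrable_mul G H)]
    congr 2
    funext ζ
    simp only [add_apply, map_add]
    ring
  smul_left F G c := by
    rw [mul_left_comm, ← integral_const_mul (starRingEnd ℂ c)]
    congr 2
    funext ζ
    simp only [smul_apply, map_mul]
    ring
  definite F h := by
    change (_ * _ : ℂ) = 0 at h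
    simp_rw [self_term] at h
    rw [integral_complex_ofReal, ← Complex.ofReal_mul, Complex.ofReal_eq_zero] at h
    have hpi : (Real.pi ^ n)⁻¹ ≠ 0 := by positivity
    have h0 := (mul_eq_zero.mp h).resolve_left hpi
    rw [integral_eq_zero_iff_of_nonneg (fun ζ => by positivity) F.integrable] at h0
    have hc := F.differentiable.continuous
    have h1 := Continuous.ae_eq_iff_eq volume (by fun_prop) continuous_const |>.mp h0
    ext ζ
    have h2 := congrFun h1 ζ
    have h3 := (Real.exp_pos (-‖ζ‖ ^ 2)).ne'
    have h4 : ‖F ζ‖ ^ 2 = 0 := by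
      rcases mul_eq_zero.mp h2 with h | h
      · exact h
      · exact absurd h h3
    exact norm_eq_zero.mp (pow_eq_zero_iff two_ne_zero |>.mp h4)

instance : NormedAddCommGroup (Fock n) := (core n).toNormedAddCommGroup

instance : InnerProductSpace ℂ (Fock n) := InnerProductSpace.ofCore (core n).toCore

end Fock

theorem fock_inner_def {n : ℕ} (F G : Fock n) :
    inner ℂ F G = ((Real.pi ^ n)⁻¹ : ℝ) *
      ∫ ζ, starRingEnd ℂ (F ζ) * G ζ * (Real.exp (-‖ζ‖ ^ 2) : ℂ) := rfl

theorem fock_norm_sq {n : ℕ} (F : Fock n) :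
    ‖F‖ ^ 2 = (Real.pi ^ n)⁻¹ * ∫ ζ, ‖F ζ‖ ^ 2 * Real.exp (-‖ζ‖ ^ 2) := by
  have h : ((‖F‖ ^ 2 : ℝ) : ℂ) = inner ℂ F F := by
    rw [inner_self_eq_norm_sq_to_K]; push_cast; rfl
  rw [fock_inner_def] at h
  simp_rw [Fock.self_term] at h
  rw [integral_complex_ofReal, ← Complex.ofReal_mul] at h
  exact_mod_cast h

/-- The exponential factor of the Bargmann-Fock representation. -/
def bargmannFactor {n : ℕ} (h : ℝ) (z : EuclideanSpace ℂ (Fin n)) (t : ℝ)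
    (ζ : EuclideanSpace ℂ (Fin n)) : ℂ :=
  Complex.exp (Complex.I * h * t - (√(h / 2) : ℝ) * inner ℂ z ζ - (h / 4) * ‖z‖ ^ 2)

theorem bargmann_density {n : ℕ} (h : ℝ) (hh : 0 ≤ h) (z : EuclideanSpace ℂ (Fin n)) (t : ℝ)
    (F : EuclideanSpace ℂ (Fin n) → ℂ) (ζ : EuclideanSpace ℂ (Fin n)) :
    ‖bargmannFactor h z t ζ * F (ζ + (√(h / 2) : ℂ) • z)‖ ^ 2 * Real.exp (-‖ζ‖ ^ 2)
      = ‖F (ζ + (√(h / 2) : ℂ) • z)‖ ^ 2 *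
        Real.exp (-‖ζ + (√(h / 2) : ℂ) • z‖ ^ 2) := by
  have hs : √(h / 2) ^ 2 = h / 2 := Real.sq_sqrt (by positivity)
  rw [norm_mul, mul_pow, bargmannFactor, Complex.norm_exp, ← Real.exp_nat_mul, mul_right_comm,
    ← Real.exp_add, mul_comm]
  congr 2
  rw [@norm_add_sq ℂ, inner_smul_right, norm_smul, mul_pow, Complex.norm_real, Real.norm_eq_abs,
    sq_abs, hs, ← inner_conj_symm ζ z]
  have e1 : ((h : ℂ) / 4 * (‖z‖ : ℂ) ^ 2).re = h / 4 * ‖z‖ ^ 2 := by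
    rw [show ((h : ℂ) / 4 * (‖z‖ : ℂ) ^ 2) = ((h / 4 * ‖z‖ ^ 2 : ℝ) : ℂ) by push_cast; ring,
      Complex.ofReal_re]
  have e2 : (inner ℂ ζ z).re = (inner ℂ z ζ).re := by
    rw [← inner_conj_symm, Complex.conj_re]
  simp [e1, e2]
  ring

/-- The operator `π_h(z,t)`, for `h ≥ 0`:
`(π_h(z,t) F)(ζ) = e^{iht - √(h/2) ζ·z̄ - h|z|²/4} F(ζ + √(h/2) z)`. -/
def bargmannLinear {n : ℕ} (h : ℝ) (hh : 0 ≤ h) (z : EuclideanSpace ℂ (Fin n)) (t : ℝ) :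
    Fock n →ₗ[ℂ] Fock n where
  toFun F := Fock.mk (fun ζ => bargmannFactor h z t ζ * F (ζ + (√(h / 2) : ℂ) • z))
    (by
      have h1 := F.differentiable
      have h2 : Differentiable ℂ fun ζ : EuclideanSpace ℂ (Fin n) => inner ℂ z ζ :=
        (innerSL ℂ z).differentiable
      unfold bargmannFactor
      exact ((((differentiable_const _).sub (h2.const_mul _)).sub
        (differentiable_const _)).cexp).mul (h1.comp (differentiable_id.add_const _)))
    (by
      simp_rw [bargmann_density h hh z t F]
      exact F.integrable.comp_add_right ((√(h / 2) : ℂ) • z))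
  map_add' F G := by
    ext ζ
    simp only [Fock.mk_apply, Fock.add_apply]
    ring
  map_smul' c F := by
    ext ζ
    simp only [Fock.mk_apply, Fock.smul_apply, RingHom.id_apply]
    ring

theorem bargmannLinear_apply {n : ℕ} (h : ℝ) (hh : 0 ≤ h) (z : EuclideanSpace ℂ (Fin n)) (t : ℝ)
    (F : Fock n) (ζ : EuclideanSpace ℂ (Fin n)) :
    bargmannLinear h hh z t F ζ
      = bargmannFactor h z t ζ * F (ζ + (√(h / 2) : ℂ) • z) := rfl

theorem norm_bargmannLinear {n : ℕ} (h : ℝ) (hh : 0 ≤ h) (z : EuclideanSpace ℂ (Fin n)) (t : ℝ)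
    (F : Fock n) : ‖bargmannLinear h hh z t F‖ = ‖F‖ := by
  have : ‖bargmannLinear h hh z t F‖ ^ 2 = ‖F‖ ^ 2 := by
    rw [fock_norm_sq, fock_norm_sq]
    simp_rw [bargmannLinear_apply, bargmann_density h hh z t F]
    rw [integral_add_right_eq_self
      (fun ζ => ‖F ζ‖ ^ 2 * Real.exp (-‖ζ‖ ^ 2)) ((√(h / 2) : ℂ) • z)]
  exact (sq_eq_sq₀ (norm_nonneg _) (norm_nonneg _)).mp this

theorem bargmannLinear_mul {n : ℕ} (h : ℝ) (hh : 0 ≤ h) (p q : HTypeGroup (heisenberg n)) :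
    bargmannLinear h hh (p * q).1 (p * q).2
      = bargmannLinear h hh p.1 p.2 ∘ₗ bargmannLinear h hh q.1 q.2 := by
  have hs : ((√(h / 2) : ℝ) : ℂ) * (√(h / 2) : ℝ) = h / 2 := by
    rw [← Complex.ofReal_mul, Real.mul_self_sqrt (by positivity)]; push_cast; rfl
  obtain ⟨z, t⟩ := p
  obtain ⟨w, s⟩ := q
  ext F ζ
  change bargmannFactor h (z + w) (t + s + (1 / 2 : ℝ) • (inner ℂ z w).im) ζ *
      F (ζ + (√(h / 2) : ℂ) • (z + w))
    = bargmannFactor h z t ζ * (bargmannFactor h w s (ζ + (√(h / 2) : ℂ) • z) *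
      F (ζ + (√(h / 2) : ℂ) • z + (√(h / 2) : ℂ) • w))
  rw [smul_add, ← add_assoc, ← mul_assoc]
  congr 1
  unfold bargmannFactor
  rw [← Complex.exp_add]
  congr 1
  have hn : ((‖z + w‖ : ℂ)) ^ 2 = (‖z‖ : ℂ) ^ 2 + (‖w‖ : ℂ) ^ 2 + inner ℂ z w + inner ℂ w z := by
    have h1 := @inner_self_eq_norm_sq_to_K ℂ _ _ _ _ (z + w)
    have h2 := @inner_self_eq_norm_sq_to_K ℂ _ _ _ _ z
    have h3 := @inner_self_eq_norm_sq_to_K ℂ _ _ _ _ w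
    simp only [inner_add_left, inner_add_right, Complex.coe_algebraMap] at h1 h2 h3
    rw [← h1, ← h2, ← h3]
    ring
  have him : 2 * Complex.I * ((inner ℂ z w).im : ℂ) = inner ℂ z w - inner ℂ w z := by
    rw [← inner_conj_symm w z, Complex.sub_conj, Complex.ofReal_mul, Complex.ofReal_ofNat]
    ring
  rw [hn, inner_add_left, inner_add_right, inner_smul_right]
  rw [show (1 / 2 : ℝ) • (inner ℂ z w).im = 1 / 2 * (inner ℂ z w).im from rfl]
  rw [Complex.ofReal_add, Complex.ofReal_add, Complex.ofReal_mul (1 / 2)]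
  simp only [Complex.ofReal_div, Complex.ofReal_one, Complex.ofReal_ofNat]
  linear_combination (h / 4 : ℂ) * him + inner ℂ w z * hs

theorem bargmannLinear_one {n : ℕ} (h : ℝ) (hh : 0 ≤ h) :
    bargmannLinear h hh (0 : EuclideanSpace ℂ (Fin n)) 0 = LinearMap.id := by
  ext F ζ
  simp [bargmannLinear_apply, bargmannFactor]

/-- The unitary operator `π_h(z,t)` for a point `p = (z,t)` of the Heisenberg group. -/
def bargmannUnitary (n : ℕ) (h : ℝ) (hh : 0 ≤ h) (p : HTypeGroup (heisenberg n)) :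
    Fock n ≃ₗᵢ[ℂ] Fock n where
  toLinearEquiv := LinearEquiv.ofLinearMap (bargmannLinear h hh p.1 p.2)
    (bargmannLinear h hh p⁻¹.1 p⁻¹.2)
    (by
      rw [← bargmannLinear_mul, mul_inv_cancel]
      exact bargmannLinear_one h hh)
    (by
      rw [← bargmannLinear_mul, inv_mul_cancel]
      exact bargmannLinear_one h hh)
  norm_map' := norm_bargmannLinear h hh p.1 p.2

/-- The Bargmann-Fock representation `π_h`, `h ≥ 0`, of the Heisenberg group by unitary operators. -/
def bargmannRep (n : ℕ) (h : ℝ) (hh : 0 ≤ h) :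
    HTypeGroup (heisenberg n) →* (Fock n ≃ₗᵢ[ℂ] Fock n) where
  toFun p := bargmannUnitary n h hh p
  map_one' := LinearIsometryEquiv.ext fun F =>
    congrArg (fun T : Fock n →ₗ[ℂ] Fock n => T F) (bargmannLinear_one h hh)
  map_mul' p q := LinearIsometryEquiv.ext fun F =>
    congrArg (fun T : Fock n →ₗ[ℂ] Fock n => T F) (bargmannLinear_mul h hh p q)

theorem bargmannRep_apply (n : ℕ) (h : ℝ) (hh : 0 ≤ h) (p : HTypeGroup (heisenberg n))
    (F : Fock n) (ζ : EuclideanSpace ℂ (Fin n)) :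
    bargmannRep n h hh p F ζ
      = Complex.exp (Complex.I * h * p.2 - (√(h / 2) : ℝ) * inner ℂ p.1 ζ - (h / 4) * ‖p.1‖ ^ 2)
        * F (ζ + (√(h / 2) : ℂ) • p.1) := rfl

/-- A skew map `j` with `j² = -1` is multiplication by `i` in suitable orthonormal coordinates. -/
theorem exists_complex_coordinates {𝔳 W : Type*} [NormedAddCommGroup 𝔳] [InnerProductSpace ℝ 𝔳]
    [FiniteDimensional ℝ 𝔳] [AddCommGroup W] (e : W ≃+ 𝔳) (j : 𝔳 →ₗ[ℝ] 𝔳)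
    (hjj : ∀ x, j (j x) = -x) (hskew : ∀ x y, inner ℝ (j x) y = -inner ℝ x (j y)) :
    ∃ n, ∃ R : EuclideanSpace ℂ (Fin n) ≃ₗᵢ[ℝ] 𝔳, ∀ z, j (R z) = R (Complex.I • z) := by
  let S : SMul ℂ W := ⟨fun c x => e.symm (c.re • e x + c.im • j (e x))⟩
  have hS : ∀ (c : ℂ) (x : W), e (c • x) = c.re • e x + c.im • j (e x) :=
    fun c x => e.apply_symm_apply _
  let M : Module ℂ W :=
    { one_smul := fun x => e.injective (by rw [hS]; simp)
      mul_smul := fun c d x => e.injective (by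
        rw [hS, hS, hS]
        simp only [map_add, map_smul, hjj, Complex.mul_re, Complex.mul_im]
        module)
      smul_zero := fun c => e.injective (by rw [hS]; simp)
      smul_add := fun c x y => e.injective (by
        rw [hS, map_add e, map_add e, hS, hS, map_add j]
        module)
      add_smul := fun c d x => e.injective (by
        rw [hS, map_add, hS, hS, Complex.add_re, Complex.add_im]
        module)
      zero_smul := fun x => e.injective (by rw [hS]; simp) }
  let core : InnerProductSpace.Core ℂ W :=
    { inner := fun x y => ⟨inner ℝ (e x) (e y), inner ℝ (j (e x)) (e y)⟩
      conj_inner_symm := fun x y => by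
        refine Complex.ext (real_inner_comm _ _) ?_
        change -inner ℝ (j (e y)) (e x) = inner ℝ (j (e x)) (e y)
        rw [hskew (e x) (e y), real_inner_comm]
      re_inner_nonneg := fun x => real_inner_self_nonneg (x := e x)
      add_left := fun x y z => by
        refine Complex.ext ?_ ?_
        · change inner ℝ (e (x + y)) (e z) = inner ℝ (e x) (e z) + inner ℝ (e y) (e z)
          rw [map_add, inner_add_left]
        · change inner ℝ (j (e (x + y))) (e z) = inner ℝ (j (e x)) (e z) + inner ℝ (j (e y)) (e z)
          rw [map_add, map_add, inner_add_left]
      smul_left := fun x y c => by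
        refine Complex.ext ?_ ?_
        · change inner ℝ (e (c • x)) (e y)
            = c.re * inner ℝ (e x) (e y) - -c.im * inner ℝ (j (e x)) (e y)
          rw [hS, inner_add_left, real_inner_smul_left, real_inner_smul_left]
          ring
        · change inner ℝ (j (e (c • x))) (e y)
            = c.re * inner ℝ (j (e x)) (e y) + -c.im * inner ℝ (e x) (e y)
          rw [hS, map_add, map_smul, map_smul, hjj, inner_add_left, real_inner_smul_left,
            real_inner_smul_left, inner_neg_left]
          ring
      definite := fun x h => by
        have h1 : inner ℝ (e x) (e x) = (0 : ℝ) := congrArg Complex.re h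
        exact (map_eq_zero_iff e e.injective).mp (inner_self_eq_zero.mp h1) }
  let N : NormedAddCommGroup W := core.toNormedAddCommGroup
  let P : InnerProductSpace ℂ W := InnerProductSpace.ofCore core.toCore
  have hsm : ∀ (c : ℝ) (x : W), e ((c : ℂ) • x) = c • e x := fun c x => by
    rw [hS]; simp
  have hnorm : ∀ x : W, ‖x‖ = ‖e x‖ := by
    intro x
    have h1 : ‖x‖ ^ 2 = ‖e x‖ ^ 2 := by
      have h2 := @inner_self_eq_norm_sq ℂ W _ _ _ x
      rw [← h2]
      exact real_inner_self_eq_norm_sq (e x)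
    exact (sq_eq_sq₀ (norm_nonneg _) (norm_nonneg _)).mp h1
  have : FiniteDimensional ℂ W := by
    obtain ⟨s, hs⟩ := (inferInstance : Module.Finite ℝ 𝔳)
    classical
    refine ⟨s.image e.symm, ?_⟩
    rw [eq_top_iff]
    intro x _
    have hx : e x ∈ Submodule.span ℝ (s : Set 𝔳) := hs ▸ Submodule.mem_top
    have key : ∀ y ∈ Submodule.span ℝ (s : Set 𝔳),
        e.symm y ∈ Submodule.span ℂ ((s.image e.symm : Finset W) : Set W) := by
      intro y hy
      induction hy using Submodule.span_induction with
      | mem y hy =>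
        exact Submodule.subset_span (by
          rw [Finset.coe_image]; exact Set.mem_image_of_mem _ hy)
      | zero => rw [map_zero]; exact Submodule.zero_mem _
      | add y z _ _ hy hz => rw [map_add]; exact Submodule.add_mem _ hy hz
      | smul c y _ hy =>
        have h1 : e.symm (c • y) = (c : ℂ) • e.symm y := by
          rw [e.symm_apply_eq, hsm, e.apply_symm_apply]
        rw [h1]
        exact Submodule.smul_mem _ _ hy
    have := key _ hx
    rwa [e.symm_apply_apply] at this
  let b := stdOrthonormalBasis ℂ W
  refine ⟨Module.finrank ℂ W, ?_, ?_⟩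
  · exact
      { toFun := fun z => e (b.repr.symm z)
        invFun := fun x => b.repr (e.symm x)
        left_inv := fun z => by simp
        right_inv := fun x => by simp
        map_add' := fun z w => by rw [map_add, map_add]
        map_smul' := fun c z => by
          rw [← Complex.coe_smul, map_smul, hsm]
          rfl
        norm_map' := fun z => by
          change ‖e (b.repr.symm z)‖ = ‖z‖
          rw [← hnorm, b.repr.symm.norm_map] }
  · intro z
    change j (e (b.repr.symm z)) = e (b.repr.symm (Complex.I • z))
    rw [map_smul, hS]
    simp

namespace HTypeAlgebra

variable {𝔳 𝔷 : Type*} [NormedAddCommGroup 𝔳] [InnerProductSpace ℝ 𝔳]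
  [FiniteDimensional ℝ 𝔳] [NormedAddCommGroup 𝔷] [InnerProductSpace ℝ 𝔷]
  (A : HTypeAlgebra 𝔳 𝔷)

theorem inner_J (μ : 𝔷) (V W : 𝔳) : inner ℝ (A.J μ V) W = inner ℝ μ (A.bracket V W) :=
  inner_JOp A.bracket μ V W

theorem inner_J_left (μ : 𝔷) (V W : 𝔳) : inner ℝ (A.J μ V) W = -inner ℝ V (A.J μ W) := by
  have h := A.bracket_self (V + W)
  simp only [map_add, LinearMap.add_apply, A.bracket_self, zero_add, add_zero] at h
  rw [inner_J, real_inner_comm (A.J μ W) V, inner_J, ← inner_neg_right]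
  congr 1
  exact eq_neg_of_add_eq_zero_right h

/-- An orthogonal transformation `R_μ : ℝ²ⁿ = ℂⁿ → 𝔳` with `J_μ = |μ| R_μ J R_μᵗ`, where `J` is
multiplication by `i` on `ℂⁿ`. -/
structure NormalForm (μ : 𝔷) (n : ℕ) where
  R : EuclideanSpace ℂ (Fin n) ≃ₗᵢ[ℝ] 𝔳
  J_eq : ∀ z, A.J μ (R z) = ‖μ‖ • R (Complex.I • z)

/-- Existence of the orthogonal transformations `R_μ`. -/
theorem exists_normalForm (μ : 𝔷) (hμ : μ ≠ 0) : ∃ n, Nonempty (A.NormalForm μ n) := by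
  have hn : ‖μ‖ ≠ 0 := norm_ne_zero_iff.mpr hμ
  obtain ⟨n, R, hR⟩ := exists_complex_coordinates (AddEquiv.refl 𝔳)
    (‖μ‖⁻¹ • A.J μ : 𝔳 →L[ℝ] 𝔳).toLinearMap
    (fun x => by
      have h : A.J μ (A.J μ x) = -(‖μ‖ ^ 2) • x := A.J_sq μ x
      have h2 : ‖μ‖⁻¹ * ‖μ‖⁻¹ * -(‖μ‖ ^ 2) = -1 := by field_simp
      change ‖μ‖⁻¹ • A.J μ (‖μ‖⁻¹ • A.J μ x) = -x
      rw [map_smul, h, smul_smul, smul_smul, h2, neg_one_smul])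
    (fun x y => by
      change inner ℝ (‖μ‖⁻¹ • A.J μ x) y = -inner ℝ x (‖μ‖⁻¹ • A.J μ y)
      rw [real_inner_smul_left, real_inner_smul_right, A.inner_J_left]
      ring)
  refine ⟨n, ⟨⟨R, fun z => ?_⟩⟩⟩
  have h : ‖μ‖⁻¹ • A.J μ (R z) = R (Complex.I • z) := hR z
  rw [← h, smul_smul, mul_inv_cancel₀ hn, one_smul]

variable {A}

/-- The homomorphism `α_μ : G → ℍ_n`, `α_μ(x,u) = (R_μᵗ x, μ·u / |μ|)`. -/
def NormalForm.alpha {μ : 𝔷} {n : ℕ} (N : A.NormalForm μ n) (hμ : μ ≠ 0) :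
    HTypeGroup A →* HTypeGroup (heisenberg n) :=
  MonoidHom.mk' (fun p => HTypeGroup.mk (heisenberg n) (N.R.symm p.1) (inner ℝ μ p.2 / ‖μ‖))
    (by
      intro p q
      have hn : ‖μ‖ ≠ 0 := norm_ne_zero_iff.mpr hμ
      refine Prod.ext ?_ ?_
      · exact map_add N.R.symm p.1 q.1
      · change inner ℝ μ (p.2 + q.2 + (1 / 2 : ℝ) • A.bracket p.1 q.1) / ‖μ‖
          = inner ℝ μ p.2 / ‖μ‖ + inner ℝ μ q.2 / ‖μ‖
            + (1 / 2 : ℝ) * (inner ℂ (N.R.symm p.1) (N.R.symm q.1)).im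
        have h1 : inner ℝ μ (A.bracket p.1 q.1)
            = ‖μ‖ * (inner ℂ (N.R.symm p.1) (N.R.symm q.1)).im := by
          have hr : ∀ a b : EuclideanSpace ℂ (Fin n), inner ℝ a b = (inner ℂ a b).re := by
            intro a b
            simp [PiLp.inner_apply, Complex.inner]
          rw [← A.inner_J]
          conv_lhs => rw [← N.R.apply_symm_apply p.1, ← N.R.apply_symm_apply q.1]
          rw [N.J_eq, real_inner_smul_left, N.R.inner_map_map, hr, inner_smul_left]
          simp
        rw [inner_add_right, inner_add_right, real_inner_smul_right, h1]
        field_simp)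

/-- The irreducible unitary representation `π_μ = π_{|μ|} ∘ α_μ` of `G` on `𝓕(ℂⁿ)`. -/
def NormalForm.rep {μ : 𝔷} {n : ℕ} (N : A.NormalForm μ n) (hμ : μ ≠ 0) :
    HTypeGroup A →* (Fock n ≃ₗᵢ[ℂ] Fock n) :=
  (bargmannRep n ‖μ‖ (norm_nonneg μ)).comp (N.alpha hμ)

/-- The bounded operator `T` on `𝓕(ℂⁿ)` is the group Fourier transform
`𝓕(f)(μ) = ∫ f(g) π_μ(g)^* dg`, as a weakly convergent operator-valued integral. Here the adjoint of
the unitary operator `π_μ(g)` is its inverse. -/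
def NormalForm.IsFourierTransform [FiniteDimensional ℝ 𝔷] [MeasurableSpace 𝔳] [BorelSpace 𝔳]
    [MeasurableSpace 𝔷] [BorelSpace 𝔷] {μ : 𝔷} {n : ℕ} (N : A.NormalForm μ n) (hμ : μ ≠ 0)
    (f : HTypeGroup A → ℂ) (T : Fock n →L[ℂ] Fock n) : Prop :=
  ∀ φ ψ : Fock n, Integrable (fun g => f g * inner ℂ ψ ((N.rep hμ g)⁻¹ φ)) ∧
    inner ℂ ψ (T φ) = ∫ g, f g * inner ℂ ψ ((N.rep hμ g)⁻¹ φ)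

end HTypeAlgebra

end

/-! If μ is compatible with the charge λ, the geodesic closes up after time T = 2π/|λ| modulo the
central element κ = (π/|λ|³)λ, and π_μ(0,κ) = e^{i⟨μ,κ⟩} = e^{2πik} = 1. Functions built from π_μ
are only bounded on G, but they are invariant under κ, so the vanishing line integrals of f fold to
one period (`integral_mul_period_mean_eq_zero`). Since right translation of π_μ(g)⁻¹φ by a curve
point acts through π_μ of that point, the conclusion is that ∫₀ᵀ π_μ(γ(s)) ds kills F = 𝓕(f)(μ)φ for
every φ. Here F(ζ) = ∫ f(g) (π_μ(g)⁻¹φ)(ζ) dg makes sense pointwise, because unitarity and the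
growth bound in Fock space control the integrand uniformly in g; F is continuous, and entire on
every complex line.

Written out in Fock space, weighted means of F over circles of radius α = √(|μ|/2)/|λ| vanish, with
the character e^{ikθ} in the weight (`NormalForm.integral_planarCircle_eq_zero`). With a the cosine
of the angle between λ and μ, compatibility reads k = aα². What remains is a uniqueness theorem for
these means, in two cases.

If λ is parallel to μ, the circles lie in complex lines. On a line ζ₀ + ℂe with ζ₀ ⊥ e the mean maps
the monomial of degree m to a multiple of a monomial, the factor being (-α)^K m!/(K+m)! ·
L_m^{(K)}(α²) with K = |k| and L a Laguerre polynomial. For m = 0 the factor is nonzero; when dim_ℂ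
𝔳 > 1 every point ζ is the foot ζ₀ of such a line, and F = 0. When dim_ℂ 𝔳 = 1 all m are needed.
Here α² = K, and for odd K a parity argument shows L_m^{(K)}(K) ≠ 0 (`laguerreCoef_ne_zero_of_odd`).
For even K this can fail: L_2^{(2)}(2) = 0. Complex dimension one forces dim 𝔷 = 1, so the exception
is the first Heisenberg group.

If λ is not parallel to μ, the component of λ orthogonal to μ acts on ℂⁿ antilinearly and yields a
quaternionic structure τ. The circle becomes e^{iθ} times a vector e' plus e^{-iθ} times a multiple
of τe'. Averaging over the unit sphere of the quaternionic line of e isolates one Taylor coefficient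
of F along ℂe (`integral_hopf_entire`). A free parameter y then shifts the charge k to k + j for all
j ≥ 0, and for fixed degree the Laguerre factor is nonzero at large charge
(`eventually_laguerreCoef_ne_zero`). So F = 0 with no parity condition. -/

open MeasureTheory

noncomputable section

/-! ### Entire functions: parameter integrals, circle averages and Taylor coefficients -/

/-- A dominated integral of entire functions is entire. -/
theorem differentiable_integral_of_bound {X : Type*} [MeasurableSpace X] {m : Measure X}
    {G : X → ℂ → ℂ} (hd : ∀ x, Differentiable ℂ (G x))
    (hm : ∀ z, AEStronglyMeasurable (fun x => G x z) m)
    (hb : ∀ R : ℝ, ∃ b : X → ℝ, Integrable b m ∧ ∀ x z, ‖z‖ ≤ R → ‖G x z‖ ≤ b x) :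
    Differentiable ℂ (fun z => ∫ x, G x z ∂m) := by
  intro z₀
  -- Unit circles about points of the unit ball at z₀ stay within radius ‖z₀‖ + 2, so by Cauchy's
  -- estimate the same b also dominates the derivatives.
  obtain ⟨b, hbi, hbb⟩ := hb (‖z₀‖ + 2)
  have hderiv : ∀ x, ∀ z ∈ Metric.ball z₀ 1, ‖deriv (G x) z‖ ≤ b x := by
    intro x z hz
    have h := Complex.norm_deriv_le_of_forall_mem_sphere_norm_le (c := z) (R := 1) (C := b x)
      (f := G x) one_pos (hd x).diffContOnCl (fun w hw => hbb x w ?_)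
    · simpa using h
    · rw [Metric.mem_ball, dist_eq_norm] at hz
      rw [mem_sphere_iff_norm] at hw
      have h1 := norm_add_le (w - z) z
      have h2 := norm_add_le (z - z₀) z₀
      simp only [sub_add_cancel] at h1 h2
      linarith
  have hmeas : AEStronglyMeasurable (fun x => deriv (G x) z₀) m := by
    -- The derivative is measurable in x as the limit of difference quotients with the steps
    -- 1/(k+1).
    have hseq : Filter.Tendsto (fun k : ℕ => (1 / ((k : ℂ) + 1))) Filter.atTop
        (nhdsWithin 0 {0}ᶜ) := by
      rw [tendsto_nhdsWithin_iff]
      refine ⟨tendsto_one_div_add_atTop_nhds_zero_nat, Filter.Eventually.of_forall fun k => ?_⟩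
      have : (k : ℂ) + 1 ≠ 0 := Nat.cast_add_one_ne_zero k
      simpa using this
    refine aestronglyMeasurable_of_tendsto_ae Filter.atTop
      (f := fun (k : ℕ) x => (1 / ((k : ℂ) + 1))⁻¹ • (G x (z₀ + 1 / ((k : ℂ) + 1)) - G x z₀))
      (fun k => ((hm (z₀ + 1 / ((k : ℂ) + 1))).sub (hm z₀)).const_smul (1 / ((k : ℂ) + 1))⁻¹)
      (Filter.Eventually.of_forall fun x => ?_)
    have h := (hasDerivAt_iff_tendsto_slope_zero.mp ((hd x) z₀).hasDerivAt).comp hseq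
    exact h
  refine (hasDerivAt_integral_of_dominated_loc_of_deriv_le (𝕜 := ℂ) (F := fun z x => G x z)
    (F' := fun z x => deriv (G x) z) (bound := b)
    (Metric.ball_mem_nhds z₀ one_pos) (Filter.Eventually.of_forall hm) ?_ hmeas
    (Filter.Eventually.of_forall hderiv) hbi
    (Filter.Eventually.of_forall fun x z _ => ((hd x) z).hasDerivAt)).2.differentiableAt
  exact hbi.mono' (hm z₀) (Filter.Eventually.of_forall fun x => hbb x z₀ (by linarith))

/-- The Taylor coefficients at the origin of a function of one complex variable. -/
def taylorCoef (u : ℂ → ℂ) (m : ℕ) : ℂ := ((m.factorial : ℂ))⁻¹ * iteratedDeriv m u 0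

theorem hasSum_taylorCoef {u : ℂ → ℂ} (hu : Differentiable ℂ u) (w : ℂ) :
    HasSum (fun m => taylorCoef u m * w ^ m) (u w) := by
  have h := Complex.hasSum_taylorSeries_of_entire hu 0 w
  refine h.congr_fun ?_ 
  intro m
  simp [taylorCoef]; ring

theorem integral_exp_int (m : ℤ) :
    ∫ φ in (0 : ℝ)..(2 * Real.pi), Complex.exp (Complex.I * m * φ)
      = if m = 0 then 2 * Real.pi else 0 := by
  split_ifs with h
  · simp [h]
  · have hm : Complex.I * (m : ℂ) ≠ 0 := mul_ne_zero Complex.I_ne_zero (by exact_mod_cast h)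
    rw [integral_exp_mul_complex hm]
    have : Complex.exp (Complex.I * m * ((2 * Real.pi : ℝ) : ℂ)) = 1 := by
      rw [Complex.exp_eq_one_iff]
      exact ⟨m, by push_cast; ring⟩
    rw [this]
    simp

theorem norm_exp_I_mul (x : ℝ) : ‖Complex.exp (Complex.I * x)‖ = 1 := by
  rw [mul_comm]; exact Complex.norm_exp_ofReal_mul_I x

/-- Circle averages against characters pick out single Taylor coefficients. -/
theorem integral_exp_mul_entire {u : ℂ → ℂ} (hu : Differentiable ℂ u) (m : ℕ) (w : ℂ) :
    ∫ φ in (0 : ℝ)..(2 * Real.pi), Complex.exp (-(Complex.I * m * φ)) *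
        u (w * Complex.exp (Complex.I * φ)) = 2 * Real.pi * (taylorCoef u m * w ^ m) := by
  rw [intervalIntegral.integral_of_le (by positivity)]
  have hs : Summable fun n => ‖taylorCoef u n * w ^ n‖ := (hasSum_taylorCoef hu w).summable.norm
  have hterm : ∀ (n : ℕ) (φ : ℝ), Complex.exp (-(Complex.I * m * φ)) *
      (taylorCoef u n * (w * Complex.exp (Complex.I * φ)) ^ n)
        = taylorCoef u n * w ^ n * Complex.exp (Complex.I * ((n - m : ℤ) : ℂ) * φ) := by
    intro n φ
    rw [mul_pow, ← Complex.exp_nat_mul]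
    rw [show Complex.I * ((n - m : ℤ) : ℂ) * (φ : ℂ) = -(Complex.I * m * φ)
      + n * (Complex.I * φ) by push_cast; ring, Complex.exp_add]
    ring
  have hc : ∀ n : ℕ, Continuous fun φ : ℝ => Complex.exp (-(Complex.I * m * φ)) *
      (taylorCoef u n * (w * Complex.exp (Complex.I * φ)) ^ n) := by
    intro n; fun_prop
  have hnorm : ∀ (n : ℕ) (φ : ℝ), ‖Complex.exp (-(Complex.I * m * φ)) *
      (taylorCoef u n * (w * Complex.exp (Complex.I * φ)) ^ n)‖ = ‖taylorCoef u n * w ^ n‖ := by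
    intro n φ
    rw [hterm, norm_mul, show Complex.I * ((n - m : ℤ) : ℂ) * (φ : ℂ)
      = Complex.I * (((n - m : ℤ) * φ : ℝ) : ℂ) by push_cast; ring, norm_exp_I_mul, mul_one]
  have h := hasSum_integral_of_summable_integral_norm
    (μ := volume.restrict (Set.Ioc (0 : ℝ) (2 * Real.pi)))
    (F := fun (n : ℕ) (φ : ℝ) => Complex.exp (-(Complex.I * m * φ)) *
      (taylorCoef u n * (w * Complex.exp (Complex.I * φ)) ^ n))
    (fun n => (hc n).integrableOn_Ioc) (by
      simp_rw [hnorm]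
      simp only [integral_const]
      exact hs.const_smul _)
  have h2 : ∀ φ : ℝ, ∑' n : ℕ, Complex.exp (-(Complex.I * m * φ)) *
      (taylorCoef u n * (w * Complex.exp (Complex.I * φ)) ^ n)
      = Complex.exp (-(Complex.I * m * φ)) * u (w * Complex.exp (Complex.I * φ)) := by
    intro φ
    rw [tsum_mul_left, (hasSum_taylorCoef hu _).tsum_eq]
  simp_rw [h2] at h
  refine h.unique ?_
  have h3 : ∀ n : ℕ, ∫ φ in Set.Ioc (0 : ℝ) (2 * Real.pi), Complex.exp (-(Complex.I * m * φ)) *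
      (taylorCoef u n * (w * Complex.exp (Complex.I * φ)) ^ n)
      = if n = m then 2 * Real.pi * (taylorCoef u m * w ^ m) else 0 := by
    intro n
    simp_rw [hterm]
    rw [integral_const_mul, ← intervalIntegral.integral_of_le (by positivity), integral_exp_int]
    split_ifs with h1 h2 h2
    · subst h2; push_cast; ring
    · omega
    · omega
    · simp
  simp_rw [h3]
  exact hasSum_ite_eq m _

theorem taylorCoef_eq_integral {u : ℂ → ℂ} (hu : Differentiable ℂ u) (m : ℕ) :
    taylorCoef u m = (2 * Real.pi : ℂ)⁻¹ * ∫ φ in (0 : ℝ)..(2 * Real.pi),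
      Complex.exp (-(Complex.I * m * φ)) * u (Complex.exp (Complex.I * φ)) := by
  have h := integral_exp_mul_entire hu m 1
  simp only [one_mul, one_pow, mul_one] at h
  rw [h]
  have : (2 * Real.pi : ℂ) ≠ 0 := by
    exact_mod_cast (by positivity : (2 * Real.pi : ℝ) ≠ 0)
  field_simp

/-- Cauchy's estimate, read off from the average over the circle of radius R. -/
theorem norm_taylorCoef_mul_pow_le {u : ℂ → ℂ} (hu : Differentiable ℂ u) (m : ℕ) {R M : ℝ}
    (hR : 0 ≤ R) (hM : ∀ w, ‖w‖ = R → ‖u w‖ ≤ M) : ‖taylorCoef u m‖ * R ^ m ≤ M := by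
  have h := integral_exp_mul_entire hu m (R : ℂ)
  have h1 : ‖∫ φ in (0 : ℝ)..(2 * Real.pi), Complex.exp (-(Complex.I * m * φ)) *
        u (R * Complex.exp (Complex.I * φ))‖ ≤ M * |2 * Real.pi - 0| := by
    refine intervalIntegral.norm_integral_le_of_norm_le_const fun φ _ => ?_
    rw [norm_mul, show -(Complex.I * m * (φ : ℂ)) = Complex.I * ((-(m * φ) : ℝ) : ℂ) by
      push_cast; ring, norm_exp_I_mul, one_mul]
    exact hM _ (by rw [norm_mul, norm_exp_I_mul, mul_one, Complex.norm_real,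
      Real.norm_of_nonneg hR])
  rw [h, norm_mul, norm_mul, norm_mul, norm_pow, Complex.norm_real, Complex.norm_real,
    Real.norm_of_nonneg hR, sub_zero, abs_of_pos (by positivity),
    Real.norm_of_nonneg Real.pi_pos.le, Complex.norm_ofNat] at h1
  have := Real.pi_pos
  nlinarith

theorem eq_zero_of_taylorCoef_eq_zero {u : ℂ → ℂ} (hu : Differentiable ℂ u)
    (h : ∀ m, taylorCoef u m = 0) (w : ℂ) : u w = 0 := by
  have h1 := hasSum_taylorCoef hu w
  simp only [h, zero_mul] at h1
  exact h1.unique hasSum_zero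

theorem taylorCoef_zero (u : ℂ → ℂ) : taylorCoef u 0 = u 0 := by simp [taylorCoef]

theorem taylorCoef_exp (m : ℕ) : taylorCoef Complex.exp m = (m.factorial : ℂ)⁻¹ := by
  simp [taylorCoef, iteratedDeriv_eq_iterate, Complex.iter_deriv_exp]

theorem differentiable_taylorCoef {F : ℂ → ℂ → ℂ} (hF : Continuous (Function.uncurry F))
    (h1 : ∀ y, Differentiable ℂ fun x => F x y) (h2 : ∀ x, Differentiable ℂ (F x)) (p : ℕ) :
    Differentiable ℂ fun y => taylorCoef (fun x => F x y) p := by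
  have he : (fun y => taylorCoef (fun x => F x y) p) = fun y => (2 * Real.pi : ℂ)⁻¹ *
      ∫ φ in Set.Ioc (0 : ℝ) (2 * Real.pi),
        Complex.exp (-(Complex.I * p * φ)) * F (Complex.exp (Complex.I * φ)) y := by
    funext y
    rw [taylorCoef_eq_integral (h1 y), intervalIntegral.integral_of_le (by positivity)]
  rw [he]
  refine (differentiable_integral_of_bound (G := fun (φ : ℝ) y =>
    Complex.exp (-(Complex.I * p * φ)) * F (Complex.exp (Complex.I * φ)) y)
    (fun φ => (h2 _).const_mul _) (fun z => ?_) fun R => ?_).const_mul _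
  · have : Continuous fun φ : ℝ => F (Complex.exp (Complex.I * φ)) z :=
      hF.comp (by fun_prop : Continuous fun φ : ℝ => (Complex.exp (Complex.I * φ), z))
    exact Continuous.aestronglyMeasurable (by fun_prop)
  · obtain ⟨C, hC⟩ := ((isCompact_closedBall (0 : ℂ) 1).prod
      (isCompact_closedBall (0 : ℂ) R)).exists_bound_of_continuousOn hF.continuousOn
    refine ⟨fun _ => C, integrable_const C, fun φ z hz => ?_⟩
    rw [norm_mul, show -(Complex.I * p * (φ : ℂ)) = Complex.I * ((-(p * φ) : ℝ) : ℂ) by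
      push_cast; ring, norm_exp_I_mul, one_mul]
    exact hC (Complex.exp (Complex.I * φ), z) ⟨by simp, by simpa using hz⟩

/-- Termwise integration of the Taylor series of a family of entire functions. -/
theorem hasSum_integral_taylorCoef {X : Type*} [MeasurableSpace X] {m : Measure X}
    [IsFiniteMeasure m] {u : X → ℂ → ℂ} (hu : ∀ x, Differentiable ℂ (u x)) {w ξ : X → ℂ}
    (hwm : AEStronglyMeasurable w m) (hξm : AEStronglyMeasurable ξ m)
    (hum : ∀ p, AEStronglyMeasurable (fun x => taylorCoef (u x) p) m) {R W M : ℝ} (hR : 0 < R)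
    (hw : ∀ᵐ x ∂m, ‖w x‖ ≤ W) (hξ : ∀ᵐ x ∂m, ‖ξ x‖ ≤ R)
    (hM : ∀ᵐ x ∂m, ∀ z, ‖z‖ = 2 * R → ‖u x z‖ ≤ M) :
    HasSum (fun p => ∫ x, w x * (taylorCoef (u x) p * ξ x ^ p) ∂m)
      (∫ x, w x * u x (ξ x) ∂m) := by
  -- The bound M holds on the circle of radius 2R while |ξ| ≤ R, so Cauchy's estimate makes the
  -- terms decay like 2^{-p}, uniformly in x.
  refine hasSum_integral_of_dominated_convergence (fun p _ => W * (M * (1 / 2) ^ p))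
    (fun p => hwm.mul ((hum p).mul (hξm.pow p))) (fun p => ?_)
    (Filter.Eventually.of_forall fun x => ?_) ?_ (Filter.Eventually.of_forall fun x => ?_)
  · filter_upwards [hw, hξ, hM] with x h1 h2 h3
    rw [norm_mul, norm_mul, norm_pow]
    have h4 := norm_taylorCoef_mul_pow_le (hu x) p (by positivity) h3
    have h5 : ‖taylorCoef (u x) p‖ * ‖ξ x‖ ^ p ≤ M * (1 / 2) ^ p := by
      calc ‖taylorCoef (u x) p‖ * ‖ξ x‖ ^ p ≤ ‖taylorCoef (u x) p‖ * R ^ p := by gcongr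
        _ = ‖taylorCoef (u x) p‖ * (2 * R) ^ p * (1 / 2) ^ p := by
          rw [mul_assoc, ← mul_pow]; congr 2; ring
        _ ≤ M * (1 / 2) ^ p := by gcongr
    exact mul_le_mul h1 h5 (by positivity) ((norm_nonneg _).trans h1)
  · exact (summable_geometric_two.mul_left M).mul_left W
  · exact integrable_const _
  · exact (hasSum_taylorCoef (hu x) (ξ x)).mul_left (w x)

/-- A weighted integral over a bounded family of points which kills all monomials `x ^ p * y ^ q`
except `x ^ d` only sees the coefficient of `x ^ d`. -/
theorem integral_eq_taylorCoef_of_moments {X : Type*} [MeasurableSpace X] {m : Measure X}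
    [IsFiniteMeasure m] {F : ℂ → ℂ → ℂ} (hF : Continuous (Function.uncurry F))
    (h1 : ∀ y, Differentiable ℂ fun x => F x y) (h2 : ∀ x, Differentiable ℂ (F x))
    {w ξ η : X → ℂ} (hwm : AEStronglyMeasurable w m) (hξm : AEStronglyMeasurable ξ m)
    (hηm : AEStronglyMeasurable η m) {R W : ℝ} (hR : 0 < R)
    (hw : ∀ᵐ x ∂m, ‖w x‖ ≤ W) (hξ : ∀ᵐ x ∂m, ‖ξ x‖ ≤ R) (hη : ∀ᵐ x ∂m, ‖η x‖ ≤ R) (d : ℕ)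
    (hmom : ∀ p q, ¬(p = d ∧ q = 0) → ∫ x, w x * (ξ x ^ p * η x ^ q) ∂m = 0) :
    ∫ x, w x * F (ξ x) (η x) ∂m
      = taylorCoef (fun x => F x 0) d * ∫ x, w x * ξ x ^ d ∂m := by
  set a : ℕ → ℂ → ℂ := fun p y => taylorCoef (fun x => F x y) p with ha
  have had : ∀ p, Differentiable ℂ (a p) := differentiable_taylorCoef hF h1 h2
  obtain ⟨C, hC⟩ := ((isCompact_closedBall (0 : ℂ) (2 * R)).prod
    (isCompact_closedBall (0 : ℂ) R)).exists_bound_of_continuousOn hF.continuousOn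
  have hs1 := hasSum_integral_taylorCoef (m := m) (u := fun x z => F z (η x))
    (fun x => h1 (η x)) hwm hξm
    (fun p => (had p).continuous.comp_aestronglyMeasurable hηm) hR hw hξ (M := C) (by
      filter_upwards [hη] with x hx z hz
      exact hC (z, η x) ⟨by simp [hz], by simpa using hx⟩)
  refine hs1.unique ?_
  -- The coefficient of x^p is itself entire in y. Expanding it in turn reduces everything to the
  -- moments of x^p y^q, of which only (d, 0) survives.
  have hterm : ∀ p, ∫ x, w x * (taylorCoef (fun z => F z (η x)) p * ξ x ^ p) ∂m
      = if p = d then taylorCoef (fun x => F x 0) d * ∫ x, w x * ξ x ^ d ∂m else 0 := by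
    intro p
    obtain ⟨M, hM⟩ := (isCompact_closedBall (0 : ℂ) (2 * R)).exists_bound_of_continuousOn
      (had p).continuous.continuousOn
    have hs2 := hasSum_integral_taylorCoef (m := m) (u := fun _ => a p) (fun _ => had p)
      (w := fun x => w x * ξ x ^ p) (hwm.mul (hξm.pow p)) hηm
      (fun q => aestronglyMeasurable_const) hR (W := W * R ^ p) (by
        filter_upwards [hw, hξ] with x h3 h4
        rw [norm_mul, norm_pow]
        exact mul_le_mul h3 (by gcongr) (by positivity) ((norm_nonneg _).trans h3)) hη
      (M := M) (Filter.Eventually.of_forall fun x z hz => hM z (by simp [hz]))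
    have he : (fun q => ∫ x, w x * ξ x ^ p * (taylorCoef (a p) q * η x ^ q) ∂m)
        = fun q => if q = 0 then (if p = d then
          taylorCoef (fun x => F x 0) d * ∫ x, w x * ξ x ^ d ∂m else 0) else 0 := by
      funext q
      have : ∀ x, w x * ξ x ^ p * (taylorCoef (a p) q * η x ^ q)
          = taylorCoef (a p) q * (w x * (ξ x ^ p * η x ^ q)) := fun x => by ring
      simp_rw [this]
      rw [integral_const_mul]
      by_cases hq : q = 0
      · by_cases hp : p = d
        · subst hq; subst hp
          simp [ha, taylorCoef_zero]
        · rw [hmom p q (fun h => hp h.1), if_pos hq, if_neg hp, mul_zero]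
      · rw [hmom p q (fun h => hq h.2), if_neg hq, mul_zero]
    rw [he] at hs2
    rw [← hs2.unique (hasSum_ite_eq 0 _)]
    exact integral_congr_ae (Filter.Eventually.of_forall fun x => by simp only [ha]; ring)
  simp_rw [hterm]
  exact hasSum_ite_eq d _

/-! ### Integration over the three-sphere in Hopf coordinates -/

theorem integral_pow_mul_one_sub_pow (a b : ℕ) :
    ∫ r in (0 : ℝ)..1, r ^ a * (1 - r) ^ b
      = (a.factorial * b.factorial : ℝ) / (a + b + 1).factorial := by
  induction b generalizing a with
  | zero =>
    simp only [pow_zero, mul_one, integral_pow, add_zero, Nat.factorial_succ]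
    push_cast
    have : (a.factorial : ℝ) ≠ 0 := by positivity
    field_simp
    simp
  | succ b ih =>
    have h := intervalIntegral.integral_mul_deriv_eq_deriv_mul (a := (0 : ℝ)) (b := 1)
      (u := fun r => (1 - r) ^ (b + 1)) (u' := fun r => -((b + 1 : ℝ) * (1 - r) ^ b))
      (v := fun r => r ^ (a + 1) / (a + 1 : ℝ)) (v' := fun r => r ^ a)
      (fun x _ => by
        have := ((hasDerivAt_id x).const_sub 1).pow (b + 1)
        refine this.congr_deriv ?_
        simp only [id, Nat.add_sub_cancel]
        push_cast
        ring)
      (fun x _ => by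
        have := (hasDerivAt_pow (a + 1) x).div_const (a + 1 : ℝ)
        convert this using 1
        have : (a + 1 : ℝ) ≠ 0 := by positivity
        push_cast
        field_simp
        try simp)
      (Continuous.intervalIntegrable (by fun_prop) _ _)
      (Continuous.intervalIntegrable (by fun_prop) _ _)
    have h0 : ∀ r : ℝ, -((b + 1 : ℝ) * (1 - r) ^ b) * (r ^ (a + 1) / (a + 1 : ℝ))
        = -((b + 1 : ℝ) / (a + 1)) * (r ^ (a + 1) * (1 - r) ^ b) := fun r => by ring
    simp_rw [mul_comm _ ((1 - _ : ℝ) ^ (b + 1))]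
    rw [h]
    simp_rw [h0]
    rw [intervalIntegral.integral_const_mul, ih (a + 1)]
    simp only [sub_self, zero_pow (Nat.succ_ne_zero _), zero_mul, zero_div, mul_zero, zero_sub]
    rw [show a + 1 + b + 1 = a + (b + 1) + 1 by ring, Nat.factorial_succ a, Nat.factorial_succ b]
    have h1 : (a + 1 : ℝ) ≠ 0 := by positivity
    push_cast
    field_simp

/-- The parameter measure `dr dφ dψ` of the three-sphere in Hopf coordinates. -/
def hopfMeasure : Measure (ℝ × ℝ × ℝ) :=
  (volume.restrict (Set.Ioc (0 : ℝ) 1)).prod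
    ((volume.restrict (Set.Ioc (0 : ℝ) (2 * Real.pi))).prod
      (volume.restrict (Set.Ioc (0 : ℝ) (2 * Real.pi))))

/-- First complex Hopf coordinate `√r e^{iφ}`. -/
def hopfFst (p : ℝ × ℝ × ℝ) : ℂ := (√p.1 : ℝ) * Complex.exp (Complex.I * p.2.1)

/-- Second complex Hopf coordinate `√(1 - r) e^{iψ}`. -/
def hopfSnd (p : ℝ × ℝ × ℝ) : ℂ := (√(1 - p.1) : ℝ) * Complex.exp (Complex.I * p.2.2)

theorem continuous_hopfFst : Continuous hopfFst := by unfold hopfFst; fun_prop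

theorem continuous_hopfSnd : Continuous hopfSnd := by unfold hopfSnd; fun_prop

theorem hopfMeasure_eq : hopfMeasure = volume.restrict (Set.Ioc (0 : ℝ) 1 ×ˢ
    (Set.Ioc (0 : ℝ) (2 * Real.pi) ×ˢ Set.Ioc (0 : ℝ) (2 * Real.pi))) := by
  rw [hopfMeasure, Measure.prod_restrict, Measure.prod_restrict]
  rfl

instance : IsFiniteMeasure hopfMeasure := by
  rw [hopfMeasure]; infer_instance

theorem integrable_hopfMeasure {g : ℝ × ℝ × ℝ → ℂ} (hg : Continuous g) :
    Integrable g hopfMeasure := by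
  rw [hopfMeasure_eq]
  refine (hg.continuousOn.integrableOn_compact (isCompact_Icc.prod
    (isCompact_Icc.prod isCompact_Icc))).mono_set
    (Set.prod_mono Set.Ioc_subset_Icc_self
      (Set.prod_mono Set.Ioc_subset_Icc_self Set.Ioc_subset_Icc_self))

theorem ae_hopfMeasure_mem : ∀ᵐ p ∂hopfMeasure, 0 ≤ p.1 ∧ p.1 ≤ 1 := by
  rw [hopfMeasure_eq]
  refine ae_restrict_of_forall_mem (by measurability) fun p hp => ?_
  exact ⟨hp.1.1.le, hp.1.2⟩

theorem norm_sq_hopf {p : ℝ × ℝ × ℝ} (h0 : 0 ≤ p.1) (h1 : p.1 ≤ 1) :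
    ‖hopfFst p‖ ^ 2 + ‖hopfSnd p‖ ^ 2 = 1 := by
  rw [hopfFst, hopfSnd, norm_mul, norm_mul, norm_exp_I_mul, norm_exp_I_mul, mul_one, mul_one,
    Complex.norm_real, Complex.norm_real, Real.norm_eq_abs, Real.norm_eq_abs, sq_abs, sq_abs,
    Real.sq_sqrt h0, Real.sq_sqrt (by linarith)]
  ring

/-- With r = |v₁|² the invariant measure of the sphere is a multiple of dr dφ dψ. The two phases
force A = B and C = D, and the radial factor is then a Beta integral. -/
theorem integral_hopf_monomial (A B C D : ℕ) :
    ∫ p, hopfFst p ^ A * starRingEnd ℂ (hopfFst p) ^ B * hopfSnd p ^ C *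
        starRingEnd ℂ (hopfSnd p) ^ D ∂hopfMeasure
      = if A = B ∧ C = D then
          (2 * Real.pi : ℂ) ^ 2 * ((A.factorial * C.factorial : ℂ) / (A + C + 1).factorial)
        else 0 := by
  have hfac : ∀ p : ℝ × ℝ × ℝ, hopfFst p ^ A * starRingEnd ℂ (hopfFst p) ^ B * hopfSnd p ^ C *
        starRingEnd ℂ (hopfSnd p) ^ D
      = ((√p.1 : ℝ) ^ (A + B) * (√(1 - p.1) : ℝ) ^ (C + D) : ℂ) *
        (Complex.exp (Complex.I * ((A - B : ℤ) : ℂ) * p.2.1) *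
          Complex.exp (Complex.I * ((C - D : ℤ) : ℂ) * p.2.2)) := by
    intro p
    simp only [hopfFst, hopfSnd, map_mul, Complex.conj_ofReal, ← Complex.exp_conj, Complex.conj_I,
      mul_pow, ← Complex.exp_nat_mul]
    rw [show Complex.I * ((A - B : ℤ) : ℂ) * (p.2.1 : ℂ) = A * (Complex.I * p.2.1)
        + B * (-Complex.I * p.2.1) by push_cast; ring,
      show Complex.I * ((C - D : ℤ) : ℂ) * (p.2.2 : ℂ) = C * (Complex.I * p.2.2)
        + D * (-Complex.I * p.2.2) by push_cast; ring, Complex.exp_add, Complex.exp_add]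
    ring
  simp_rw [hfac]
  rw [hopfMeasure, integral_prod_mul
    (fun r : ℝ => ((√r : ℝ) ^ (A + B) * (√(1 - r) : ℝ) ^ (C + D) : ℂ))
    (fun q : ℝ × ℝ => Complex.exp (Complex.I * ((A - B : ℤ) : ℂ) * q.1) *
          Complex.exp (Complex.I * ((C - D : ℤ) : ℂ) * q.2)),
    integral_prod_mul (fun φ : ℝ => Complex.exp (Complex.I * ((A - B : ℤ) : ℂ) * φ))
      (fun φ : ℝ => Complex.exp (Complex.I * ((C - D : ℤ) : ℂ) * φ)),
    ← intervalIntegral.integral_of_le (by positivity),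
    ← intervalIntegral.integral_of_le (by positivity),
    ← intervalIntegral.integral_of_le (by positivity), integral_exp_int, integral_exp_int]
  by_cases h1 : A = B
  · by_cases h2 : C = D
    · subst h1; subst h2
      have hr : ∫ r in (0 : ℝ)..1, ((√r : ℝ) ^ (A + A) * (√(1 - r) : ℝ) ^ (C + C) : ℂ)
          = ((A.factorial * C.factorial : ℂ) / (A + C + 1).factorial) := by
        rw [intervalIntegral.integral_congr (g := fun r : ℝ => ((r ^ A * (1 - r) ^ C : ℝ) : ℂ))]
        · rw [intervalIntegral.integral_ofReal, integral_pow_mul_one_sub_pow]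
          push_cast; rfl
        · intro r hr
          rw [Set.uIcc_of_le zero_le_one] at hr
          simp only [← two_mul, pow_mul, ← Complex.ofReal_pow, Real.sq_sqrt hr.1,
            Real.sq_sqrt (sub_nonneg.mpr hr.2)]
          push_cast; rfl
      rw [hr]
      simp
      ring
    · have : ((C : ℤ) - D) ≠ 0 := by omega
      simp [this, h2]
  · have : ((A : ℤ) - B) ≠ 0 := by omega
    simp [this, h1]

/-- The two linear forms are the coordinates of Xe' + Yτe' in the basis e, τe of a quaternionic
line, where e' = v₁e + v₂τe. The phases leave only p = q + d, and in that case the signs from -Y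
produce the binomial expansion of (1 - 1)^q, which vanishes unless q = 0. -/
theorem integral_hopf_moment (d : ℕ) (X Y : ℂ) (p q : ℕ) :
    ∫ v, starRingEnd ℂ (hopfFst v) ^ d *
        ((X * hopfFst v - Y * starRingEnd ℂ (hopfSnd v)) ^ p *
          (X * hopfSnd v + Y * starRingEnd ℂ (hopfFst v)) ^ q) ∂hopfMeasure
      = if p = d ∧ q = 0 then (2 * Real.pi : ℂ) ^ 2 * X ^ d / (d + 1) else 0 := by
  have hexp : ∀ v, starRingEnd ℂ (hopfFst v) ^ d *
        ((X * hopfFst v - Y * starRingEnd ℂ (hopfSnd v)) ^ p *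
          (X * hopfSnd v + Y * starRingEnd ℂ (hopfFst v)) ^ q)
      = ∑ a ∈ Finset.range (p + 1), ∑ b ∈ Finset.range (q + 1),
        (X ^ a * (-Y) ^ (p - a) * X ^ b * Y ^ (q - b) * p.choose a * q.choose b) *
          (hopfFst v ^ a * starRingEnd ℂ (hopfFst v) ^ (q - b + d) * hopfSnd v ^ b *
            starRingEnd ℂ (hopfSnd v) ^ (p - a)) := by
    intro v
    rw [sub_eq_add_neg, add_pow, add_pow, Finset.sum_mul_sum, Finset.mul_sum]
    refine Finset.sum_congr rfl fun a _ => ?_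
    rw [Finset.mul_sum]
    refine Finset.sum_congr rfl fun b _ => ?_
    rw [← neg_mul, mul_pow, mul_pow, mul_pow, mul_pow, pow_add]
    ring
  have hcont : ∀ a b : ℕ, Continuous fun v =>
      (X ^ a * (-Y) ^ (p - a) * X ^ b * Y ^ (q - b) * p.choose a * q.choose b) *
          (hopfFst v ^ a * starRingEnd ℂ (hopfFst v) ^ (q - b + d) * hopfSnd v ^ b *
            starRingEnd ℂ (hopfSnd v) ^ (p - a)) := by
    intro a b
    have h1 := continuous_hopfFst
    have h2 := continuous_hopfSnd
    have h3 := Complex.continuous_conj.comp h1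
    have h4 := Complex.continuous_conj.comp h2
    exact continuous_const.mul ((((h1.pow _).mul (h3.pow _)).mul (h2.pow _)).mul (h4.pow _))
  simp_rw [hexp]
  rw [integral_finsetSum _ fun a _ => integrable_finsetSum _ fun b _ =>
    integrable_hopfMeasure (hcont a b)]
  simp_rw [integral_finsetSum (Finset.range (q + 1)) fun b _ =>
    integrable_hopfMeasure (hcont _ b), integral_const_mul, integral_hopf_monomial]
  by_cases hpq : p = q + d
  · rw [Finset.sum_comm]
    -- Only a = p - b meets the phase conditions. There C(p,b)(p-b)! b!/(p+1)! = 1/(p+1) does not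
    -- depend on b, so just the sign and C(q,b) remain.
    have hinner : ∀ b ∈ Finset.range (q + 1), (∑ a ∈ Finset.range (p + 1),
        (X ^ a * (-Y) ^ (p - a) * X ^ b * Y ^ (q - b) * p.choose a * q.choose b) *
          (if a = q - b + d ∧ b = p - a then
            (2 * Real.pi : ℂ) ^ 2 * ((a.factorial * b.factorial : ℂ) / (a + b + 1).factorial)
          else 0))
        = (2 * Real.pi : ℂ) ^ 2 * X ^ p * Y ^ q / (p + 1) * ((-1) ^ b * q.choose b) := by
      intro b hb
      rw [Finset.mem_range] at hb
      rw [Finset.sum_eq_single (p - b)]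
      · rw [if_pos (by omega)]
        have e1 : p - (p - b) = b := by omega
        have e2 : p - b + b = p := by omega
        have hbp : b ≤ p := by omega
        rw [e1, e2, Nat.choose_symm hbp]
        have hch : (p.choose b : ℂ) * ((p - b).factorial * b.factorial) = p.factorial := by
          have := Nat.choose_mul_factorial_mul_factorial hbp
          rw [mul_comm ((p - b).factorial : ℂ), ← mul_assoc]
          exact_mod_cast this
        have hY : Y ^ b * Y ^ (q - b) = Y ^ q := by rw [← pow_add]; congr 1; omega
        have hX : X ^ (p - b) * X ^ b = X ^ p := by rw [← pow_add, e2]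
        have hp1 : ((p + 1).factorial : ℂ) = (p + 1) * p.factorial := by
          rw [Nat.factorial_succ]; push_cast; rfl
        have hpf : (p.factorial : ℂ) ≠ 0 := by exact_mod_cast p.factorial_ne_zero
        have hp2 : (p + 1 : ℂ) ≠ 0 := Nat.cast_add_one_ne_zero p
        rw [hp1, neg_pow Y, ← hX, ← hY, ← hch]
        rw [← hch] at hpf
        have h3 : (p.choose b : ℂ) ≠ 0 := left_ne_zero_of_mul hpf
        have h4 := left_ne_zero_of_mul (right_ne_zero_of_mul hpf)
        have h5 := right_ne_zero_of_mul (right_ne_zero_of_mul hpf)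
        field_simp
      · intro a _ hab
        rw [if_neg (by omega), mul_zero]
      · intro h
        exact absurd (Finset.mem_range.mpr (by omega)) h
    rw [Finset.sum_congr rfl hinner, ← Finset.mul_sum]
    have halt := Int.alternating_sum_range_choose (n := q)
    have halt' : ∑ b ∈ Finset.range (q + 1), ((-1) ^ b * q.choose b : ℂ)
        = if q = 0 then 1 else 0 := by exact_mod_cast congrArg (Int.cast : ℤ → ℂ) halt
    rw [halt']
    by_cases hq : q = 0
    · subst hq
      simp at hpq
      simp [hpq]
    · simp [hq]
  · rw [if_neg (by omega)]
    refine Finset.sum_eq_zero fun a ha => Finset.sum_eq_zero fun b hb => ?_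
    rw [Finset.mem_range] at ha hb
    rw [if_neg (by omega), mul_zero]

/-- Integration over the three-sphere against `conj v₁ ^ d` projects to the highest weight vector
of degree `d`. -/
theorem integral_hopf_entire {F : ℂ → ℂ → ℂ} (hF : Continuous (Function.uncurry F))
    (h1 : ∀ y, Differentiable ℂ fun x => F x y) (h2 : ∀ x, Differentiable ℂ (F x)) (d : ℕ)
    (X Y : ℂ) :
    ∫ v, starRingEnd ℂ (hopfFst v) ^ d * F (X * hopfFst v - Y * starRingEnd ℂ (hopfSnd v))
          (X * hopfSnd v + Y * starRingEnd ℂ (hopfFst v)) ∂hopfMeasure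
      = taylorCoef (fun x => F x 0) d * ((2 * Real.pi : ℂ) ^ 2 * X ^ d / (d + 1)) := by
  have c1 := continuous_hopfFst
  have c2 := continuous_hopfSnd
  have c3 : Continuous fun v => starRingEnd ℂ (hopfFst v) := Complex.continuous_conj.comp c1
  have c4 : Continuous fun v => starRingEnd ℂ (hopfSnd v) := Complex.continuous_conj.comp c2
  have hb : ∀ᵐ v ∂hopfMeasure, ‖hopfFst v‖ ≤ 1 ∧ ‖hopfSnd v‖ ≤ 1 := by
    filter_upwards [ae_hopfMeasure_mem] with v hv
    have := norm_sq_hopf hv.1 hv.2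
    constructor <;> nlinarith [norm_nonneg (hopfFst v), norm_nonneg (hopfSnd v),
      sq_nonneg (‖hopfFst v‖), sq_nonneg (‖hopfSnd v‖)]
  have hXY := norm_nonneg X
  have hXY' := norm_nonneg Y
  rw [integral_eq_taylorCoef_of_moments hF h1 h2 (m := hopfMeasure) (R := ‖X‖ + ‖Y‖ + 1) (W := 1)
    (w := fun v => starRingEnd ℂ (hopfFst v) ^ d)
    (ξ := fun v => X * hopfFst v - Y * starRingEnd ℂ (hopfSnd v))
    (η := fun v => X * hopfSnd v + Y * starRingEnd ℂ (hopfFst v))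
    (c3.pow d).aestronglyMeasurable
    ((continuous_const.mul c1).sub (continuous_const.mul c4)).aestronglyMeasurable
    ((continuous_const.mul c2).add (continuous_const.mul c3)).aestronglyMeasurable
    (by positivity) ?_ ?_ ?_ d ?_]
  · have h := integral_hopf_moment d X Y d 0
    simp only [pow_zero, mul_one, and_self, if_true] at h
    rw [h]
  · filter_upwards [hb] with v hv
    rw [norm_pow, RCLike.norm_conj]
    exact pow_le_one₀ (norm_nonneg _) hv.1
  · filter_upwards [hb] with v hv
    refine (norm_sub_le _ _).trans ?_
    rw [norm_mul, norm_mul, RCLike.norm_conj]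
    nlinarith [hv.1, hv.2]
  · filter_upwards [hb] with v hv
    refine (norm_add_le _ _).trans ?_
    rw [norm_mul, norm_mul, RCLike.norm_conj]
    nlinarith [hv.1, hv.2]
  · intro p q hpq
    rw [integral_hopf_moment, if_neg hpq]

/-! ### Twisted circle means in the plane and Laguerre coefficients -/

theorem intervalIntegral_swap_of_continuous {g : ℝ → ℝ → ℂ}
    (hg : Continuous (Function.uncurry g)) (a b c d : ℝ) :
    ∫ x in a..b, ∫ y in c..d, g x y = ∫ y in c..d, ∫ x in a..b, g x y := by
  refine intervalIntegral_intervalIntegral_swap ?_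
  exact (hg.continuousOn.integrableOn_compact (isCompact_uIcc.prod isCompact_uIcc)).mono_set
    (Set.prod_mono Set.uIoc_subset_uIcc Set.uIoc_subset_uIcc)

theorem exp_I_periodic (N : ℤ) (θ : ℝ) :
    Complex.exp (Complex.I * N * ((θ + 2 * Real.pi : ℝ) : ℂ)) = Complex.exp (Complex.I * N * θ) := by
  rw [Complex.exp_eq_exp_iff_exists_int]
  exact ⟨N, by push_cast; ring⟩

theorem exp_I_periodic_one (θ : ℝ) :
    Complex.exp (Complex.I * ((θ + 2 * Real.pi : ℝ) : ℂ)) = Complex.exp (Complex.I * θ) := by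
  have := exp_I_periodic 1 θ
  simpa using this

/-- Negating the angle does not change the integral over a period. -/
theorem integral_neg_angle {g : ℝ → ℂ} (hg : Function.Periodic g (2 * Real.pi)) :
    ∫ θ in (0 : ℝ)..(2 * Real.pi), g (-θ) = ∫ θ in (0 : ℝ)..(2 * Real.pi), g θ := by
  rw [intervalIntegral.integral_comp_neg]
  have := hg.intervalIntegral_add_eq (-(2 * Real.pi)) 0
  simpa using this

theorem integral_exp_mul_exp_exp (M : ℕ) (β : ℂ) :
    ∫ θ in (0 : ℝ)..(2 * Real.pi), Complex.exp (Complex.I * M * θ) *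
        Complex.exp (-(β * Complex.exp (-(Complex.I * θ))))
      = 2 * Real.pi * ((-β) ^ M / M.factorial) := by
  have h := integral_exp_mul_entire Complex.differentiable_exp M (-β)
  rw [taylorCoef_exp] at h
  rw [← integral_neg_angle] at h
  · rw [← mul_comm ((-β) ^ M), ← div_eq_mul_inv] at h
    rw [← h]
    refine intervalIntegral.integral_congr fun θ _ => ?_
    push_cast
    simp
  · intro θ
    have e1 := exp_I_periodic (-(M : ℤ)) θ
    have e2 := exp_I_periodic_one θ
    push_cast at e1 e2 ⊢
    rw [e2]
    congr 1
    convert e1 using 2 <;> ring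

/-- The coefficients, essentially Laguerre polynomials, by which circle means weighted with the
character of degree `N` act on monomials of degree `m`. -/
def laguerreCoef (β : ℝ) (N m : ℕ) : ℂ :=
  ∑ l ∈ Finset.range (m + 1), (m.choose l : ℂ) * β ^ l * ((-β) ^ (N + l) / (N + l).factorial)

theorem integral_eq_laguerreCoef (β : ℝ) (N m : ℕ) :
    ∫ θ in (0 : ℝ)..(2 * Real.pi), Complex.exp (Complex.I * N * θ) *
        Complex.exp (-(β * Complex.exp (-(Complex.I * θ)))) *
        (1 + β * Complex.exp (Complex.I * θ)) ^ m
      = 2 * Real.pi * laguerreCoef β N m := by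
  have hexp : ∀ θ : ℝ, Complex.exp (Complex.I * N * θ) *
        Complex.exp (-(β * Complex.exp (-(Complex.I * θ)))) *
        (1 + β * Complex.exp (Complex.I * θ)) ^ m
      = ∑ l ∈ Finset.range (m + 1), ((m.choose l : ℂ) * β ^ l) *
        (Complex.exp (Complex.I * ((N + l : ℕ) : ℂ) * θ) *
          Complex.exp (-(β * Complex.exp (-(Complex.I * θ))))) := by
    intro θ
    rw [add_comm (1 : ℂ), add_pow, Finset.mul_sum]
    refine Finset.sum_congr rfl fun l _ => ?_
    rw [show Complex.I * ((N + l : ℕ) : ℂ) * (θ : ℂ) = Complex.I * N * θ + l * (Complex.I * θ) by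
      push_cast; ring, Complex.exp_add, Complex.exp_nat_mul, mul_pow, one_pow]
    ring
  simp_rw [hexp]
  rw [intervalIntegral.integral_finsetSum
    fun l _ => Continuous.intervalIntegrable (by fun_prop) _ _]
  rw [laguerreCoef, Finset.mul_sum]
  refine Finset.sum_congr rfl fun l _ => ?_
  rw [intervalIntegral.integral_const_mul, integral_exp_mul_exp_exp]
  ring

/-- For an odd charge the Laguerre coefficients never vanish. -/
theorem laguerreCoef_ne_zero_of_odd {K : ℕ} (hK : Odd K) {α : ℝ} (hα : α ^ 2 = K) (m : ℕ) :
    laguerreCoef α K m ≠ 0 := by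
  have hαc : (α : ℂ) ^ 2 = K := by exact_mod_cast congrArg (Complex.ofReal) hα
  have hα0 : (α : ℂ) ≠ 0 := by
    intro h
    rw [h] at hαc
    have : (K : ℂ) = 0 := by rw [← hαc]; simp
    have : K = 0 := by exact_mod_cast this
    subst this; exact absurd hK (by decide)
  -- the integer obtained after clearing denominators
  set S : ℤ := ∑ l ∈ Finset.range (m + 1),
    (m.choose l : ℤ) * (-1) ^ l * K ^ l * ((K + m).descFactorial (m - l) : ℤ) with hS
  have hcast : laguerreCoef α K m * (K + m).factorial = (-(α : ℂ)) ^ K * (S : ℂ) := by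
    rw [laguerreCoef, hS, Finset.sum_mul]
    push_cast
    rw [Finset.mul_sum]
    refine Finset.sum_congr rfl fun l hl => ?_
    have hl' : l ≤ m := by rw [Finset.mem_range] at hl; omega
    have hd : ((K + l).factorial : ℂ) * ((K + m).descFactorial (m - l) : ℂ)
        = (K + m).factorial := by
      have := Nat.factorial_mul_descFactorial (show m - l ≤ K + m by omega)
      rw [show K + m - (m - l) = K + l by omega] at this
      exact_mod_cast this
    have hf : ((K + l).factorial : ℂ) ≠ 0 := by exact_mod_cast (K + l).factorial_ne_zero
    rw [← hd, ← hαc, pow_add, ← pow_mul, mul_comm 2 l, pow_mul, neg_pow (α : ℂ) l]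
    field_simp
  -- Modulo 2 only l = m survives, contributing ±K^m, which is odd. The term l = m - 1 contains m(K
  -- + m), even because K is odd; for l ≤ m - 2 the descending factorial has at least two
  -- consecutive factors.
  have hodd : Odd S := by
    rw [hS, Finset.sum_range_succ]
    refine Even.add_odd ?_ ?_
    · rw [even_iff_two_dvd]
      refine Finset.dvd_sum fun l hl => ?_
      rw [Finset.mem_range] at hl
      rw [← even_iff_two_dvd]
      obtain ⟨t, ht⟩ : ∃ t, m - l = t + 1 := ⟨m - l - 1, by omega⟩
      by_cases ht0 : t = 0
      · subst ht0
        rw [ht]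
        have e1 : m.choose l = m := by
          obtain rfl : m = l + 1 := by omega
          simp
        rw [e1]
        simp only [zero_add, Nat.descFactorial_one]
        have hev : Even ((m : ℤ) * ((K + m : ℕ) : ℤ)) := by
          have : Even (m * (K + m)) := by
            rcases Nat.even_or_odd m with h | h
            · exact h.mul_right _
            · exact (hK.add_odd h).mul_left _
          exact_mod_cast this
        have : (m : ℤ) * (-1) ^ l * K ^ l * ((K + m : ℕ) : ℤ)
            = ((m : ℤ) * ((K + m : ℕ) : ℤ)) * ((-1) ^ l * K ^ l) := by ring
        rw [this]
        exact hev.mul_right _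
      · refine Even.mul_left ?_ _
        obtain ⟨t', rfl⟩ : ∃ t', t = t' + 1 := ⟨t - 1, by omega⟩
        rw [ht]
        have h2 : 2 ∣ (K + m).descFactorial (t' + 1 + 1) := by
          have := Nat.factorial_dvd_descFactorial (K + m) (t' + 1 + 1)
          exact (Nat.dvd_factorial (by norm_num) (by omega)).trans this
        exact_mod_cast even_iff_two_dvd.mpr h2
    · simp only [Nat.choose_self, Nat.cast_one, one_mul, Nat.sub_self, Nat.descFactorial_zero,
        mul_one]
      refine Odd.mul (Odd.pow (by decide)) (Odd.pow ?_)
      exact_mod_cast hK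
  intro h0
  rw [h0, zero_mul] at hcast
  have hS0 : (S : ℂ) = 0 := (mul_eq_zero.mp hcast.symm).resolve_left
    (pow_ne_zero _ (neg_ne_zero.mpr hα0))
  have : S = 0 := by exact_mod_cast hS0
  rw [this] at hodd
  exact absurd hodd (by decide)

theorem laguerreCoef_zero_right (β : ℝ) (N : ℕ) :
    laguerreCoef β N 0 = (-β) ^ N / N.factorial := by
  simp [laguerreCoef]

/-- For fixed degree, the Laguerre coefficients are nonzero for large charge. -/
theorem eventually_laguerreCoef_ne_zero {β : ℝ} (hβ : β ≠ 0) (m : ℕ) :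
    ∀ᶠ N in Filter.atTop, laguerreCoef β N m ≠ 0 := by
  have hβc : (β : ℂ) ≠ 0 := by exact_mod_cast hβ
  -- After division by (-β)^N/N! the l = 0 term equals 1 and every other term is O(1/N).
  have hform : ∀ N : ℕ, laguerreCoef β N m * (N.factorial / (-β) ^ N)
      = ∑ l ∈ Finset.range (m + 1), (m.choose l : ℂ) * β ^ l * (-β) ^ l *
        ((N.factorial / (N + l).factorial : ℝ) : ℂ) := by
    intro N
    rw [laguerreCoef, Finset.sum_mul]
    refine Finset.sum_congr rfl fun l _ => ?_
    have h1 : (-(β : ℂ)) ^ N ≠ 0 := pow_ne_zero _ (neg_ne_zero.mpr hβc)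
    rw [pow_add]
    push_cast
    field_simp
  have hlim : Filter.Tendsto (fun N : ℕ => ∑ l ∈ Finset.range (m + 1),
      (m.choose l : ℂ) * β ^ l * (-β) ^ l * ((N.factorial / (N + l).factorial : ℝ) : ℂ))
      Filter.atTop (nhds (∑ l ∈ Finset.range (m + 1),
        (m.choose l : ℂ) * β ^ l * (-β) ^ l * (if l = 0 then 1 else 0))) := by
    refine tendsto_finsetSum _ fun l _ => Filter.Tendsto.const_mul _ ?_
    split_ifs with hl
    · subst hl
      have : ∀ N : ℕ, (N.factorial / (N + 0).factorial : ℝ) = 1 := fun N => by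
        rw [add_zero]; exact div_self (by positivity)
      simp only [this, Complex.ofReal_one]
      exact tendsto_const_nhds
    · rw [← Complex.ofReal_zero]
      refine (Complex.continuous_ofReal.tendsto 0).comp ?_
      refine squeeze_zero (fun N => by positivity) (fun N => ?_)
        tendsto_one_div_add_atTop_nhds_zero_nat
      obtain ⟨l', rfl⟩ := Nat.exists_eq_succ_of_ne_zero hl
      have h1 : (N + 1) * N.factorial ≤ (N + (l' + 1)).factorial := by
        rw [← Nat.factorial_succ]
        exact Nat.factorial_le (by omega)
      rw [div_le_div_iff₀ (by positivity) (by positivity)]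
      have h2 : ((N + 1) * N.factorial : ℝ) ≤ (N + (l' + 1)).factorial := by exact_mod_cast h1
      simp only [Nat.succ_eq_add_one]
      linarith
  have hval : ∑ l ∈ Finset.range (m + 1),
        (m.choose l : ℂ) * β ^ l * (-β) ^ l * (if l = 0 then 1 else 0) = 1 := by
    rw [Finset.sum_eq_single 0]
    · simp
    · intro l _ hl; simp [hl]
    · simp
  rw [hval] at hlim
  filter_upwards [hlim.eventually_ne one_ne_zero] with N hN h0
  rw [← hform, h0, zero_mul] at hN
  exact hN rfl

/-- An entire function whose twisted circle means vanish has vanishing Taylor coefficients,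
except where the Laguerre coefficient vanishes. -/
theorem taylorCoef_mul_laguerreCoef_eq_zero {u : ℂ → ℂ} (hu : Differentiable ℂ u) (K : ℕ) (α : ℝ)
    (h : ∀ a : ℂ, ∫ θ in (0 : ℝ)..(2 * Real.pi), Complex.exp (Complex.I * K * θ) *
      Complex.exp (-(α * a * Complex.exp (-(Complex.I * θ)))) *
        u (a + α * Complex.exp (Complex.I * θ)) = 0) (m : ℕ) :
    taylorCoef u m * laguerreCoef α K m = 0 := by
  have huc := hu.continuous
  -- Centres on the unit circle suffice. Rotating the centre by φ multiplies the degree-m part of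
  -- the mean by e^{i(K+m)φ}, so this character extracts it.
  have h0 : ∫ φ in (0 : ℝ)..(2 * Real.pi), Complex.exp (-(Complex.I * ((K + m : ℕ) : ℂ) * φ)) *
      ∫ θ in (0 : ℝ)..(2 * Real.pi), Complex.exp (Complex.I * K * θ) *
      Complex.exp (-(α * Complex.exp (Complex.I * φ) * Complex.exp (-(Complex.I * θ)))) *
        u (Complex.exp (Complex.I * φ) + α * Complex.exp (Complex.I * θ)) = 0 := by
    simp [h]
  -- The substitution θ = ψ + φ separates the dependence on φ from the weight.
  have h1 : ∀ φ : ℝ, ∫ θ in (0 : ℝ)..(2 * Real.pi), Complex.exp (Complex.I * K * θ) *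
      Complex.exp (-(α * Complex.exp (Complex.I * φ) * Complex.exp (-(Complex.I * θ)))) *
        u (Complex.exp (Complex.I * φ) + α * Complex.exp (Complex.I * θ))
      = ∫ ψ in (0 : ℝ)..(2 * Real.pi), Complex.exp (Complex.I * K * φ) *
        (Complex.exp (Complex.I * K * ψ) *
        Complex.exp (-(α * Complex.exp (-(Complex.I * ψ)))) *
        u ((1 + α * Complex.exp (Complex.I * ψ)) * Complex.exp (Complex.I * φ))) := by
    intro φ
    set g : ℝ → ℂ := fun θ => Complex.exp (Complex.I * K * θ) *
      Complex.exp (-(α * Complex.exp (Complex.I * φ) * Complex.exp (-(Complex.I * θ)))) *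
        u (Complex.exp (Complex.I * φ) + α * Complex.exp (Complex.I * θ)) with hg
    have hper : Function.Periodic g (2 * Real.pi) := by
      intro θ
      have e1 := exp_I_periodic (K : ℤ) θ
      have e2 := exp_I_periodic_one θ
      simp only [Int.cast_natCast] at e1
      simp only [hg, Complex.exp_neg, e1, e2]
    have e3 : ∫ θ in (0 : ℝ)..(2 * Real.pi), g θ = ∫ ψ in (0 : ℝ)..(2 * Real.pi), g (ψ + φ) := by
      rw [intervalIntegral.integral_comp_add_right]
      have := hper.intervalIntegral_add_eq 0 φ
      simpa [add_comm] using this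
    rw [e3]
    refine intervalIntegral.integral_congr fun ψ _ => ?_
    simp only [hg]
    have e4 : Complex.exp (Complex.I * φ) * Complex.exp (-(Complex.I * ((ψ + φ : ℝ) : ℂ)))
        = Complex.exp (-(Complex.I * ψ)) := by
      rw [← Complex.exp_add]; congr 1; push_cast; ring
    have e5 : Complex.exp (Complex.I * K * ((ψ + φ : ℝ) : ℂ))
        = Complex.exp (Complex.I * K * φ) * Complex.exp (Complex.I * K * ψ) := by
      rw [← Complex.exp_add]; congr 1; push_cast; ring
    have e6 : Complex.exp (Complex.I * ((ψ + φ : ℝ) : ℂ))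
        = Complex.exp (Complex.I * ψ) * Complex.exp (Complex.I * φ) := by
      rw [← Complex.exp_add]; congr 1; push_cast; ring
    rw [mul_assoc (α : ℂ), e4, e5, e6]
    rw [show Complex.exp (Complex.I * φ) + α * (Complex.exp (Complex.I * ψ) *
      Complex.exp (Complex.I * φ))
      = (1 + α * Complex.exp (Complex.I * ψ)) * Complex.exp (Complex.I * φ) by ring]
    ring
  simp_rw [h1, ← intervalIntegral.integral_const_mul] at h0
  rw [intervalIntegral_swap_of_continuous (by
    unfold Function.uncurry
    have : Continuous fun x : ℝ × ℝ => u ((1 + α * Complex.exp (Complex.I * x.2)) *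
      Complex.exp (Complex.I * x.1)) := huc.comp (by fun_prop)
    fun_prop)] at h0
  have h2 : ∀ ψ : ℝ, ∫ φ in (0 : ℝ)..(2 * Real.pi),
      Complex.exp (-(Complex.I * ((K + m : ℕ) : ℂ) * φ)) * (Complex.exp (Complex.I * K * φ) *
        (Complex.exp (Complex.I * K * ψ) *
        Complex.exp (-(α * Complex.exp (-(Complex.I * ψ)))) *
        u ((1 + α * Complex.exp (Complex.I * ψ)) * Complex.exp (Complex.I * φ))))
      = 2 * Real.pi * taylorCoef u m * (Complex.exp (Complex.I * K * ψ) *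
        Complex.exp (-(α * Complex.exp (-(Complex.I * ψ)))) *
        (1 + α * Complex.exp (Complex.I * ψ)) ^ m) := by
    intro ψ
    have h3 := integral_exp_mul_entire hu m (1 + α * Complex.exp (Complex.I * ψ))
    rw [show 2 * Real.pi * taylorCoef u m * (Complex.exp (Complex.I * K * ψ) *
        Complex.exp (-(α * Complex.exp (-(Complex.I * ψ)))) *
        (1 + α * Complex.exp (Complex.I * ψ)) ^ m)
      = (Complex.exp (Complex.I * K * ψ) *
        Complex.exp (-(α * Complex.exp (-(Complex.I * ψ))))) * (2 * Real.pi *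
        (taylorCoef u m * (1 + α * Complex.exp (Complex.I * ψ)) ^ m)) by ring, ← h3,
      ← intervalIntegral.integral_const_mul]
    refine intervalIntegral.integral_congr fun φ _ => ?_
    rw [show -(Complex.I * ((K + m : ℕ) : ℂ) * (φ : ℂ)) = -(Complex.I * m * φ)
      + -(Complex.I * K * φ) by push_cast; ring, Complex.exp_add,
      Complex.exp_neg (Complex.I * K * φ)]
    field_simp
  simp_rw [h2] at h0
  rw [intervalIntegral.integral_const_mul, integral_eq_laguerreCoef] at h0
  have hpi : (2 * Real.pi : ℂ) ≠ 0 := by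
    exact_mod_cast (by positivity : (2 * Real.pi : ℝ) ≠ 0)
  have h4 : (2 * Real.pi : ℂ) * (2 * Real.pi) * (taylorCoef u m * laguerreCoef α K m) = 0 := by
    rw [← h0]; ring
  exact (mul_eq_zero.mp h4).resolve_left (mul_ne_zero hpi hpi)

theorem intervalIntegral_hopf_swap {g : ℝ → ℝ × ℝ × ℝ → ℂ}
    (hg : Continuous (Function.uncurry g)) (a b : ℝ) :
    ∫ x in a..b, ∫ v, g x v ∂hopfMeasure = ∫ v, (∫ x in a..b, g x v) ∂hopfMeasure := by
  refine intervalIntegral_integral_swap ?_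
  rw [hopfMeasure_eq, Measure.prod_restrict]
  exact (hg.continuousOn.integrableOn_compact (isCompact_uIcc.prod (isCompact_Icc.prod
    (isCompact_Icc.prod isCompact_Icc)))).mono_set (Set.prod_mono Set.uIoc_subset_uIcc
    (Set.prod_mono Set.Ioc_subset_Icc_self
      (Set.prod_mono Set.Ioc_subset_Icc_self Set.Ioc_subset_Icc_self)))

/-! ### Uniqueness for twisted means in several complex variables -/

section Uniqueness

variable {E : Type*} [NormedAddCommGroup E] [InnerProductSpace ℂ E]

theorem conj_exp_I_mul (θ : ℝ) :
    starRingEnd ℂ (Complex.exp (Complex.I * θ)) = Complex.exp (-(Complex.I * θ)) := by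
  rw [← Complex.exp_conj]; simp

/-- Twisted means over circles in complex lines, tested on a complex line. -/
theorem taylorCoef_mul_laguerreCoef_of_circle_means {F : E → ℂ}
    (hFd : ∀ a b : E, Differentiable ℂ fun t : ℂ => F (a + t • b)) (K : ℕ) (α : ℝ) {e : E}
    (he : ‖e‖ = 1)
    (h : ∀ ζ, ∫ θ in (0 : ℝ)..(2 * Real.pi), Complex.exp (Complex.I * K * θ) *
      Complex.exp (-(α * inner ℂ (Complex.exp (Complex.I * θ) • e) ζ)) *
        F (ζ + (α * Complex.exp (Complex.I * θ)) • e) = 0)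
    {ζ₀ : E} (hζ : inner ℂ e ζ₀ = 0) (m : ℕ) :
    taylorCoef (fun t : ℂ => F (ζ₀ + t • e)) m * laguerreCoef α K m = 0 := by
  refine taylorCoef_mul_laguerreCoef_eq_zero (hFd ζ₀ e) K α (fun a => ?_) m
  rw [← h (ζ₀ + a • e)]
  refine intervalIntegral.integral_congr fun θ _ => ?_
  have hin : inner ℂ (Complex.exp (Complex.I * θ) • e) (ζ₀ + a • e)
      = a * Complex.exp (-(Complex.I * θ)) := by
    rw [inner_smul_left, inner_add_right, hζ, inner_smul_right, inner_self_eq_norm_sq_to_K, he,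
      conj_exp_I_mul]
    simp
    ring
  simp only [hin, add_smul, add_assoc, mul_assoc]

/-- Every point lies on a complex line through the origin. On that line all Taylor coefficients
vanish, because with α² = K odd no Laguerre coefficient is zero. -/
theorem eq_zero_of_circle_means_of_odd {F : E → ℂ}
    (hFd : ∀ a b : E, Differentiable ℂ fun t : ℂ => F (a + t • b)) {K : ℕ} (hK : Odd K) {α : ℝ}
    (hα : α ^ 2 = K) [Nontrivial E]
    (h : ∀ e : E, ‖e‖ = 1 → ∀ ζ, ∫ θ in (0 : ℝ)..(2 * Real.pi), Complex.exp (Complex.I * K * θ) *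
      Complex.exp (-(α * inner ℂ (Complex.exp (Complex.I * θ) • e) ζ)) *
        F (ζ + (α * Complex.exp (Complex.I * θ)) • e) = 0) (ζ : E) : F ζ = 0 := by
  obtain ⟨e, t, he, rfl⟩ : ∃ (e : E) (t : ℂ), ‖e‖ = 1 ∧ ζ = t • e := by
    by_cases hζ : ζ = 0
    · obtain ⟨e, he⟩ := exists_norm_eq E zero_le_one
      exact ⟨e, 0, he, by rw [hζ, zero_smul]⟩
    · have hn : (‖ζ‖ : ℂ) ≠ 0 := by exact_mod_cast norm_ne_zero_iff.mpr hζ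
      refine ⟨((‖ζ‖ : ℂ)⁻¹) • ζ, ‖ζ‖, ?_, ?_⟩
      · rw [norm_smul, norm_inv, Complex.norm_real, norm_norm,
          inv_mul_cancel₀ (norm_ne_zero_iff.mpr hζ)]
      · rw [smul_smul, mul_inv_cancel₀ hn, one_smul]
  have h1 := fun m => (mul_eq_zero.mp (taylorCoef_mul_laguerreCoef_of_circle_means hFd K α he
    (h e he) (inner_zero_right e) m)).resolve_right (laguerreCoef_ne_zero_of_odd hK hα m)
  have := eq_zero_of_taylorCoef_eq_zero (hFd 0 e) h1 t
  simpa using this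

/-- In dimension at least two there is a unit vector e ⊥ ζ. The degree-zero coefficient of F along ζ
+ ℂe is F(ζ), and its Laguerre factor (-α)^K/K! is never zero, whatever K is. -/
theorem eq_zero_of_circle_means_of_one_lt_finrank [FiniteDimensional ℂ E] {F : E → ℂ}
    (hFd : ∀ a b : E, Differentiable ℂ fun t : ℂ => F (a + t • b)) (K : ℕ) {α : ℝ}
    (hα : α ≠ 0) (hE : 1 < Module.finrank ℂ E)
    (h : ∀ e : E, ‖e‖ = 1 → ∀ ζ, ∫ θ in (0 : ℝ)..(2 * Real.pi), Complex.exp (Complex.I * K * θ) *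
      Complex.exp (-(α * inner ℂ (Complex.exp (Complex.I * θ) • e) ζ)) *
        F (ζ + (α * Complex.exp (Complex.I * θ)) • e) = 0) (ζ : E) : F ζ = 0 := by
  obtain ⟨e, he, heζ⟩ : ∃ e : E, ‖e‖ = 1 ∧ inner ℂ e ζ = 0 := by
    have hne : (ℂ ∙ ζ)ᗮ ≠ ⊥ := by
      intro hbot
      have h1 := (Submodule.finrank_add_finrank_orthogonal (ℂ ∙ ζ))
      rw [hbot, finrank_bot, add_zero] at h1
      have h2 := finrank_span_le_card (R := ℂ) ({ζ} : Set E)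
      simp only [Set.toFinset_singleton, Finset.card_singleton] at h2
      omega
    obtain ⟨w, hw, hw0⟩ := Submodule.exists_mem_ne_zero_of_ne_bot hne
    refine ⟨((‖w‖ : ℂ)⁻¹) • w, ?_, ?_⟩
    · rw [norm_smul, norm_inv, Complex.norm_real, norm_norm,
          inv_mul_cancel₀ (norm_ne_zero_iff.mpr hw0)]
    · rw [inner_smul_left, Submodule.mem_orthogonal_singleton_iff_inner_left.mp hw, mul_zero]
  have h1 := taylorCoef_mul_laguerreCoef_of_circle_means hFd K α he (h e he) heζ 0
  rw [taylorCoef_zero, laguerreCoef_zero_right] at h1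
  have h2 : (-(α : ℂ)) ^ K / K.factorial ≠ 0 :=
    div_ne_zero (pow_ne_zero _ (neg_ne_zero.mpr (by exact_mod_cast hα)))
      (by exact_mod_cast K.factorial_ne_zero)
  simpa using (mul_eq_zero.mp h1).resolve_right h2

/-- An antiunitary quaternionic structure. -/
structure IsQuaternionic (τ : E → E) : Prop where
  map_add : ∀ v w, τ (v + w) = τ v + τ w
  map_smul : ∀ (c : ℂ) v, τ (c • v) = starRingEnd ℂ c • τ v
  sq : ∀ v, τ (τ v) = -v
  norm_map : ∀ v, ‖τ v‖ = ‖v‖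
  inner_self : ∀ v, inner ℂ v (τ v) = 0

/-- The hypothesis is used for all unit vectors e' = v₁e + v₂τe of one quaternionic line, at the
base points e' + yτe'. Since e' and τe' are orthonormal, the weight depends only on θ and y, so
averaging against conj(v₁)^d acts on F alone and leaves its degree-d coefficient along ℂe times (1 +
βe^{iθ})^d. -/
theorem taylorCoef_mul_integral_of_quaternionic_means {F : E → ℂ} (hFc : Continuous F)
    (hFd : ∀ a b : E, Differentiable ℂ fun t : ℂ => F (a + t • b)) {τ : E → E}
    (hτ : IsQuaternionic τ) (k : ℤ) (β γ : ℝ)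
    (h : ∀ e : E, ‖e‖ = 1 → ∀ ζ, ∫ θ in (0 : ℝ)..(2 * Real.pi), Complex.exp (Complex.I * k * θ) *
      Complex.exp (-(β * Complex.exp (-(Complex.I * θ)) * inner ℂ e ζ
        + γ * Complex.exp (Complex.I * θ) * inner ℂ (τ e) ζ)) *
      F (ζ + (β * Complex.exp (Complex.I * θ)) • e + (γ * Complex.exp (-(Complex.I * θ))) • τ e)
        = 0) {e : E} (he : ‖e‖ = 1) (d : ℕ) (y : ℂ) :
    taylorCoef (fun t : ℂ => F (t • e)) d *
      ∫ θ in (0 : ℝ)..(2 * Real.pi), Complex.exp (Complex.I * k * θ) *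
        Complex.exp (-(β * Complex.exp (-(Complex.I * θ)) + γ * Complex.exp (Complex.I * θ) * y)) *
        (1 + β * Complex.exp (Complex.I * θ)) ^ d = 0 := by
  set F₂ : ℂ → ℂ → ℂ := fun x y => F (x • e + y • τ e) with hF₂
  have hF₂c : Continuous (Function.uncurry F₂) := by
    unfold Function.uncurry
    exact hFc.comp (by fun_prop)
  have hF₂1 : ∀ y, Differentiable ℂ fun x => F₂ x y := by
    intro y
    simp only [hF₂, add_comm (_ • e)]
    exact hFd (y • τ e) e
  have hF₂2 : ∀ x, Differentiable ℂ (F₂ x) := fun x => hFd (x • e) (τ e)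
  have hee : inner ℂ e e = (1 : ℂ) := by rw [inner_self_eq_norm_sq_to_K, he]; simp
  have htt : inner ℂ (τ e) (τ e) = (1 : ℂ) := by
    rw [inner_self_eq_norm_sq_to_K, hτ.norm_map, he]; simp
  have het : inner ℂ e (τ e) = (0 : ℂ) := hτ.inner_self e
  have hte : inner ℂ (τ e) e = (0 : ℂ) := by rw [← inner_conj_symm, het, map_zero]
  set c1 := fun v => starRingEnd ℂ (hopfFst v) with hc1
  set c2 := fun v => starRingEnd ℂ (hopfSnd v) with hc2
  have k1 := continuous_hopfFst
  have k2 := continuous_hopfSnd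
  have k3 : Continuous c1 := Complex.continuous_conj.comp k1
  have k4 : Continuous c2 := Complex.continuous_conj.comp k2
  set W : ℝ → ℂ := fun θ => Complex.exp (Complex.I * k * θ) *
        Complex.exp (-(β * Complex.exp (-(Complex.I * θ)) + γ * Complex.exp (Complex.I * θ) * y))
    with hW
  -- The evaluation points are X(θ)e' + Y(θ)τe'.
  set X : ℝ → ℂ := fun θ => 1 + β * Complex.exp (Complex.I * θ) with hX
  set Y : ℝ → ℂ := fun θ => y + γ * Complex.exp (-(Complex.I * θ)) with hY
  have hWc : Continuous W := by simp only [hW]; fun_prop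
  have hXc : Continuous X := by simp only [hX]; fun_prop
  have hYc : Continuous Y := by simp only [hY]; fun_prop
  have hv : ∀ᵐ v ∂hopfMeasure, ∫ θ in (0 : ℝ)..(2 * Real.pi), W θ * (c1 v ^ d *
      F₂ (X θ * hopfFst v - Y θ * c2 v) (X θ * hopfSnd v + Y θ * c1 v)) = 0 := by
    filter_upwards [ae_hopfMeasure_mem] with v hv
    set e' := hopfFst v • e + hopfSnd v • τ e with he'
    have hns := norm_sq_hopf hv.1 hv.2
    have hcc1 : c1 v * hopfFst v = (‖hopfFst v‖ : ℂ) ^ 2 := Complex.conj_mul' _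
    have hcc2 : c2 v * hopfSnd v = (‖hopfSnd v‖ : ℂ) ^ 2 := Complex.conj_mul' _
    have hnsc : c1 v * hopfFst v + c2 v * hopfSnd v = 1 := by
      rw [hcc1, hcc2]; exact_mod_cast congrArg Complex.ofReal hns
    have hee' : inner ℂ e' e' = (1 : ℂ) := by
      rw [he', inner_add_left, inner_add_right, inner_add_right]
      simp only [inner_smul_left, inner_smul_right, hee, htt, het, hte]
      have hn := hnsc
      simp only [hc1, hc2] at hn
      linear_combination hn
    have hne' : ‖e'‖ = 1 := by
      rw [inner_self_eq_norm_sq_to_K] at hee'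
      change ((‖e'‖ : ℝ) : ℂ) ^ 2 = 1 at hee'
      have : ‖e'‖ ^ 2 = 1 := by exact_mod_cast hee'
      nlinarith [norm_nonneg e']
    -- Antilinearity together with τ² = -1 gives τe' the coordinates (-conj v₂, conj v₁), as in the
    -- moment formula on the sphere.
    have hτe' : τ e' = c1 v • τ e - c2 v • e := by
      rw [he', hτ.map_add, hτ.map_smul, hτ.map_smul, hτ.sq]
      simp [hc1, hc2, sub_eq_add_neg]
    have hi1 : inner ℂ e' (e' + y • τ e') = 1 := by
      rw [inner_add_right, hee', inner_smul_right, hτ.inner_self]; ring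
    have hi2 : inner ℂ (τ e') (e' + y • τ e') = y := by
      rw [inner_add_right, inner_smul_right, ← inner_conj_symm, hτ.inner_self,
        inner_self_eq_norm_sq_to_K, hτ.norm_map, hne']
      simp
    have h1 := h e' hne' (e' + y • τ e')
    simp only [hi1, hi2, mul_one] at h1
    have h2 : ∀ θ : ℝ, F (e' + y • τ e' + (β * Complex.exp (Complex.I * θ)) • e'
        + (γ * Complex.exp (-(Complex.I * θ))) • τ e')
        = F₂ (X θ * hopfFst v - Y θ * c2 v) (X θ * hopfSnd v + Y θ * c1 v) := by
      intro θ
      simp only [hF₂]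
      congr 1
      rw [hτe', he']
      simp only [hX, hY]
      module
    simp only [h2] at h1
    have h3 : ∀ θ : ℝ, W θ * (c1 v ^ d *
        F₂ (X θ * hopfFst v - Y θ * c2 v) (X θ * hopfSnd v + Y θ * c1 v))
        = c1 v ^ d * (W θ * F₂ (X θ * hopfFst v - Y θ * c2 v) (X θ * hopfSnd v + Y θ * c1 v)) :=
      fun θ => by ring
    simp_rw [h3]
    rw [intervalIntegral.integral_const_mul, h1, mul_zero]
  have hsw : ∫ v, (∫ θ in (0 : ℝ)..(2 * Real.pi), W θ * (c1 v ^ d *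
      F₂ (X θ * hopfFst v - Y θ * c2 v) (X θ * hopfSnd v + Y θ * c1 v))) ∂hopfMeasure = 0 := by
    rw [integral_congr_ae hv]; simp
  rw [← intervalIntegral_hopf_swap (by
    unfold Function.uncurry
    have hc : Continuous fun x : ℝ × ℝ × ℝ × ℝ =>
        F₂ (X x.1 * hopfFst x.2 - Y x.1 * c2 x.2) (X x.1 * hopfSnd x.2 + Y x.1 * c1 x.2) :=
      hF₂c.comp (Continuous.prodMk
        (((hXc.comp continuous_fst).mul (k1.comp continuous_snd)).sub
          ((hYc.comp continuous_fst).mul (k4.comp continuous_snd)))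
        (((hXc.comp continuous_fst).mul (k2.comp continuous_snd)).add
          ((hYc.comp continuous_fst).mul (k3.comp continuous_snd))))
    exact (hWc.comp continuous_fst).mul (((k3.comp continuous_snd).pow d).mul hc))] at hsw
  have hin : ∀ θ : ℝ, ∫ v, W θ * (c1 v ^ d *
      F₂ (X θ * hopfFst v - Y θ * c2 v) (X θ * hopfSnd v + Y θ * c1 v)) ∂hopfMeasure
      = taylorCoef (fun t : ℂ => F (t • e)) d * ((2 * Real.pi : ℂ) ^ 2 / (d + 1)) *
        (W θ * X θ ^ d) := by
    intro θ
    rw [integral_const_mul, integral_hopf_entire hF₂c hF₂1 hF₂2]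
    simp only [hF₂, zero_smul, add_zero]
    ring
  simp_rw [hin] at hsw
  rw [intervalIntegral.integral_const_mul] at hsw
  have hpi : (2 * Real.pi : ℂ) ^ 2 / (d + 1) ≠ 0 := by
    refine div_ne_zero (pow_ne_zero _ ?_) (Nat.cast_add_one_ne_zero d)
    exact_mod_cast (by positivity : (2 * Real.pi : ℝ) ≠ 0)
  rcases mul_eq_zero.mp hsw with h1 | h1
  · rw [(mul_eq_zero.mp h1).resolve_right hpi, zero_mul]
  · simp only [hW, hX] at h1
    rw [h1, mul_zero]

/-- If some Taylor coefficient along ℂe were nonzero, the remaining θ-integral would vanish for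
every y. Its y^j coefficient is, up to a nonzero factor, the Laguerre coefficient of charge k + j;
this needs γ ≠ 0. For large j that coefficient is nonzero, a contradiction. -/
theorem eq_zero_of_quaternionic_means [Nontrivial E] {F : E → ℂ} (hFc : Continuous F)
    (hFd : ∀ a b : E, Differentiable ℂ fun t : ℂ => F (a + t • b)) {τ : E → E}
    (hτ : IsQuaternionic τ) (k : ℤ) {β γ : ℝ} (hβ : β ≠ 0) (hγ : γ ≠ 0)
    (h : ∀ e : E, ‖e‖ = 1 → ∀ ζ, ∫ θ in (0 : ℝ)..(2 * Real.pi), Complex.exp (Complex.I * k * θ) *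
      Complex.exp (-(β * Complex.exp (-(Complex.I * θ)) * inner ℂ e ζ
        + γ * Complex.exp (Complex.I * θ) * inner ℂ (τ e) ζ)) *
      F (ζ + (β * Complex.exp (Complex.I * θ)) • e + (γ * Complex.exp (-(Complex.I * θ))) • τ e)
        = 0) (ζ : E) : F ζ = 0 := by
  obtain ⟨e, t, he, rfl⟩ : ∃ (e : E) (t : ℂ), ‖e‖ = 1 ∧ ζ = t • e := by
    by_cases hζ : ζ = 0
    · obtain ⟨e, he⟩ := exists_norm_eq E zero_le_one
      exact ⟨e, 0, he, by rw [hζ, zero_smul]⟩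
    · have hn : (‖ζ‖ : ℂ) ≠ 0 := by exact_mod_cast norm_ne_zero_iff.mpr hζ
      refine ⟨((‖ζ‖ : ℂ)⁻¹) • ζ, ‖ζ‖, ?_, ?_⟩
      · rw [norm_smul, norm_inv, Complex.norm_real, norm_norm,
          inv_mul_cancel₀ (norm_ne_zero_iff.mpr hζ)]
      · rw [smul_smul, mul_inv_cancel₀ hn, one_smul]
  have hd : Differentiable ℂ fun t : ℂ => F (t • e) := by simpa using hFd 0 e
  refine eq_zero_of_taylorCoef_eq_zero hd (fun d => ?_) t
  by_contra hne
  have h1 := fun y => (mul_eq_zero.mp (taylorCoef_mul_integral_of_quaternionic_means hFc hFd hτ k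
    β γ h he d y)).resolve_left hne
  -- The charge N must be large enough for the Laguerre coefficient to be nonzero, and at least k so
  -- that j = N - k is a natural number.
  obtain ⟨N, hN, hkN⟩ := ((eventually_laguerreCoef_ne_zero hβ d).and
    (Filter.eventually_ge_atTop k.toNat)).exists
  obtain ⟨j, hj⟩ : ∃ j : ℕ, k + j = N := ⟨(N - k).toNat, by omega⟩
  refine hN ?_
  -- Setting y = e^{iφ} and testing against e^{-ijφ} extracts the coefficient of y^j.
  have h2 : ∫ φ in (0 : ℝ)..(2 * Real.pi), Complex.exp (-(Complex.I * j * φ)) *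
      ∫ θ in (0 : ℝ)..(2 * Real.pi), Complex.exp (Complex.I * k * θ) *
        Complex.exp (-(β * Complex.exp (-(Complex.I * θ)) + γ * Complex.exp (Complex.I * θ) *
          Complex.exp (Complex.I * φ))) *
        (1 + β * Complex.exp (Complex.I * θ)) ^ d = 0 := by
    simp only [h1, mul_zero, intervalIntegral.integral_zero]
  simp_rw [← intervalIntegral.integral_const_mul] at h2
  rw [intervalIntegral_swap_of_continuous (by unfold Function.uncurry; fun_prop)] at h2
  have h3 : ∀ θ : ℝ, ∫ φ in (0 : ℝ)..(2 * Real.pi), Complex.exp (-(Complex.I * j * φ)) *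
      (Complex.exp (Complex.I * k * θ) *
        Complex.exp (-(β * Complex.exp (-(Complex.I * θ)) + γ * Complex.exp (Complex.I * θ) *
          Complex.exp (Complex.I * φ))) *
        (1 + β * Complex.exp (Complex.I * θ)) ^ d)
      = (2 * Real.pi * ((j.factorial : ℂ)⁻¹ * (-γ) ^ j)) * (Complex.exp (Complex.I * N * θ) *
        Complex.exp (-(β * Complex.exp (-(Complex.I * θ)))) *
        (1 + β * Complex.exp (Complex.I * θ)) ^ d) := by
    intro θ
    have h4 := integral_exp_mul_entire Complex.differentiable_exp j
      (-(γ * Complex.exp (Complex.I * θ)))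
    rw [taylorCoef_exp] at h4
    have h5 : Complex.exp (Complex.I * N * θ) = Complex.exp (Complex.I * k * θ) *
        Complex.exp (Complex.I * θ) ^ j := by
      rw [← Complex.exp_nat_mul, ← Complex.exp_add]
      congr 1
      have : (N : ℂ) = k + j := by exact_mod_cast congrArg (Int.cast : ℤ → ℂ) hj.symm
      rw [this]; ring
    rw [h5, show (2 * Real.pi * ((j.factorial : ℂ)⁻¹ * (-γ) ^ j)) * (Complex.exp (Complex.I * k * θ) *
        Complex.exp (Complex.I * θ) ^ j *
        Complex.exp (-(β * Complex.exp (-(Complex.I * θ)))) *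
        (1 + β * Complex.exp (Complex.I * θ)) ^ d)
      = (Complex.exp (Complex.I * k * θ) *
        Complex.exp (-(β * Complex.exp (-(Complex.I * θ)))) *
        (1 + β * Complex.exp (Complex.I * θ)) ^ d) *
        (2 * Real.pi * ((j.factorial : ℂ)⁻¹ * (-(γ * Complex.exp (Complex.I * θ))) ^ j)) by
        rw [neg_mul_eq_neg_mul (γ : ℂ), mul_pow]; ring, ← h4, ← intervalIntegral.integral_const_mul]
    refine intervalIntegral.integral_congr fun φ _ => ?_
    simp only [neg_add, Complex.exp_add, neg_mul]
    ring
  simp_rw [h3] at h2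
  rw [intervalIntegral.integral_const_mul, integral_eq_laguerreCoef] at h2
  have hpi : (2 * Real.pi : ℂ) ≠ 0 := by
    exact_mod_cast (by positivity : (2 * Real.pi : ℝ) ≠ 0)
  have hγ' : (-(γ : ℂ)) ^ j ≠ 0 := pow_ne_zero _ (neg_ne_zero.mpr (by exact_mod_cast hγ))
  have hjf : ((j.factorial : ℂ))⁻¹ ≠ 0 := inv_ne_zero (by exact_mod_cast j.factorial_ne_zero)
  have h6 := (mul_eq_zero.mp h2).resolve_left (mul_ne_zero hpi (mul_ne_zero hjf hγ'))
  exact (mul_eq_zero.mp h6).resolve_left hpi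

end Uniqueness

/-! ### Unfolding line integrals to one central period -/

/-- A measurable strip crossed once per period is a fundamental domain for the translations. -/
theorem isAddFundamentalDomain_strip {T : ℝ} (hT : 0 < T) {L : ℝ → ℝ} (hL : Measurable L)
    (hper : ∀ s, L (s + T) = L s - 1) :
    IsAddFundamentalDomain (AddSubgroup.zmultiples T) {s | L s ∈ Set.Ico (0 : ℝ) 1} volume := by
  have hn : ∀ (n : ℤ) s, L (n • T + s) = L s - n := by
    -- L + s/T is periodic, so translation by nT lowers L by exactly n. The unique translate in the
    -- strip is therefore the one with n = ⌊L s⌋, and L need not be monotone.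
    have h : Function.Periodic (fun s => L s + s / T) T := by
      intro s
      simp only [hper]
      field_simp
      ring
    intro n s
    have := h.zsmul n s
    simp only [zsmul_eq_mul] at this ⊢
    rw [add_comm s] at this
    field_simp at this ⊢
    nlinarith
  refine IsAddFundamentalDomain.mk' (hL measurableSet_Ico).nullMeasurableSet fun s => ?_
  refine ⟨⟨⌊L s⌋ • T, ⌊L s⌋, rfl⟩, ?_, ?_⟩
  · change L (⌊L s⌋ • T + s) ∈ Set.Ico (0 : ℝ) 1
    rw [hn]
    exact ⟨Int.fract_nonneg _, Int.fract_lt_one _⟩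
  · rintro ⟨_, n, rfl⟩ h
    change L (n • T + s) ∈ Set.Ico (0 : ℝ) 1 at h
    rw [hn] at h
    have : ⌊L s⌋ = n := Int.floor_eq_iff.mpr ⟨by linarith [h.1], by linarith [h.2]⟩
    simp [this]

section Twisted

variable {𝔳 𝔷 : Type*} [NormedAddCommGroup 𝔳] [InnerProductSpace ℝ 𝔳]
  [NormedAddCommGroup 𝔷] [InnerProductSpace ℝ 𝔷]

/-- The two-step nilpotent product on `𝔳 × 𝔷` given by a bilinear map. -/
def twistedMul (B : 𝔳 →ₗ[ℝ] 𝔳 →ₗ[ℝ] 𝔷) (g c : 𝔳 × 𝔷) : 𝔳 × 𝔷 :=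
  (g.1 + c.1, g.2 + c.2 + (1 / 2 : ℝ) • B g.1 c.1)

theorem twistedMul_neg_cancel (B : 𝔳 →ₗ[ℝ] 𝔳 →ₗ[ℝ] 𝔷) (hB : ∀ x, B x x = 0) (g c : 𝔳 × 𝔷) :
    twistedMul B (twistedMul B g c) (-c) = g := by
  refine Prod.ext ?_ ?_
  · simp [twistedMul]
  · simp only [twistedMul, Prod.fst_neg, Prod.snd_neg, map_neg, map_add, LinearMap.add_apply, hB]
    module

variable [FiniteDimensional ℝ 𝔳]

theorem continuous_bilin (B : 𝔳 →ₗ[ℝ] 𝔳 →ₗ[ℝ] 𝔷) :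
    Continuous fun p : 𝔳 × 𝔳 => B p.1 p.2 := by
  have := B.toContinuousBilinearMap.continuous₂
  exact this

theorem continuous_twistedMul (B : 𝔳 →ₗ[ℝ] 𝔳 →ₗ[ℝ] 𝔷) :
    Continuous fun p : (𝔳 × 𝔷) × (𝔳 × 𝔷) => twistedMul B p.1 p.2 := by
  have := (continuous_bilin B).comp
    (by fun_prop : Continuous fun p : (𝔳 × 𝔷) × (𝔳 × 𝔷) => (p.1.1, p.2.1))
  exact (by fun_prop : Continuous fun p : (𝔳 × 𝔷) × (𝔳 × 𝔷) => p.1.1 + p.2.1).prodMk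
    ((by fun_prop : Continuous fun p : (𝔳 × 𝔷) × (𝔳 × 𝔷) => p.1.2 + p.2.2).add
      (this.const_smul (1 / 2 : ℝ)))

variable [FiniteDimensional ℝ 𝔷]
  [MeasurableSpace 𝔳] [BorelSpace 𝔳] [MeasurableSpace 𝔷] [BorelSpace 𝔷]

theorem measurePreserving_twistedMul_right (B : 𝔳 →ₗ[ℝ] 𝔳 →ₗ[ℝ] 𝔷) (c : 𝔳 × 𝔷) :
    MeasurePreserving (fun g => twistedMul B g c)
      ((volume : Measure 𝔳).prod (volume : Measure 𝔷)) (volume.prod volume) := by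
  refine (measurePreserving_add_right (volume : Measure 𝔳) c.1).skew_product
    (g := fun x u => u + c.2 + (1 / 2 : ℝ) • B x c.1) ?_ (Filter.Eventually.of_forall fun x => ?_)
  · have := (continuous_bilin B).comp
      (by fun_prop : Continuous fun p : 𝔳 × 𝔷 => (p.1, c.1))
    have h : Continuous (Function.uncurry fun x u => u + c.2 + (1 / 2 : ℝ) • B x c.1) :=
      (by fun_prop : Continuous fun p : 𝔳 × 𝔷 => p.2 + c.2).add (this.const_smul (1 / 2 : ℝ))
    exact h.measurable
  · simp only [add_assoc]
    exact (measurePreserving_add_right (volume : Measure 𝔷) _).map_eq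

/-- If the integrals of `f` over all right translates of a curve which is periodic modulo the
centre vanish, then `f` is orthogonal to the mean of any function that is invariant under the
central period. -/
theorem integral_mul_period_mean_eq_zero (B : 𝔳 →ₗ[ℝ] 𝔳 →ₗ[ℝ] 𝔷) (hB : ∀ x, B x x = 0)
    {f : 𝔳 × 𝔷 → ℂ} (hf : Integrable f) {c : ℝ → 𝔳 × 𝔷} (hc : Continuous c) {T : ℝ} (hT : 0 < T)
    {κ : 𝔷} (hcT : ∀ s, c (s + T) = c s + (0, κ)) (ℓ : 𝔷 →L[ℝ] ℝ) (hℓ : ℓ κ = 1)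
    (hray : ∀ᵐ g : 𝔳 × 𝔷, ∫ s : ℝ, f (twistedMul B g (c s)) = 0)
    {Φ : 𝔳 × 𝔷 → ℂ} (hΦ : Continuous Φ) {C : ℝ} (hC : ∀ g, ‖Φ g‖ ≤ C)
    (hΦκ : ∀ x u, Φ (x, u + κ) = Φ (x, u)) :
    ∫ g, f g * ∫ s in (0 : ℝ)..T, Φ (twistedMul B g (-c s)) = 0 := by
  have hcm := continuous_twistedMul B
  have hback : Continuous fun p : ℝ × (𝔳 × 𝔷) => twistedMul B p.2 (-c p.1) :=
    hcm.comp (by fun_prop : Continuous fun p : ℝ × (𝔳 × 𝔷) => (p.2, -c p.1))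
  have hfwd : Continuous fun p : ℝ × (𝔳 × 𝔷) => twistedMul B p.2 (c p.1) :=
    hcm.comp (by fun_prop : Continuous fun p : ℝ × (𝔳 × 𝔷) => (p.2, c p.1))
  -- S contains one representative of each orbit under translation by κ. It is unbounded in the
  -- other directions, which is harmless because integrability over G comes from f.
  set S : Set (𝔳 × 𝔷) := {g | ℓ g.2 ∈ Set.Ico (0 : ℝ) 1} with hS
  have hSm : MeasurableSet S :=
    ((by fun_prop : Continuous fun g : 𝔳 × 𝔷 => ℓ g.2).measurable) measurableSet_Ico
  set χΦ : 𝔳 × 𝔷 → ℂ := S.indicator Φ with hχΦ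
  have hχΦm : Measurable χΦ := hΦ.measurable.indicator hSm
  set H' : ℝ × (𝔳 × 𝔷) → ℂ := fun p => χΦ (twistedMul B p.2 (-c p.1)) * f p.2 with hH'
  have hstep : ∀ g s, twistedMul B g (-c (s + T)) = twistedMul B g (-c s) - (0, κ) := by
    intro g s
    rw [hcT]
    refine Prod.ext ?_ ?_
    · simp [twistedMul]
    · simp [twistedMul]; abel
  -- Along s ↦ g c(s)⁻¹ the value of ℓ drops by one per period, so the times spent in S form a
  -- fundamental domain for Tℤ. Hence integrating the cut-off Φ over the whole line equals
  -- integrating Φ over [0, T].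
  have hfd : ∀ g, IsAddFundamentalDomain (AddSubgroup.zmultiples T)
      {s | twistedMul B g (-c s) ∈ S} volume := by
    intro g
    refine isAddFundamentalDomain_strip (L := fun s => ℓ (twistedMul B g (-c s)).2) hT ?_ ?_
    · have : Continuous fun s => twistedMul B g (-c s) :=
        hback.comp (by fun_prop : Continuous fun s : ℝ => (s, g))
      exact (by fun_prop : Continuous fun s => ℓ (twistedMul B g (-c s)).2).measurable
    · intro s
      rw [hstep]
      simp [hℓ]
  have hfd0 : IsAddFundamentalDomain (AddSubgroup.zmultiples T) (Set.Ioc (0 : ℝ) T) volume := by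
    simpa using isAddFundamentalDomain_Ioc hT 0
  have hinv : ∀ g (n : AddSubgroup.zmultiples T) s,
      Φ (twistedMul B g (-c (n +ᵥ s))) = Φ (twistedMul B g (-c s)) := by
    intro g
    have h : Function.Periodic (fun s => Φ (twistedMul B g (-c s))) T := by
      intro s
      simp only [hstep]
      have := hΦκ (twistedMul B g (-c s)).1 ((twistedMul B g (-c s)).2 - κ)
      rw [sub_add_cancel] at this
      rw [Prod.mk.eta] at this
      rw [this]
      congr 1
      refine Prod.ext ?_ ?_ <;> simp
    rintro ⟨_, n, rfl⟩ s
    change Φ (twistedMul B g (-c (n • T + s))) = _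
    rw [add_comm]
    exact h.zsmul n s
  have hcg : ∀ g, Continuous fun s => Φ (twistedMul B g (-c s)) := fun g =>
    hΦ.comp (hback.comp (by fun_prop : Continuous fun s : ℝ => (s, g)))
  have hSgm : ∀ g, MeasurableSet {s | twistedMul B g (-c s) ∈ S} := fun g =>
    (hback.comp (by fun_prop : Continuous fun s : ℝ => (s, g))).measurable hSm
  have hind : ∀ g s, χΦ (twistedMul B g (-c s))
      = {s | twistedMul B g (-c s) ∈ S}.indicator (fun s => Φ (twistedMul B g (-c s))) s := by
    intro g s
    by_cases h : twistedMul B g (-c s) ∈ S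
    · rw [hχΦ, Set.indicator_of_mem h, Set.indicator_of_mem (by exact h)]
    · rw [hχΦ, Set.indicator_of_notMem h, Set.indicator_of_notMem (by exact h)]
  have hint : ∀ g, Integrable fun s => χΦ (twistedMul B g (-c s)) := by
    intro g
    simp_rw [hind]
    rw [integrable_indicator_iff (hSgm g), (hfd g).integrableOn_iff hfd0 (hinv g)]
    exact (hcg g).integrableOn_Ioc
  have hval : ∀ g, ∫ s, χΦ (twistedMul B g (-c s))
      = ∫ s in (0 : ℝ)..T, Φ (twistedMul B g (-c s)) := by
    intro g
    simp_rw [hind]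
    rw [integral_indicator (hSgm g), (hfd g).setIntegral_eq hfd0 (hinv g),
      intervalIntegral.integral_of_le hT.le]
  have hvalnorm : ∀ g, ∫ s, ‖χΦ (twistedMul B g (-c s))‖
      = ∫ s in (0 : ℝ)..T, ‖Φ (twistedMul B g (-c s))‖ := by
    intro g
    simp_rw [hind, norm_indicator_eq_indicator_norm]
    rw [integral_indicator (hSgm g), (hfd g).setIntegral_eq hfd0 (fun n s => by rw [hinv g]),
      intervalIntegral.integral_of_le hT.le]
  have hH'm : AEStronglyMeasurable H' ((volume : Measure ℝ).prod (volume : Measure (𝔳 × 𝔷))) :=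
    (hχΦm.comp hback.measurable).aestronglyMeasurable.mul hf.aestronglyMeasurable.comp_snd
  have hH'i : Integrable H' ((volume : Measure ℝ).prod (volume : Measure (𝔳 × 𝔷))) := by
    rw [integrable_prod_iff' hH'm]
    refine ⟨Filter.Eventually.of_forall fun g => by
      simpa only [hH'] using (hint g).mul_const (f g), ?_⟩
    refine (hf.norm.const_mul (C * T)).mono' hH'm.norm.prod_swap.integral_prod_right'
      (Filter.Eventually.of_forall fun g => ?_)
    simp only [hH', norm_mul]
    rw [integral_mul_const, hvalnorm, Real.norm_of_nonneg]
    · gcongr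
      refine (Real.le_norm_self _).trans ?_
      refine (intervalIntegral.norm_integral_le_of_norm_le_const (C := C) fun s _ => ?_).trans ?_
      · rw [norm_norm]; exact hC _
      · rw [sub_zero, abs_of_pos hT]
    · refine mul_nonneg ?_ (norm_nonneg _)
      exact intervalIntegral.integral_nonneg hT.le fun s _ => norm_nonneg _
  -- Right translation preserves Haar measure, so replacing g by g c(s) moves the curve from Φ to f.
  -- The inner integral is then the vanishing line integral of f.
  have hshear : MeasurePreserving (fun p : ℝ × (𝔳 × 𝔷) => (p.1, twistedMul B p.2 (c p.1)))
      ((volume : Measure ℝ).prod (volume : Measure (𝔳 × 𝔷)))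
      ((volume : Measure ℝ).prod (volume : Measure (𝔳 × 𝔷))) :=
    (MeasurePreserving.id (volume : Measure ℝ)).skew_product
      (g := fun s g => twistedMul B g (c s)) hfwd.measurable
      (Filter.Eventually.of_forall fun s => (measurePreserving_twistedMul_right B (c s)).map_eq)
  have hcomp : ∀ p : ℝ × (𝔳 × 𝔷), H' (p.1, twistedMul B p.2 (c p.1))
      = χΦ p.2 * f (twistedMul B p.2 (c p.1)) := by
    intro p
    simp only [hH', twistedMul_neg_cancel B hB]
  have e1 : ∫ p, H' p ∂((volume : Measure ℝ).prod (volume : Measure (𝔳 × 𝔷)))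
      = ∫ g, f g * ∫ s in (0 : ℝ)..T, Φ (twistedMul B g (-c s)) := by
    rw [integral_prod_symm _ hH'i]
    refine integral_congr_ae (Filter.Eventually.of_forall fun g => ?_)
    simp only [hH']
    rw [integral_mul_const, hval, mul_comm]
  have e2 : ∫ p, H' p ∂((volume : Measure ℝ).prod (volume : Measure (𝔳 × 𝔷))) = 0 := by
    have h1 : ∫ p, H' p ∂((volume : Measure ℝ).prod (volume : Measure (𝔳 × 𝔷)))
        = ∫ p : ℝ × (𝔳 × 𝔷), H' (p.1, twistedMul B p.2 (c p.1))
          ∂((volume : Measure ℝ).prod (volume : Measure (𝔳 × 𝔷))) := by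
      conv_lhs => rw [← hshear.map_eq]
      rw [integral_map hshear.measurable.aemeasurable (by rw [hshear.map_eq]; exact hH'm)]
    have h2 : Integrable (fun p : ℝ × (𝔳 × 𝔷) => H' (p.1, twistedMul B p.2 (c p.1)))
        ((volume : Measure ℝ).prod (volume : Measure (𝔳 × 𝔷))) :=
      hshear.integrable_comp_of_integrable hH'i
    rw [h1, integral_prod_symm _ h2]
    rw [integral_congr_ae (g := fun _ => (0 : ℂ))]
    · simp
    · filter_upwards [hray] with g hg
      rw [integral_congr_ae (g := fun s => χΦ g * f (twistedMul B g (c s)))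
        (Filter.Eventually.of_forall fun s => hcomp (s, g)), integral_const_mul, hg, mul_zero]
  rw [← e1, e2]

end Twisted

/-! ### Pointwise growth in Fock space -/

section FockGrowth

variable {n : ℕ}

/-- Rotation by the angle `θ` as a real isometry. -/
def rotationIsometry (n : ℕ) (θ : ℝ) :
    EuclideanSpace ℂ (Fin n) ≃ₗᵢ[ℝ] EuclideanSpace ℂ (Fin n) where
  toLinearEquiv := (LinearEquiv.smulOfNeZero ℂ (EuclideanSpace ℂ (Fin n))
    (Complex.exp (Complex.I * θ)) (Complex.exp_ne_zero _)).restrictScalars ℝ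
  norm_map' ζ := by
    change ‖Complex.exp (Complex.I * θ) • ζ‖ = ‖ζ‖
    rw [norm_smul, norm_exp_I_mul, one_mul]

theorem rotationIsometry_apply (θ : ℝ) (ζ : EuclideanSpace ℂ (Fin n)) :
    rotationIsometry n θ ζ = Complex.exp (Complex.I * θ) • ζ := rfl

/-- Holomorphic functions satisfy the mean value property for the Gaussian measure. -/
theorem integral_gaussian_mean {G : EuclideanSpace ℂ (Fin n) → ℂ} (hG : Differentiable ℂ G)
    (hi : Integrable fun ζ => G ζ * (Real.exp (-‖ζ‖ ^ 2) : ℂ)) :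
    ∫ ζ, G ζ * (Real.exp (-‖ζ‖ ^ 2) : ℂ)
      = G 0 * ∫ ζ : EuclideanSpace ℂ (Fin n), (Real.exp (-‖ζ‖ ^ 2) : ℂ) := by
  set P : EuclideanSpace ℂ (Fin n) → ℂ := fun ζ => G ζ * (Real.exp (-‖ζ‖ ^ 2) : ℂ) with hP
  have hPr : ∀ θ ζ, P (rotationIsometry n θ ζ)
      = G (Complex.exp (Complex.I * θ) • ζ) * (Real.exp (-‖ζ‖ ^ 2) : ℂ) := by
    intro θ ζ
    change G _ * (Real.exp (-‖rotationIsometry n θ ζ‖ ^ 2) : ℂ) = _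
    rw [LinearIsometryEquiv.norm_map, rotationIsometry_apply]
  have hmp : ∀ θ, MeasurePreserving (rotationIsometry n θ) volume volume := fun θ =>
    (rotationIsometry n θ).measurePreserving
  have hme : ∀ θ, MeasurableEmbedding (rotationIsometry n θ) := fun θ =>
    (rotationIsometry n θ).toHomeomorph.measurableEmbedding
  -- The Gaussian is invariant under ζ ↦ e^{iθ}ζ, so G may be replaced by its average over θ, which
  -- is G(0) by the mean value property on ℂζ.
  have h1 : ∀ θ, ∫ ζ, P (rotationIsometry n θ ζ) = ∫ ζ, P ζ := fun θ =>
    (hmp θ).integral_comp (hme θ) P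
  have h1n : ∀ θ, ∫ ζ, ‖P (rotationIsometry n θ ζ)‖ = ∫ ζ, ‖P ζ‖ := fun θ =>
    (hmp θ).integral_comp (hme θ) fun ζ => ‖P ζ‖
  have hPc : Continuous P := by
    have := hG.continuous
    simp only [hP]
    fun_prop
  have hjc : Continuous (Function.uncurry fun (θ : ℝ) ζ => P (rotationIsometry n θ ζ)) := by
    refine hPc.comp ?_
    exact (by fun_prop : Continuous fun p : ℝ × EuclideanSpace ℂ (Fin n) =>
      Complex.exp (Complex.I * p.1) • p.2)
  have hsw := intervalIntegral_integral_swap (a := 0) (b := 2 * Real.pi) (μ := volume)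
    (f := fun (θ : ℝ) ζ => P (rotationIsometry n θ ζ)) (by
      rw [integrable_prod_iff hjc.aestronglyMeasurable]
      refine ⟨Filter.Eventually.of_forall fun θ =>
        (hmp θ).integrable_comp_of_integrable hi, ?_⟩
      simp only [Function.uncurry, h1n]
      rw [Set.uIoc_of_le (by positivity)]
      exact integrable_const _)
  have hin : ∀ ζ, ∫ θ in (0 : ℝ)..(2 * Real.pi), P (rotationIsometry n θ ζ)
      = 2 * Real.pi * (G 0 * (Real.exp (-‖ζ‖ ^ 2) : ℂ)) := by
    intro ζ
    simp_rw [hPr]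
    have hu : Differentiable ℂ fun t : ℂ => G (t • ζ) :=
      hG.comp (differentiable_id.smul_const ζ)
    have := integral_exp_mul_entire hu 0 1
    simp only [Nat.cast_zero, mul_zero, zero_mul, neg_zero, Complex.exp_zero, one_mul, pow_zero,
      mul_one, taylorCoef_zero, zero_smul] at this
    rw [intervalIntegral.integral_mul_const, this]
    ring
  simp_rw [h1, hin] at hsw
  rw [intervalIntegral.integral_const, integral_const_mul, integral_const_mul] at hsw
  have hpi : (2 * Real.pi : ℂ) ≠ 0 := by
    exact_mod_cast (by positivity : (2 * Real.pi : ℝ) ≠ 0)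
  refine mul_left_cancel₀ hpi ?_
  rw [← hsw]
  simp

theorem integrable_gaussian (n : ℕ) :
    Integrable fun ζ : EuclideanSpace ℂ (Fin n) => Real.exp (-‖ζ‖ ^ 2) := by
  have h := GaussianFourier.integrable_cexp_neg_mul_sq_norm_add (b := 1)
    (V := EuclideanSpace ℂ (Fin n)) (by norm_num) 0 0
  refine h.norm.congr (Filter.Eventually.of_forall fun ζ => ?_)
  simp only [zero_mul, add_zero, Complex.norm_exp]
  congr 1
  rw [show -1 * (‖ζ‖ : ℂ) ^ 2 = ((-‖ζ‖ ^ 2 : ℝ) : ℂ) by push_cast; ring, Complex.ofReal_re]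

/-- Evaluation at the origin is bounded on spheres of Fock space. -/
theorem exists_bound_apply_zero (n : ℕ) (r : ℝ) :
    ∃ C : ℝ, ∀ F : Fock n, ‖F‖ = r → ‖F 0‖ ≤ C := by
  set c₀ := ∫ ζ : EuclideanSpace ℂ (Fin n), Real.exp (-‖ζ‖ ^ 2) with hc₀
  have hpos : 0 < c₀ := by
    rw [hc₀, integral_pos_iff_support_of_nonneg (fun ζ => (Real.exp_pos _).le)
      (integrable_gaussian n)]
    have : Function.support (fun ζ : EuclideanSpace ℂ (Fin n) => Real.exp (-‖ζ‖ ^ 2))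
        = Set.univ := by
      ext ζ; simp [(Real.exp_pos _).ne']
    rw [this]
    exact Measure.measure_univ_pos.mpr (NeZero.ne _)
  -- This crude constant comes from |F| ≤ 1 + |F|² integrated against the Gaussian; only uniformity
  -- over ‖F‖ = r is needed.
  refine ⟨(c₀ + Real.pi ^ n * r ^ 2) / c₀, fun F hF => ?_⟩
  have hdom : Integrable fun ζ => Real.exp (-‖ζ‖ ^ 2) + ‖F ζ‖ ^ 2 * Real.exp (-‖ζ‖ ^ 2) :=
    (integrable_gaussian n).add F.integrable
  have hle : ∀ ζ, ‖F ζ * (Real.exp (-‖ζ‖ ^ 2) : ℂ)‖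
      ≤ Real.exp (-‖ζ‖ ^ 2) + ‖F ζ‖ ^ 2 * Real.exp (-‖ζ‖ ^ 2) := by
    intro ζ
    rw [norm_mul, Complex.norm_real, Real.norm_of_nonneg (Real.exp_pos _).le]
    have := Real.exp_pos (-‖ζ‖ ^ 2)
    nlinarith [sq_nonneg (‖F ζ‖ - 1), norm_nonneg (F ζ)]
  have hc := F.differentiable.continuous
  have hi : Integrable fun ζ => F ζ * (Real.exp (-‖ζ‖ ^ 2) : ℂ) :=
    hdom.mono' (Continuous.aestronglyMeasurable (by fun_prop)) (Filter.Eventually.of_forall hle)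
  have h1 := integral_gaussian_mean F.differentiable hi
  rw [integral_complex_ofReal, ← hc₀] at h1
  have h2 : ‖F 0‖ * c₀ ≤ c₀ + Real.pi ^ n * r ^ 2 := by
    calc ‖F 0‖ * c₀ = ‖∫ ζ, F ζ * (Real.exp (-‖ζ‖ ^ 2) : ℂ)‖ := by
          rw [h1, norm_mul, Complex.norm_real, Real.norm_of_nonneg hpos.le]
      _ ≤ ∫ ζ, ‖F ζ * (Real.exp (-‖ζ‖ ^ 2) : ℂ)‖ := norm_integral_le_integral_norm _
      _ ≤ ∫ ζ, (Real.exp (-‖ζ‖ ^ 2) + ‖F ζ‖ ^ 2 * Real.exp (-‖ζ‖ ^ 2)) :=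
          integral_mono hi.norm hdom hle
      _ = c₀ + ∫ ζ, ‖F ζ‖ ^ 2 * Real.exp (-‖ζ‖ ^ 2) :=
          integral_add (integrable_gaussian n) F.integrable
      _ = c₀ + Real.pi ^ n * r ^ 2 := by
          rw [← hF, fock_norm_sq, ← mul_assoc, mul_inv_cancel₀ (by positivity), one_mul]
  rwa [le_div_iff₀ hpos]

/-- Elements of Fock space grow at most like `e^{|ζ|²/2}`, uniformly on spheres. -/
theorem exists_fock_growth (n : ℕ) (r : ℝ) :
    ∃ C : ℝ, 0 ≤ C ∧ ∀ F : Fock n, ‖F‖ = r → ∀ ζ, ‖F ζ‖ ≤ C * Real.exp (‖ζ‖ ^ 2 / 2) := by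
  obtain ⟨C, hC⟩ := exists_bound_apply_zero n r
  refine ⟨max C 0, le_max_right _ _, fun F hF ζ => ?_⟩
  -- At h = 2 the unitary operator translates by exactly ζ, and at the origin its factor is
  -- e^{-|ζ|²/2}.
  have h := hC (bargmannLinear 2 zero_le_two ζ 0 F) (by rw [norm_bargmannLinear, hF])
  rw [bargmannLinear_apply, bargmannFactor] at h
  simp only [inner_zero_right, mul_zero, Complex.ofReal_zero, norm_mul, Complex.norm_exp,
    ne_eq, OfNat.ofNat_ne_zero, not_false_eq_true, div_self, Real.sqrt_one, Complex.ofReal_one,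
    one_smul, zero_add, sub_zero, zero_sub] at h
  have e1 : (-(((2 : ℝ) : ℂ) / 4 * (‖ζ‖ : ℂ) ^ 2)).re = -(‖ζ‖ ^ 2 / 2) := by
    rw [show -(((2 : ℝ) : ℂ) / 4 * (‖ζ‖ : ℂ) ^ 2) = ((-(‖ζ‖ ^ 2 / 2) : ℝ) : ℂ) by
      push_cast; ring, Complex.ofReal_re]
  rw [e1, Real.exp_neg, inv_mul_le_iff₀ (Real.exp_pos _)] at h
  rw [mul_comm]
  exact h.trans (by gcongr; exact le_max_left _ _)

end FockGrowth

/-! ### Orbits of the representation and the pointwise Fourier transform -/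

namespace HTypeAlgebra

variable {𝔳 𝔷 : Type*} [NormedAddCommGroup 𝔳] [InnerProductSpace ℝ 𝔳]
  [FiniteDimensional ℝ 𝔳] [NormedAddCommGroup 𝔷] [InnerProductSpace ℝ 𝔷]
  {A : HTypeAlgebra 𝔳 𝔷} {μ : 𝔷} {n : ℕ}

/-- The value at `ζ` of `π_μ(g)⁻¹ φ`. -/
def NormalForm.orbit (N : A.NormalForm μ n) (hμ : μ ≠ 0) (φ : Fock n) (g : 𝔳 × 𝔷)
    (ζ : EuclideanSpace ℂ (Fin n)) : ℂ :=
  ((N.rep hμ (HTypeGroup.mk A g.1 g.2))⁻¹ φ) ζ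

theorem NormalForm.rep_apply (N : A.NormalForm μ n) (hμ : μ ≠ 0) (φ : Fock n) (g : HTypeGroup A)
    (ζ : EuclideanSpace ℂ (Fin n)) :
    (N.rep hμ g φ) ζ = Complex.exp (Complex.I * ‖μ‖ * (inner ℝ μ g.2 / ‖μ‖ : ℝ)
        - (√(‖μ‖ / 2) : ℝ) * inner ℂ (N.R.symm g.1) ζ - (‖μ‖ / 4) * ‖N.R.symm g.1‖ ^ 2)
      * φ (ζ + (√(‖μ‖ / 2) : ℂ) • N.R.symm g.1) :=
  rfl

theorem NormalForm.orbit_eq (N : A.NormalForm μ n) (hμ : μ ≠ 0) (φ : Fock n) (g : 𝔳 × 𝔷)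
    (ζ : EuclideanSpace ℂ (Fin n)) :
    N.orbit hμ φ g ζ = Complex.exp (-(Complex.I * (inner ℝ μ g.2 : ℝ))
        + (√(‖μ‖ / 2) : ℝ) * inner ℂ (N.R.symm g.1) ζ - (‖μ‖ / 4) * ‖N.R.symm g.1‖ ^ 2)
      * φ (ζ - (√(‖μ‖ / 2) : ℂ) • N.R.symm g.1) := by
  rw [NormalForm.orbit, ← map_inv, N.rep_apply]
  change Complex.exp (Complex.I * ‖μ‖ * (inner ℝ μ (-g.2) / ‖μ‖ : ℝ)
        - (√(‖μ‖ / 2) : ℝ) * inner ℂ (N.R.symm (-g.1)) ζ - (‖μ‖ / 4) * ‖N.R.symm (-g.1)‖ ^ 2)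
      * φ (ζ + (√(‖μ‖ / 2) : ℂ) • N.R.symm (-g.1)) = _
  have hn : (‖μ‖ : ℂ) ≠ 0 := by exact_mod_cast norm_ne_zero_iff.mpr hμ
  rw [map_neg, inner_neg_left, inner_neg_right, norm_neg, smul_neg, ← sub_eq_add_neg]
  congr 2
  push_cast
  field_simp
  ring

theorem NormalForm.continuous_orbit (N : A.NormalForm μ n) (hμ : μ ≠ 0) (φ : Fock n)
    {X : Type*} [TopologicalSpace X] {a : X → 𝔳 × 𝔷} {b : X → EuclideanSpace ℂ (Fin n)}
    (ha : Continuous a) (hb : Continuous b) : Continuous fun x => N.orbit hμ φ (a x) (b x) := by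
  simp_rw [N.orbit_eq]
  have h1 := φ.differentiable.continuous
  have h3 : Continuous fun x => N.R.symm (a x).1 := N.R.symm.continuous.comp (by fun_prop)
  have h4 : Continuous fun x => φ (b x - (√(‖μ‖ / 2) : ℂ) • N.R.symm (a x).1) :=
    h1.comp (by fun_prop)
  refine Continuous.mul ?_ h4
  refine Complex.continuous_exp.comp ?_
  fun_prop

/-- By unitarity the orbit stays on the sphere of radius ‖φ‖, which makes the bound uniform in g.
This lets |f| dominate all integrals over G below. -/
theorem NormalForm.exists_norm_orbit_le (N : A.NormalForm μ n) (hμ : μ ≠ 0) (φ : Fock n) :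
    ∃ C : ℝ, 0 ≤ C ∧ ∀ g ζ, ‖N.orbit hμ φ g ζ‖ ≤ C * Real.exp (‖ζ‖ ^ 2 / 2) := by
  obtain ⟨C, hC0, hC⟩ := exists_fock_growth n ‖φ‖
  exact ⟨C, hC0, fun g ζ => hC _ (LinearIsometryEquiv.norm_map _ φ) ζ⟩

theorem NormalForm.differentiable_orbit (N : A.NormalForm μ n) (hμ : μ ≠ 0) (φ : Fock n)
    (g : 𝔳 × 𝔷) : Differentiable ℂ (N.orbit hμ φ g) :=
  ((N.rep hμ (HTypeGroup.mk A g.1 g.2))⁻¹ φ).differentiable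

/-- The centre acts through the character e^{i⟨μ,u⟩}, which is trivial on κ. This is where
compatibility enters. -/
theorem NormalForm.orbit_add_centre (N : A.NormalForm μ n) (hμ : μ ≠ 0) (φ : Fock n) {κ : 𝔷} {k : ℤ}
    (hκ : inner ℝ μ κ = 2 * Real.pi * k) (x : 𝔳) (u : 𝔷) (ζ : EuclideanSpace ℂ (Fin n)) :
    N.orbit hμ φ (x, u + κ) ζ = N.orbit hμ φ (x, u) ζ := by
  rw [N.orbit_eq, N.orbit_eq]
  congr 1
  rw [Complex.exp_eq_exp_iff_exists_int]
  refine ⟨-k, ?_⟩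
  simp only [inner_add_right, hκ]
  push_cast
  ring

/-- Because (gc⁻¹)⁻¹ = cg⁻¹, translating g amounts to applying π_μ(c) in the variable ζ, with a
factor that does not involve g. The integral against f then passes through it. -/
theorem NormalForm.orbit_twistedMul_neg (N : A.NormalForm μ n) (hμ : μ ≠ 0) (φ : Fock n)
    (g c : 𝔳 × 𝔷) (ζ : EuclideanSpace ℂ (Fin n)) :
    N.orbit hμ φ (twistedMul A.bracket g (-c)) ζ
      = Complex.exp (Complex.I * (inner ℝ μ c.2 : ℝ)
          - (√(‖μ‖ / 2) : ℝ) * inner ℂ (N.R.symm c.1) ζ - (‖μ‖ / 4) * ‖N.R.symm c.1‖ ^ 2)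
        * N.orbit hμ φ g (ζ + (√(‖μ‖ / 2) : ℂ) • N.R.symm c.1) := by
  have h1 : HTypeGroup.mk A (twistedMul A.bracket g (-c)).1 (twistedMul A.bracket g (-c)).2
      = HTypeGroup.mk A g.1 g.2 * (HTypeGroup.mk A c.1 c.2)⁻¹ := rfl
  rw [NormalForm.orbit, h1, ← map_inv, mul_inv_rev, inv_inv, map_mul]
  change (N.rep hμ (HTypeGroup.mk A c.1 c.2) (N.rep hμ (HTypeGroup.mk A g.1 g.2)⁻¹ φ)) ζ = _
  rw [N.rep_apply, NormalForm.orbit, map_inv]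
  change Complex.exp (Complex.I * ‖μ‖ * (inner ℝ μ c.2 / ‖μ‖ : ℝ)
        - (√(‖μ‖ / 2) : ℝ) * inner ℂ (N.R.symm c.1) ζ - (‖μ‖ / 4) * ‖N.R.symm c.1‖ ^ 2)
      * _ = _
  have hn : (‖μ‖ : ℂ) ≠ 0 := by exact_mod_cast norm_ne_zero_iff.mpr hμ
  congr 2
  push_cast
  field_simp

theorem NormalForm.orbit_apply (N : A.NormalForm μ n) (hμ : μ ≠ 0) (φ : Fock n) (g : 𝔳 × 𝔷)
    (ζ : EuclideanSpace ℂ (Fin n)) :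
    N.orbit hμ φ g ζ = ((N.rep hμ (HTypeGroup.mk A g.1 g.2))⁻¹ φ) ζ := rfl

attribute [irreducible] NormalForm.orbit

variable [FiniteDimensional ℝ 𝔷] [MeasurableSpace 𝔳] [BorelSpace 𝔳]
  [MeasurableSpace 𝔷] [BorelSpace 𝔷]

/-- The value at `ζ` of `𝓕(f)(μ) φ`. -/
def NormalForm.fourierApply (N : A.NormalForm μ n) (hμ : μ ≠ 0) (f : 𝔳 × 𝔷 → ℂ) (φ : Fock n)
    (ζ : EuclideanSpace ℂ (Fin n)) : ℂ :=
  ∫ g, f g * N.orbit hμ φ g ζ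

theorem NormalForm.aestronglyMeasurable_orbit (N : A.NormalForm μ n) (hμ : μ ≠ 0) (φ : Fock n)
    {f : 𝔳 × 𝔷 → ℂ} (hf : Integrable f) (ζ : EuclideanSpace ℂ (Fin n)) :
    AEStronglyMeasurable fun g => f g * N.orbit hμ φ g ζ := by
  exact hf.aestronglyMeasurable.mul
    (N.continuous_orbit hμ φ continuous_id continuous_const).aestronglyMeasurable

theorem NormalForm.continuous_fourierApply (N : A.NormalForm μ n) (hμ : μ ≠ 0)
    {f : 𝔳 × 𝔷 → ℂ} (hf : Integrable f) (φ : Fock n) :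
    Continuous (N.fourierApply hμ f φ) := by
  obtain ⟨C, hC0, hC⟩ := N.exists_norm_orbit_le hμ φ
  rw [continuous_iff_continuousAt]
  intro ζ₀
  refine continuousAt_of_dominated
    (bound := fun g => ‖f g‖ * (C * Real.exp ((‖ζ₀‖ + 1) ^ 2 / 2)))
    (Filter.Eventually.of_forall fun ζ => N.aestronglyMeasurable_orbit hμ φ hf ζ) ?_
    (hf.norm.mul_const _) (Filter.Eventually.of_forall fun g => ?_)
  · filter_upwards [Metric.ball_mem_nhds ζ₀ one_pos] with ζ hζ
    refine Filter.Eventually.of_forall fun g => ?_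
    rw [norm_mul]
    have h1 : ‖ζ‖ ≤ ‖ζ₀‖ + 1 := by
      rw [Metric.mem_ball, dist_eq_norm] at hζ
      have := norm_add_le (ζ - ζ₀) ζ₀
      rw [sub_add_cancel] at this
      linarith
    refine mul_le_mul_of_nonneg_left ((hC g ζ).trans ?_) (norm_nonneg _)
    gcongr
  · exact ((N.differentiable_orbit hμ φ g).continuous.const_mul (f g)).continuousAt

theorem NormalForm.differentiable_fourierApply_line (N : A.NormalForm μ n) (hμ : μ ≠ 0)
    {f : 𝔳 × 𝔷 → ℂ} (hf : Integrable f) (φ : Fock n) (a b : EuclideanSpace ℂ (Fin n)) :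
    Differentiable ℂ fun t : ℂ => N.fourierApply hμ f φ (a + t • b) := by
  obtain ⟨C, hC0, hC⟩ := N.exists_norm_orbit_le hμ φ
  refine differentiable_integral_of_bound
    (G := fun g t => f g * N.orbit hμ φ g (a + t • b)) (fun g => ?_)
    (fun t => N.aestronglyMeasurable_orbit hμ φ hf _) fun R => ?_
  · refine ((N.differentiable_orbit hμ φ g).comp ?_).const_mul _
    exact (differentiable_const a).add (differentiable_id.smul_const b)
  · refine ⟨fun g => ‖f g‖ * (C * Real.exp ((‖a‖ + R * ‖b‖) ^ 2 / 2)), hf.norm.mul_const _,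
      fun g t ht => ?_⟩
    rw [norm_mul]
    refine mul_le_mul_of_nonneg_left ((hC g _).trans ?_) (norm_nonneg _)
    have h1 : ‖a + t • b‖ ≤ ‖a‖ + R * ‖b‖ := by
      refine (norm_add_le _ _).trans ?_
      rw [norm_smul]
      gcongr
    gcongr

/-- The Fourier transform vanishes as an operator if it vanishes pointwise on Fock space. -/
theorem NormalForm.isFourierTransform_zero (N : A.NormalForm μ n) (hμ : μ ≠ 0)
    {f : 𝔳 × 𝔷 → ℂ} (hf : Integrable f) (h0 : ∀ φ ζ, N.fourierApply hμ f φ ζ = 0) :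
    N.IsFourierTransform hμ f 0 := by
  intro φ ψ
  set P : 𝔳 × 𝔷 → Fock n := fun g => (N.rep hμ (HTypeGroup.mk A g.1 g.2))⁻¹ φ with hP
  have hPn : ∀ g, ‖P g‖ = ‖φ‖ := fun g => LinearIsometryEquiv.norm_map _ φ
  have hPo : ∀ g ζ, P g ζ = N.orbit hμ φ g ζ := fun g ζ => (N.orbit_apply hμ φ g ζ).symm
  set D : (𝔳 × 𝔷) → EuclideanSpace ℂ (Fin n) → ℂ := fun g ζ =>
    f g * (starRingEnd ℂ (ψ ζ) * P g ζ * (Real.exp (-‖ζ‖ ^ 2) : ℂ)) with hD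
  have hDm : AEStronglyMeasurable (Function.uncurry D)
      ((volume : Measure (𝔳 × 𝔷)).prod volume) := by
    refine hf.aestronglyMeasurable.comp_fst.mul (Continuous.aestronglyMeasurable ?_)
    have h1 := (Complex.continuous_conj.comp ψ.differentiable.continuous).comp
      (continuous_snd : Continuous fun p : (𝔳 × 𝔷) × EuclideanSpace ℂ (Fin n) => p.2)
    have h2 : Continuous fun p : (𝔳 × 𝔷) × EuclideanSpace ℂ (Fin n) => P p.1 p.2 := by
      simp_rw [hPo]
      exact N.continuous_orbit hμ φ continuous_fst continuous_snd
    have h3 : Continuous fun p : (𝔳 × 𝔷) × EuclideanSpace ℂ (Fin n) =>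
      (Real.exp (-‖p.2‖ ^ 2) : ℂ) := by fun_prop
    exact (h1.mul h2).mul h3
  have hnorm : ∀ F : Fock n, ∫ ζ, ‖F ζ‖ ^ 2 * Real.exp (-‖ζ‖ ^ 2) = Real.pi ^ n * ‖F‖ ^ 2 := by
    intro F
    rw [fock_norm_sq, ← mul_assoc, mul_inv_cancel₀ (by positivity), one_mul]
  -- The bound |ψ||P g| ≤ |ψ|² + |P g|², with ‖P g‖ = ‖φ‖, justifies exchanging the integrals over G
  -- and over ℂⁿ.
  have hDi : Integrable (Function.uncurry D) ((volume : Measure (𝔳 × 𝔷)).prod volume) := by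
    rw [integrable_prod_iff hDm]
    refine ⟨Filter.Eventually.of_forall fun g => (Fock.integrable_mul ψ (P g)).const_mul (f g), ?_⟩
    refine (hf.norm.mul_const (Real.pi ^ n * ‖ψ‖ ^ 2 + Real.pi ^ n * ‖φ‖ ^ 2)).mono'
      hDm.norm.integral_prod_right' (Filter.Eventually.of_forall fun g => ?_)
    rw [Real.norm_of_nonneg (integral_nonneg fun ζ => norm_nonneg _)]
    simp only [Function.uncurry, hD, norm_mul (f g)]
    rw [integral_const_mul, ← hPn g, ← hnorm, ← hnorm,
      ← integral_add (Fock.integrable ψ) (Fock.integrable (P g))]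
    refine mul_le_mul_of_nonneg_left (integral_mono (Fock.integrable_mul ψ (P g)).norm
      ((Fock.integrable ψ).add (Fock.integrable (P g))) fun ζ => ?_) (norm_nonneg _)
    simp only [norm_mul, RCLike.norm_conj, Complex.norm_real, Real.norm_eq_abs, Real.abs_exp]
    have hexp := Real.exp_pos (-‖ζ‖ ^ 2)
    have h : ‖ψ ζ‖ * ‖P g ζ‖ ≤ ‖ψ ζ‖ ^ 2 + ‖P g ζ‖ ^ 2 := by
      nlinarith [sq_nonneg (‖ψ ζ‖ - ‖P g ζ‖), sq_nonneg (‖ψ ζ‖ + ‖P g ζ‖)]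
    nlinarith
  have hform : ∀ g : 𝔳 × 𝔷, f g * inner ℂ ψ (P g)
      = ((Real.pi ^ n)⁻¹ : ℝ) * ∫ ζ, D g ζ := by
    intro g
    rw [fock_inner_def, mul_left_comm, ← integral_const_mul]
  have hint : Integrable fun g : 𝔳 × 𝔷 =>
      f g * inner ℂ ψ (P g) := by
    simp_rw [hform]
    exact hDi.integral_prod_left.const_mul _
  refine ⟨hint, ?_⟩
  have hzero : ∫ g : 𝔳 × 𝔷, f g * inner ℂ ψ (P g) = 0 := by
    simp_rw [hform]
    rw [integral_const_mul, integral_integral_swap hDi]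
    have : ∀ ζ, ∫ g, D g ζ = 0 := by
      intro ζ
      have e : ∀ g, D g ζ = (starRingEnd ℂ (ψ ζ) * (Real.exp (-‖ζ‖ ^ 2) : ℂ)) *
          (f g * N.orbit hμ φ g ζ) := fun g => by simp only [hD, hPo]; ring
      simp_rw [e]
      rw [integral_const_mul]
      have := h0 φ ζ
      rw [NormalForm.fourierApply] at this
      rw [this, mul_zero]
    simp [this]
  rw [zero_apply, inner_zero_right]
  exact hzero.symm

/-- Vanishing of the integrals of `f` over the translates of a centrally periodic curve, in terms
of the Fourier transform at a frequency which is trivial on the period. -/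
theorem NormalForm.integral_fourierApply_eq_zero (N : A.NormalForm μ n) (hμ : μ ≠ 0)
    {f : 𝔳 × 𝔷 → ℂ} (hf : Integrable f) {c : ℝ → 𝔳 × 𝔷} (hc : Continuous c) {T : ℝ} (hT : 0 < T)
    {κ : 𝔷} (hκ0 : κ ≠ 0) (hcT : ∀ s, c (s + T) = c s + (0, κ)) {k : ℤ}
    (hκ : inner ℝ μ κ = 2 * Real.pi * k)
    (hray : ∀ᵐ g : 𝔳 × 𝔷, ∫ s : ℝ, f (twistedMul A.bracket g (c s)) = 0) (φ : Fock n)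
    (ζ : EuclideanSpace ℂ (Fin n)) :
    ∫ s in (0 : ℝ)..T, Complex.exp (Complex.I * (inner ℝ μ (c s).2 : ℝ)
          - (√(‖μ‖ / 2) : ℝ) * inner ℂ (N.R.symm (c s).1) ζ - (‖μ‖ / 4) * ‖N.R.symm (c s).1‖ ^ 2)
        * N.fourierApply hμ f φ (ζ + (√(‖μ‖ / 2) : ℂ) • N.R.symm (c s).1) = 0 := by
  obtain ⟨C, hC0, hC⟩ := N.exists_norm_orbit_le hμ φ
  have hκn : ‖κ‖ ^ 2 ≠ 0 := pow_ne_zero _ (norm_ne_zero_iff.mpr hκ0)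
  -- The strip is measured by the functional ⟨κ, ·⟩/|κ|², which equals 1 on κ.
  have h1 := integral_mul_period_mean_eq_zero A.bracket A.bracket_self hf hc hT hcT
    ((‖κ‖ ^ 2)⁻¹ • innerSL ℝ κ) (by
      rw [smul_apply, innerSL_apply_apply, real_inner_self_eq_norm_sq,
        smul_eq_mul, inv_mul_cancel₀ hκn]) hray (Φ := fun g => N.orbit hμ φ g ζ)
    (N.continuous_orbit hμ φ continuous_id continuous_const)
    (fun g => hC g ζ) (fun x u => N.orbit_add_centre hμ φ hκ x u ζ)
  simp_rw [N.orbit_twistedMul_neg, ← intervalIntegral.integral_const_mul] at h1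
  have hR : Continuous fun s => N.R.symm (c s).1 := N.R.symm.continuous.comp (by fun_prop)
  set w : ℝ → ℂ := fun s => Complex.exp (Complex.I * (inner ℝ μ (c s).2 : ℝ)
    - (√(‖μ‖ / 2) : ℝ) * inner ℂ (N.R.symm (c s).1) ζ - (‖μ‖ / 4) * ‖N.R.symm (c s).1‖ ^ 2) with hw
  set q : ℝ → EuclideanSpace ℂ (Fin n) := fun s => ζ + (√(‖μ‖ / 2) : ℂ) • N.R.symm (c s).1 with hq
  have hwc : Continuous w := by
    simp only [hw]
    fun_prop
  have hqc : Continuous q := by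
    simp only [hq]
    fun_prop
  obtain ⟨M, hM⟩ := (isCompact_Icc (a := (0 : ℝ)) (b := T)).exists_bound_of_continuousOn
    (f := fun s => ‖w s‖ * (C * Real.exp (‖q s‖ ^ 2 / 2))) (by fun_prop)
  have hbd : ∀ g, ∀ s ∈ Set.Icc (0 : ℝ) T, ‖w s * N.orbit hμ φ g (q s)‖ ≤ M := by
    intro g s hs
    rw [norm_mul]
    exact (mul_le_mul_of_nonneg_left (hC g (q s)) (norm_nonneg _)).trans
      ((Real.le_norm_self _).trans (hM s hs))
  rw [← intervalIntegral_integral_swap] at h1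
  · rw [← h1]
    refine intervalIntegral.integral_congr fun s _ => ?_
    simp only [NormalForm.fourierApply]
    rw [← integral_const_mul]
    refine integral_congr_ae (Filter.Eventually.of_forall fun g => ?_)
    simp only
    ring
  · rw [Set.uIoc_of_le hT.le]
    have hm : Continuous fun p : ℝ × (𝔳 × 𝔷) => w p.1 * N.orbit hμ φ p.2 (q p.1) :=
      (hwc.comp continuous_fst).mul (N.continuous_orbit hμ φ continuous_snd (hqc.comp continuous_fst))
    have hdom : Integrable (fun p : ℝ × (𝔳 × 𝔷) => M * ‖f p.2‖)
        ((volume.restrict (Set.Ioc 0 T)).prod volume) := by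
      have := (integrable_const (μ := volume.restrict (Set.Ioc (0 : ℝ) T)) M).mul_prod hf.norm
      exact this
    refine hdom.mono' (hf.aestronglyMeasurable.comp_snd.mul hm.aestronglyMeasurable) ?_
    have hae : ∀ᵐ p ∂((volume.restrict (Set.Ioc 0 T)).prod (volume : Measure (𝔳 × 𝔷))),
        p.1 ∈ Set.Ioc (0 : ℝ) T :=
      Measure.quasiMeasurePreserving_fst.ae (ae_restrict_mem measurableSet_Ioc)
    filter_upwards [hae] with p hp
    simp only [Function.uncurry, norm_mul (f p.2)]
    rw [mul_comm]
    exact mul_le_mul_of_nonneg_right (hbd p.2 p.1 (Set.Ioc_subset_Icc_self hp)) (norm_nonneg _)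

end HTypeAlgebra

/-! ### Circles in complex lines and in transverse planes -/

section ChargedMeans

variable {E : Type*} [NormedAddCommGroup E] [InnerProductSpace ℂ E]

/-- Points of the unit circle through `e` in the plane spanned by `e` and `e'`. -/
def planarCircle (e e' : E) (θ : ℝ) : E :=
  (Real.sin θ : ℂ) • e - (Real.cos θ : ℂ) • e'

/-- Means over circles in complex lines, in either orientation, have a standard form. -/
theorem circle_means_of_aligned {F : E → ℂ} {α a : ℝ} (ha : a = 1 ∨ a = -1) {k : ℤ}
    (hk : (k : ℝ) = a * α ^ 2)
    (h : ∀ e : E, ‖e‖ = 1 → ∀ ζ, ∫ θ in (0 : ℝ)..(2 * Real.pi), Complex.exp (Complex.I * k * θ) *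
      Complex.exp (-(α * inner ℂ (planarCircle e ((a * Complex.I) • e) θ) ζ)) *
        F (ζ + (α : ℂ) • planarCircle e ((a * Complex.I) • e) θ) = 0)
    (e : E) (he : ‖e‖ = 1) (ζ : E) :
    ∫ θ in (0 : ℝ)..(2 * Real.pi), Complex.exp (Complex.I * k.natAbs * θ) *
      Complex.exp (-(α * inner ℂ (Complex.exp (Complex.I * θ) • e) ζ)) *
        F (ζ + (α * Complex.exp (Complex.I * θ)) • e) = 0 := by
  have hexp : ∀ θ : ℝ, Complex.exp (Complex.I * θ) = Real.cos θ + Real.sin θ * Complex.I := by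
    intro θ
    rw [mul_comm, Complex.exp_mul_I]
    push_cast; rfl
  have hexpn : ∀ θ : ℝ, Complex.exp (-(Complex.I * θ)) = Real.cos θ - Real.sin θ * Complex.I := by
    intro θ
    have := hexp (-θ)
    simp only [Real.cos_neg, Real.sin_neg, Complex.ofReal_neg] at this
    rw [← mul_neg, this]
    ring
  rcases ha with rfl | rfl
  · have hk0 : 0 ≤ k := by
      have : (0 : ℝ) ≤ k := by rw [hk]; positivity
      exact_mod_cast this
    have hkn : ((k.natAbs : ℕ) : ℂ) = k := by
      have : ((k.natAbs : ℕ) : ℤ) = k := Int.natAbs_of_nonneg hk0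
      rw [← Int.cast_natCast, this]
    -- For a = 1 the circle based at ie is e^{iθ}e.
    have h1 := h (Complex.I • e) (by rw [norm_smul, Complex.norm_I, he, one_mul]) ζ
    rw [← h1, hkn]
    refine intervalIntegral.integral_congr fun θ _ => ?_
    have hx : planarCircle (Complex.I • e) ((((1 : ℝ) : ℂ) * Complex.I) • Complex.I • e) θ
        = Complex.exp (Complex.I * θ) • e := by
      rw [planarCircle, hexp, smul_smul, smul_smul, smul_smul, ← sub_smul]
      congr 1
      rw [Complex.ofReal_one]
      linear_combination (-(Real.cos θ : ℂ)) * Complex.I_sq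
    simp only [hx]
    rw [smul_smul]
  · have hk0 : k ≤ 0 := by
      have : (k : ℝ) ≤ 0 := by rw [hk]; nlinarith [sq_nonneg α]
      exact_mod_cast this
    have hkn : ((k.natAbs : ℕ) : ℂ) = -k := by
      have : ((k.natAbs : ℕ) : ℤ) = -k := Int.ofNat_natAbs_of_nonpos hk0
      rw [← Int.cast_natCast, this, Int.cast_neg]
    -- For a = -1 the circle based at -ie is e^{-iθ}e. Since k ≤ 0 here, reversing the angle
    -- restores both the orientation and the charge |k|.
    have h1 := h (-(Complex.I • e))
      (by rw [norm_neg, norm_smul, Complex.norm_I, he, one_mul]) ζ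
    rw [← h1, ← integral_neg_angle]
    · refine intervalIntegral.integral_congr fun θ _ => ?_
      have hx : planarCircle (-(Complex.I • e))
          ((((-1 : ℝ) : ℂ) * Complex.I) • (-(Complex.I • e))) θ
          = Complex.exp (-(Complex.I * θ)) • e := by
        rw [planarCircle, hexpn, ← neg_smul, smul_smul, smul_smul, smul_smul, ← sub_smul]
        congr 1
        push_cast
        linear_combination (-(Complex.cos θ : ℂ)) * Complex.I_sq
      simp only [hx]
      simp only [smul_smul, hkn, Complex.ofReal_neg, mul_neg, neg_mul, neg_neg]
    · intro θ
      have e1 := exp_I_periodic (k.natAbs : ℤ) θ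
      simp only [Int.cast_natCast] at e1
      simp only [e1, exp_I_periodic_one]

/-- Uniqueness for means over circles in planes that are not complex lines. -/
theorem eq_zero_of_transverse_means [Nontrivial E] {F : E → ℂ} (hFc : Continuous F)
    (hFd : ∀ a b : E, Differentiable ℂ fun t : ℂ => F (a + t • b)) {α a b : ℝ} (hα : 0 < α)
    (hb : 0 < b) (hab : a ^ 2 + b ^ 2 = 1) (k : ℤ) {κ : E → E}
    (hadd : ∀ v w, κ (v + w) = κ v + κ w)
    (hsmul : ∀ (c : ℂ) v, κ (c • v) = starRingEnd ℂ c • κ v)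
    (hsq : ∀ v, κ (κ v) = -((b : ℂ) ^ 2) • v) (hnorm : ∀ v, ‖κ v‖ = b * ‖v‖)
    (hinner : ∀ v, inner ℂ v (κ v) = 0)
    (h : ∀ e : E, ‖e‖ = 1 → ∀ ζ, ∫ θ in (0 : ℝ)..(2 * Real.pi), Complex.exp (Complex.I * k * θ) *
      Complex.exp (-(α * inner ℂ (planarCircle e ((a * Complex.I) • e + κ e) θ) ζ)) *
        F (ζ + (α : ℂ) • planarCircle e ((a * Complex.I) • e + κ e) θ) = 0)
    (ζ : E) : F ζ = 0 := by
  have ha : -1 < a := by nlinarith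
  -- For J = ai + κ, the e^{iθ} part of sin θ · e - cos θ · Je is -½((1+a)i + κ)e, of norm ρ; the
  -- e^{-iθ} part has norm b/(2ρ). Both are positive because b > 0.
  set ρ : ℝ := √((1 + a) / 2) with hρdef
  have hρ : 0 < ρ := Real.sqrt_pos.mpr (by linarith)
  have hρ2 : 2 * ρ ^ 2 = 1 + a := by
    rw [hρdef, Real.sq_sqrt (by linarith)]; ring
  have hρc : (ρ : ℂ) ≠ 0 := by exact_mod_cast hρ.ne'
  have hbc : (b : ℂ) ≠ 0 := by exact_mod_cast hb.ne'
  have habc : (a : ℂ) ^ 2 + (b : ℂ) ^ 2 = 1 := by exact_mod_cast congrArg Complex.ofReal hab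
  have hρ2c : 2 * (ρ : ℂ) ^ 2 = 1 + a := by exact_mod_cast congrArg Complex.ofReal hρ2
  set τ : E → E := fun v => ((b : ℂ)⁻¹ * Complex.I) • κ v with hτdef
  have hτ : IsQuaternionic τ := by
    refine ⟨fun v w => ?_, fun c v => ?_, fun v => ?_, fun v => ?_, fun v => ?_⟩
    · simp only [hτdef, hadd, smul_add]
    · simp only [hτdef, hsmul, smul_smul]
      congr 1; ring
    · simp only [hτdef, hsmul, hsq, smul_smul, map_mul, map_inv₀, Complex.conj_ofReal,
        Complex.conj_I]
      rw [← neg_one_smul ℂ v]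
      congr 1
      field_simp
      linear_combination Complex.I_sq
    · simp only [hτdef, norm_smul, hnorm, norm_mul, norm_inv, Complex.norm_real, Complex.norm_I,
        Real.norm_of_nonneg hb.le]
      field_simp
    · simp only [hτdef, inner_smul_right, hinner, mul_zero]
  refine eq_zero_of_quaternionic_means hFc hFd hτ k (β := α * ρ) (γ := α * (b / (2 * ρ)))
    (by positivity) (by positivity) (fun e' he' ζ => ?_) ζ
  -- This inverts ρe' = -½((1+a)i + κ)e, using ((1+a)i + κ)² = -2(1+a) and 1 + a = 2ρ². Thus e' may
  -- be an arbitrary unit vector.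
  set e : E := ((2 * ρ : ℂ)⁻¹) • (((1 + a) * Complex.I : ℂ) • e' + κ e') with hedef
  have hinner' : inner ℂ (κ e') e' = 0 := by rw [← inner_conj_symm, hinner, map_zero]
  have hκκ : inner ℂ (κ e') (κ e') = (b : ℂ) ^ 2 := by
    rw [inner_self_eq_norm_sq_to_K, hnorm, he', mul_one]; rfl
  have hee' : inner ℂ e' e' = (1 : ℂ) := by rw [inner_self_eq_norm_sq_to_K, he']; simp
  have he : ‖e‖ = 1 := by
    have h1 : inner ℂ e e = (1 : ℂ) := by
      rw [hedef, inner_smul_left, inner_smul_right, inner_add_left, inner_add_right,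
        inner_add_right, inner_smul_left, inner_smul_right, inner_smul_left, inner_smul_right,
        hinner, hinner', hκκ, hee']
      simp only [map_inv₀, map_mul, map_add, map_one, Complex.conj_ofReal, Complex.conj_I,
        Complex.conj_ofNat]
      field_simp
      linear_combination (-(1 + a : ℂ) ^ 2) * Complex.I_sq + habc - 2 * hρ2c
    rw [inner_self_eq_norm_sq_to_K] at h1
    change ((‖e‖ : ℝ) : ℂ) ^ 2 = 1 at h1
    have : ‖e‖ ^ 2 = 1 := by exact_mod_cast h1
    nlinarith [norm_nonneg e]
  have hx : ∀ θ : ℝ, planarCircle e ((a * Complex.I) • e + κ e) θ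
      = (ρ * Complex.exp (Complex.I * θ)) • e'
        + (b / (2 * ρ) * Complex.exp (-(Complex.I * θ))) • τ e' := by
    intro θ
    have hexp : Complex.exp (Complex.I * θ) = Real.cos θ + Real.sin θ * Complex.I := by
      rw [mul_comm, Complex.exp_mul_I]
      push_cast; rfl
    have hexpn : Complex.exp (-(Complex.I * θ)) = Real.cos θ - Real.sin θ * Complex.I := by
      rw [show -(Complex.I * (θ : ℂ)) = (-θ : ℂ) * Complex.I by ring, Complex.exp_mul_I,
        Complex.cos_neg, Complex.sin_neg]
      push_cast; ring
    have hκe : κ e = ((2 * ρ : ℂ)⁻¹) • ((-((1 + a) * Complex.I) : ℂ) • κ e'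
        + (-((b : ℂ) ^ 2)) • e') := by
      rw [hedef, hsmul, hadd, hsmul, hsq]
      simp only [map_inv₀, map_mul, map_add, map_one, Complex.conj_ofReal, Complex.conj_I,
        Complex.conj_ofNat, mul_neg]
    rw [planarCircle, hκe, hedef, hexp, hexpn]
    simp only [hτdef]
    generalize (Real.cos θ : ℂ) = C
    generalize (Real.sin θ : ℂ) = S
    have hc1 : (ρ : ℂ) * (C + S * Complex.I)
        = (2 * ρ : ℂ)⁻¹ * (S * ((1 + a) * Complex.I) - C * (a * Complex.I * ((1 + a) * Complex.I)
          - (b : ℂ) ^ 2)) := by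
      field_simp
      linear_combination (C + S * Complex.I) * hρ2c - C * habc + C * (a + a ^ 2) * Complex.I_sq
    have hc2 : (b : ℂ) / (2 * ρ) * (C - S * Complex.I) * ((b : ℂ)⁻¹ * Complex.I)
        = (2 * ρ : ℂ)⁻¹ * (S - C * (a * Complex.I - (1 + a) * Complex.I)) := by
      field_simp
      linear_combination (-S) * Complex.I_sq
    rw [hc1, smul_smul _ _ (κ e'), hc2]
    module
  have h1 := h e he ζ
  rw [← h1]
  refine intervalIntegral.integral_congr fun θ _ => ?_
  have hin : inner ℂ (planarCircle e ((a * Complex.I) • e + κ e) θ) ζ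
      = ρ * Complex.exp (-(Complex.I * θ)) * inner ℂ e' ζ
        + b / (2 * ρ) * Complex.exp (Complex.I * θ) * inner ℂ (τ e') ζ := by
    rw [hx, inner_add_left, inner_smul_left, inner_smul_left]
    simp only [map_mul, map_div₀, Complex.conj_ofReal, Complex.conj_ofNat, conj_exp_I_mul]
    rw [← conj_exp_I_mul, Complex.conj_conj]
  have hpt : ζ + (α : ℂ) • planarCircle e ((a * Complex.I) • e + κ e) θ
      = ζ + (((α * ρ : ℝ) : ℂ) * Complex.exp (Complex.I * θ)) • e'
        + (((α * (b / (2 * ρ)) : ℝ) : ℂ) * Complex.exp (-(Complex.I * θ))) • τ e' := by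
    rw [hx]
    generalize τ e' = t
    push_cast
    module
  simp only [hin, hpt]
  congr 3
  push_cast
  ring

end ChargedMeans

/-! ### The operators J, explicit geodesics and normal form coordinates -/

/-- The exponential of an operator `j` with `j² = -1`. -/
theorem exp_smul_of_mul_self_eq_neg_one {V : Type*} [NormedAddCommGroup V] [NormedSpace ℝ V]
    [CompleteSpace V] {j : V →L[ℝ] V} (hj : j * j = -1) (θ : ℝ) :
    NormedSpace.exp (θ • j) = Real.cos θ • (1 : V →L[ℝ] V) + Real.sin θ • j := by
  let φ : ℂ →ₐ[ℝ] (V →L[ℝ] V) := Complex.liftAux j hj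
  have hφ : ∀ z : ℂ, φ z = z.re • (1 : V →L[ℝ] V) + z.im • j := by
    intro z
    change Complex.liftAux j hj z = _
    rw [Complex.liftAux_apply, Algebra.algebraMap_eq_smul_one]
  have hc : Continuous φ := by
    have : (φ : ℂ → V →L[ℝ] V) = fun z => z.re • (1 : V →L[ℝ] V) + z.im • j := funext hφ
    rw [this]
    fun_prop
  let _ : Algebra ℚ (V →L[ℝ] V) := Algebra.compHom _ (algebraMap ℚ ℝ)
  have h1 := NormedSpace.map_exp φ hc (θ * Complex.I)
  have h2 : φ (θ * Complex.I) = θ • j := by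
    rw [hφ]; simp
  rw [h2, ← Complex.exp_eq_exp_ℂ, hφ] at h1
  rw [← h1, Complex.exp_ofReal_mul_I_re, Complex.exp_ofReal_mul_I_im]

namespace HTypeAlgebra

variable {𝔳 𝔷 : Type*} [NormedAddCommGroup 𝔳] [InnerProductSpace ℝ 𝔳]
  [FiniteDimensional ℝ 𝔳] [NormedAddCommGroup 𝔷] [InnerProductSpace ℝ 𝔷]

section Operators

variable (A : HTypeAlgebra 𝔳 𝔷)

theorem J_add (μ κ : 𝔷) (x : 𝔳) : A.J (μ + κ) x = A.J μ x + A.J κ x := by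
  refine ext_inner_right ℝ fun w => ?_
  rw [inner_add_left, inner_J, inner_J, inner_J, inner_add_left]

theorem J_smul (c : ℝ) (μ : 𝔷) (x : 𝔳) : A.J (c • μ) x = c • A.J μ x := by
  refine ext_inner_right ℝ fun w => ?_
  rw [real_inner_smul_left, inner_J, inner_J, real_inner_smul_left]

theorem J_J (μ : 𝔷) (x : 𝔳) : A.J μ (A.J μ x) = -(‖μ‖ ^ 2) • x :=
  A.J_sq μ x

theorem norm_J (μ : 𝔷) (x : 𝔳) : ‖A.J μ x‖ = ‖μ‖ * ‖x‖ := by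
  refine (sq_eq_sq₀ (norm_nonneg _) (by positivity)).mp ?_
  rw [← real_inner_self_eq_norm_sq, inner_J_left, J_J, real_inner_smul_right,
    real_inner_self_eq_norm_sq]
  ring

theorem inner_self_J (μ : 𝔷) (x : 𝔳) : inner ℝ x (A.J μ x) = 0 := by
  have := A.inner_J_left μ x x
  rw [real_inner_comm] at this
  linarith

/-- Polarization of J_μ² = -|μ|²: the cross terms of J_{μ+κ}² cancel when μ ⊥ κ. -/
theorem J_anticomm {μ κ : 𝔷} (h : inner ℝ μ κ = 0) (x : 𝔳) :
    A.J κ (A.J μ x) = -A.J μ (A.J κ x) := by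
  have h1 := A.J_J (μ + κ) x
  rw [J_add, J_add, map_add, map_add, J_J, J_J, norm_add_sq_real, h] at h1
  have h2 : A.J κ (A.J μ x) + A.J μ (A.J κ x) = 0 := by
    have h3 : A.J κ (A.J μ x) + A.J μ (A.J κ x)
        = (-(‖μ‖ ^ 2) • x + A.J μ (A.J κ x) + (A.J κ (A.J μ x) + -(‖κ‖ ^ 2) • x))
          + (‖μ‖ ^ 2 + ‖κ‖ ^ 2) • x := by module
    rw [h3, h1]
    module
  exact eq_neg_of_add_eq_zero_left h2

theorem inner_J_J {μ κ : 𝔷} (h : inner ℝ μ κ = 0) (x : 𝔳) :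
    inner ℝ (A.J μ x) (A.J κ x) = 0 := by
  have h1 := A.inner_J_left μ x (A.J κ x)
  have h2 := A.inner_J_left κ x (A.J μ x)
  rw [A.J_anticomm h, inner_neg_right, real_inner_comm] at h2
  linarith

/-- Geodesics in terms of the complex structure `J_{λ/|λ|}`. -/
theorem geodesic_eq {lam : 𝔷} (hlam : lam ≠ 0) (ν : 𝔳) (s : ℝ) :
    A.geodesic ν lam s = HTypeGroup.mk A
      (‖lam‖⁻¹ • (Real.sin (s * ‖lam‖) • ν - Real.cos (s * ‖lam‖) • A.J (‖lam‖⁻¹ • lam) ν))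
      ((s * ‖ν‖ ^ 2 / (2 * ‖lam‖ ^ 2)) • lam) := by
  have hl : ‖lam‖ ≠ 0 := norm_ne_zero_iff.mpr hlam
  have : CompleteSpace 𝔳 := FiniteDimensional.complete ℝ 𝔳
  set j := A.J (‖lam‖⁻¹ • lam) with hjdef
  have hjn : ‖‖lam‖⁻¹ • lam‖ = 1 := by
    rw [norm_smul, norm_inv, norm_norm, inv_mul_cancel₀ hl]
  have hjj : ∀ x, j (j x) = -x := by
    intro x
    rw [hjdef, J_J, hjn]
    simp
  have hj : j * j = -1 := by
    ext x
    exact hjj x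
  have hJ : A.J lam = ‖lam‖ • j := by
    ext x
    change A.J lam x = ‖lam‖ • j x
    rw [hjdef, J_smul, smul_smul, mul_inv_cancel₀ hl, one_smul]
  have hinv : Ring.inverse (A.J lam) = -(‖lam‖⁻¹ • j) := by
    let u : (𝔳 →L[ℝ] 𝔳)ˣ :=
      { val := A.J lam
        inv := -(‖lam‖⁻¹ • j)
        val_inv := by
          rw [hJ, mul_neg, smul_mul_smul_comm, mul_inv_cancel₀ hl, hj, one_smul, neg_neg]
        inv_val := by
          rw [hJ, neg_mul, smul_mul_smul_comm, inv_mul_cancel₀ hl, hj, one_smul, neg_neg] }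
    exact Ring.inverse_unit u
  rw [geodesic, hinv, hJ, smul_smul, exp_smul_of_mul_self_eq_neg_one hj]
  congr 1
  change -(‖lam‖⁻¹ • j (Real.cos (s * ‖lam‖) • ν + Real.sin (s * ‖lam‖) • j ν)) = _
  rw [map_add, map_smul, map_smul, hjj]
  module

end Operators

variable {A : HTypeAlgebra 𝔳 𝔷} {μ : 𝔷} {n : ℕ}

theorem re_inner_euclideanSpace (a b : EuclideanSpace ℂ (Fin n)) :
    inner ℝ a b = (inner ℂ a b).re := by
  simp [PiLp.inner_apply, Complex.inner]

/-- The operator `J_κ` in the coordinates of a normal form. -/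
def NormalForm.conjJ (N : A.NormalForm μ n) (κ : 𝔷) (e : EuclideanSpace ℂ (Fin n)) :
    EuclideanSpace ℂ (Fin n) :=
  N.R.symm (A.J κ (N.R e))

theorem NormalForm.R_conjJ (N : A.NormalForm μ n) (κ : 𝔷) (e : EuclideanSpace ℂ (Fin n)) :
    N.R (N.conjJ κ e) = A.J κ (N.R e) :=
  N.R.apply_symm_apply _

theorem NormalForm.conjJ_self (N : A.NormalForm μ n) (e : EuclideanSpace ℂ (Fin n)) :
    N.conjJ μ e = ((‖μ‖ : ℂ) * Complex.I) • e := by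
  rw [conjJ, N.J_eq, map_smul, N.R.symm_apply_apply, ← Complex.coe_smul, smul_smul]

theorem NormalForm.conjJ_add (N : A.NormalForm μ n) (κ : 𝔷) (v w : EuclideanSpace ℂ (Fin n)) :
    N.conjJ κ (v + w) = N.conjJ κ v + N.conjJ κ w := by
  simp only [conjJ, map_add]

theorem NormalForm.conjJ_real_smul (N : A.NormalForm μ n) (κ : 𝔷) (c : ℝ)
    (v : EuclideanSpace ℂ (Fin n)) : N.conjJ κ ((c : ℂ) • v) = (c : ℂ) • N.conjJ κ v := by
  simp only [conjJ, Complex.coe_smul, map_smul]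

theorem NormalForm.conjJ_conjJ (N : A.NormalForm μ n) (κ : 𝔷) (v : EuclideanSpace ℂ (Fin n)) :
    N.conjJ κ (N.conjJ κ v) = -((‖κ‖ : ℂ) ^ 2) • v := by
  rw [conjJ, N.R_conjJ, A.J_J, map_smul, N.R.symm_apply_apply, ← Complex.coe_smul]
  push_cast
  rfl

theorem NormalForm.norm_conjJ (N : A.NormalForm μ n) (κ : 𝔷) (v : EuclideanSpace ℂ (Fin n)) :
    ‖N.conjJ κ v‖ = ‖κ‖ * ‖v‖ := by
  rw [conjJ, N.R.symm.norm_map, A.norm_J, N.R.norm_map]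

theorem NormalForm.conjJ_add_left (N : A.NormalForm μ n) (κ κ' : 𝔷)
    (v : EuclideanSpace ℂ (Fin n)) : N.conjJ (κ + κ') v = N.conjJ κ v + N.conjJ κ' v := by
  rw [conjJ, A.J_add, map_add, conjJ, conjJ]

theorem NormalForm.conjJ_smul_left (N : A.NormalForm μ n) (c : ℝ) (κ : 𝔷)
    (v : EuclideanSpace ℂ (Fin n)) : N.conjJ (c • κ) v = (c : ℂ) • N.conjJ κ v := by
  rw [conjJ, A.J_smul, map_smul, Complex.coe_smul, conjJ]

/-- In these coordinates J_μ is |μ| times multiplication by i, so anticommuting with it means being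
antilinear. -/
theorem NormalForm.conjJ_smul (N : A.NormalForm μ n) (hμ : μ ≠ 0) {κ : 𝔷} (h : inner ℝ μ κ = 0)
    (c : ℂ) (v : EuclideanSpace ℂ (Fin n)) :
    N.conjJ κ (c • v) = starRingEnd ℂ c • N.conjJ κ v := by
  have hn : ‖μ‖ ≠ 0 := norm_ne_zero_iff.mpr hμ
  have hI : N.conjJ κ (Complex.I • v) = (-Complex.I) • N.conjJ κ v := by
    have h1 : N.R (Complex.I • v) = ‖μ‖⁻¹ • A.J μ (N.R v) := by
      rw [N.J_eq, smul_smul, inv_mul_cancel₀ hn, one_smul]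
    rw [conjJ, h1, map_smul, A.J_anticomm h, ← N.R_conjJ, N.J_eq, ← smul_neg, smul_smul,
      inv_mul_cancel₀ hn, one_smul, map_neg, N.R.symm_apply_apply, neg_smul]
  have hc : c • v = (c.re : ℂ) • v + (c.im : ℂ) • Complex.I • v := by
    rw [smul_smul, ← add_smul, Complex.re_add_im]
  rw [hc, N.conjJ_add, N.conjJ_real_smul, N.conjJ_real_smul, hI, smul_smul, ← add_smul]
  congr 1
  apply Complex.ext <;> simp

/-- The real part vanishes because J_κ is skew, the imaginary part because J_μv ⊥ J_κv. -/
theorem NormalForm.inner_conjJ (N : A.NormalForm μ n) (hμ : μ ≠ 0) {κ : 𝔷} (h : inner ℝ μ κ = 0)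
    (v : EuclideanSpace ℂ (Fin n)) : inner ℂ v (N.conjJ κ v) = 0 := by
  have hn : ‖μ‖ ≠ 0 := norm_ne_zero_iff.mpr hμ
  refine Complex.ext ?_ ?_
  · rw [← re_inner_euclideanSpace, ← N.R.inner_map_map, N.R_conjJ, A.inner_self_J, Complex.zero_re]
  · have h1 : (inner ℂ v (N.conjJ κ v)).im = inner ℝ (Complex.I • v) (N.conjJ κ v) := by
      rw [re_inner_euclideanSpace, inner_smul_left]
      simp
    have h2 := A.inner_J_J h (N.R v)
    rw [N.J_eq, real_inner_smul_left, ← N.R_conjJ, N.R.inner_map_map] at h2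
    rw [h1, Complex.zero_im]
    exact (mul_eq_zero.mp h2).resolve_left hn

theorem NormalForm.nontrivial [Nontrivial 𝔳] (N : A.NormalForm μ n) :
    Nontrivial (EuclideanSpace ℂ (Fin n)) :=
  N.R.toEquiv.nontrivial

theorem NormalForm.finrank_eq (N : A.NormalForm μ n) : Module.finrank ℝ 𝔳 = 2 * n := by
  rw [← N.R.toLinearEquiv.finrank_eq, ← Module.finrank_mul_finrank ℝ ℂ, Complex.finrank_real_complex,
    finrank_euclideanSpace_fin]

/-- If `𝔳` has complex dimension one then the centre is spanned by any of its nonzero elements. -/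
theorem NormalForm.finrank_centre_of_one [Nontrivial 𝔳] (N : A.NormalForm μ 1) (hμ : μ ≠ 0) :
    Module.finrank ℝ 𝔷 = 1 := by
  have hn : ‖μ‖ ≠ 0 := norm_ne_zero_iff.mpr hμ
  have := N.nontrivial
  -- On a one-dimensional space J_κe is a complex multiple of e, yet it is Hermitian-orthogonal to
  -- e, so J_κe = 0. Since |J_κe| = |κ|, this gives κ = 0.
  have hzero : ∀ κ : 𝔷, inner ℝ μ κ = 0 → κ = 0 := by
    intro κ hκ
    obtain ⟨e, he⟩ := exists_norm_eq (EuclideanSpace ℂ (Fin 1)) zero_le_one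
    have he0 : e ≠ 0 := by
      rintro rfl
      simp at he
    obtain ⟨c, hc⟩ := (finrank_eq_one_iff_of_nonzero' e he0).mp
      (finrank_euclideanSpace_fin (𝕜 := ℂ) (n := 1)) (N.conjJ κ e)
    have h1 := N.inner_conjJ hμ hκ e
    rw [← hc, inner_smul_right, inner_self_eq_norm_sq_to_K, he] at h1
    have h2 : c = 0 := by simpa using h1
    have h3 := N.norm_conjJ κ e
    rw [← hc, h2, zero_smul, norm_zero, he, mul_one] at h3
    exact norm_eq_zero.mp h3.symm
  refine (finrank_eq_one_iff_of_nonzero' μ hμ).mpr fun κ => ⟨inner ℝ μ κ / ‖μ‖ ^ 2, ?_⟩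
  refine (sub_eq_zero.mp (hzero (κ - (inner ℝ μ κ / ‖μ‖ ^ 2) • μ) ?_)).symm
  rw [inner_sub_right, real_inner_smul_right, real_inner_self_eq_norm_sq]
  field_simp
  ring

end HTypeAlgebra

/-! ### From the X-ray transform to the vanishing of the Fourier transform -/

namespace HTypeAlgebra

variable {𝔳 𝔷 : Type*} [NormedAddCommGroup 𝔳] [InnerProductSpace ℝ 𝔳] [FiniteDimensional ℝ 𝔳]
  [MeasurableSpace 𝔳] [BorelSpace 𝔳] [NormedAddCommGroup 𝔷] [InnerProductSpace ℝ 𝔷]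
  [FiniteDimensional ℝ 𝔷] [MeasurableSpace 𝔷] [BorelSpace 𝔷]
  {A : HTypeAlgebra 𝔳 𝔷} {μ : 𝔷} {n : ℕ}

/-- Vanishing of the X-ray transform, expressed through the Fourier transform. -/
theorem NormalForm.integral_planarCircle_eq_zero (N : A.NormalForm μ n) (hμ : μ ≠ 0)
    {f : HTypeGroup A → ℂ} (hf : Integrable f) {lam : 𝔷} (hlam : lam ≠ 0) {k : ℤ}
    (hk : inner ℝ lam μ = 2 * (k : ℝ) * ‖lam‖ ^ 3)
    (hI : ∀ ν : 𝔳, ‖ν‖ = 1 → A.xray ν lam f =ᵐ[volume] 0) (φ : Fock n)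
    (e : EuclideanSpace ℂ (Fin n)) (he : ‖e‖ = 1) (ζ : EuclideanSpace ℂ (Fin n)) :
    ∫ θ in (0 : ℝ)..(2 * Real.pi), Complex.exp (Complex.I * k * θ) *
      Complex.exp (-((√(‖μ‖ / 2) / ‖lam‖ : ℝ)
        * inner ℂ (planarCircle e (N.conjJ (‖lam‖⁻¹ • lam) e) θ) ζ)) *
      N.fourierApply hμ f φ
        (ζ + ((√(‖μ‖ / 2) / ‖lam‖ : ℝ) : ℂ) • planarCircle e (N.conjJ (‖lam‖⁻¹ • lam) e) θ) = 0 := by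
  have hl : 0 < ‖lam‖ := norm_pos_iff.mpr hlam
  have hpi := Real.pi_pos
  set u : 𝔷 := ‖lam‖⁻¹ • lam with hu
  have hun : ‖u‖ = 1 := by rw [hu, norm_smul, norm_inv, norm_norm, inv_mul_cancel₀ hl.ne']
  set c : ℝ → 𝔳 × 𝔷 := fun s =>
    (‖lam‖⁻¹ • (Real.sin (s * ‖lam‖) • N.R e - Real.cos (s * ‖lam‖) • A.J u (N.R e)),
      (s / (2 * ‖lam‖ ^ 2)) • lam) with hc
  have hν : ‖N.R e‖ = 1 := by rw [N.R.norm_map, he]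
  have hgeo : ∀ s, (c s : 𝔳 × 𝔷) = A.geodesic (N.R e) lam s := by
    intro s
    rw [A.geodesic_eq hlam, hν, one_pow, mul_one]
    rfl
  have hT : 0 < 2 * Real.pi / ‖lam‖ := by positivity
  have hR : ∀ θ : ℝ, N.R.symm (c (θ / ‖lam‖)).1
      = ((‖lam‖⁻¹ : ℝ) : ℂ) • planarCircle e (N.conjJ u e) θ := by
    intro θ
    simp only [hc, div_mul_cancel₀ _ hl.ne', map_smul, map_sub, N.R.symm_apply_apply, planarCircle,
      conjJ, Complex.coe_smul]
  have hnorm : ∀ θ : ℝ, ‖N.R.symm (c (θ / ‖lam‖)).1‖ ^ 2 = (‖lam‖⁻¹) ^ 2 := by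
    intro θ
    rw [N.R.symm.norm_map]
    simp only [hc, div_mul_cancel₀ _ hl.ne']
    rw [norm_smul, mul_pow, norm_sub_sq_real, norm_smul, norm_smul, real_inner_smul_left,
      real_inner_smul_right, A.inner_self_J, A.norm_J, hun, hν]
    simp only [Real.norm_eq_abs, mul_one, mul_zero, sub_zero, sq_abs, abs_inv, abs_norm,
      Real.sin_sq_add_cos_sq]
  have hz : ∀ θ : ℝ, inner ℝ μ (c (θ / ‖lam‖)).2 = k * θ := by
    intro θ
    simp only [hc]
    rw [real_inner_smul_right, real_inner_comm, hk]
    field_simp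
  -- In the time T = 2π/|λ| the central coordinate advances by Tλ/(2|λ|²) = (π/|λ|³)λ, on which μ
  -- takes the value 2πk.
  have h1 := N.integral_fourierApply_eq_zero hμ (f := f) hf (c := c) (by fun_prop) hT
    (κ := (Real.pi / ‖lam‖ ^ 3) • lam) (smul_ne_zero (by positivity) hlam)
    (fun s => by
      have e1 : (s + 2 * Real.pi / ‖lam‖) * ‖lam‖ = s * ‖lam‖ + 2 * Real.pi := by field_simp
      refine Prod.ext ?_ ?_
      · simp only [hc, e1, Real.sin_add_two_pi, Real.cos_add_two_pi, Prod.fst_add, add_zero]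
      · simp only [hc, Prod.snd_add, ← add_smul]
        congr 1
        field_simp)
    (k := k) (by
      rw [real_inner_smul_right, real_inner_comm, hk]
      field_simp)
    (by
      filter_upwards [hI (N.R e) hν] with g hg
      exact (integral_congr_ae (ae_of_all _ fun s =>
        congrArg (fun p => f (twistedMul A.bracket g p)) (hgeo s))).trans hg) φ ζ
  have h2 := intervalIntegral.integral_comp_div (a := 0) (b := 2 * Real.pi)
    (fun s => Complex.exp (Complex.I * (inner ℝ μ (c s).2 : ℝ)
          - (√(‖μ‖ / 2) : ℝ) * inner ℂ (N.R.symm (c s).1) ζ - (‖μ‖ / 4) * ‖N.R.symm (c s).1‖ ^ 2)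
        * N.fourierApply hμ f φ (ζ + (√(‖μ‖ / 2) : ℂ) • N.R.symm (c s).1)) hl.ne'
  rw [zero_div, h1, smul_zero] at h2
  -- With s = θ/|λ| the central phase is kθ. The projection of the geodesic to 𝔳 has constant norm
  -- 1/|λ|, so the Gaussian factor is constant and can be divided out.
  have h3 : ∀ θ : ℝ, Complex.exp (Complex.I * (inner ℝ μ (c (θ / ‖lam‖)).2 : ℝ)
          - (√(‖μ‖ / 2) : ℝ) * inner ℂ (N.R.symm (c (θ / ‖lam‖)).1) ζ
          - (‖μ‖ / 4) * ‖N.R.symm (c (θ / ‖lam‖)).1‖ ^ 2)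
        * N.fourierApply hμ f φ (ζ + (√(‖μ‖ / 2) : ℂ) • N.R.symm (c (θ / ‖lam‖)).1)
      = Complex.exp (-((‖μ‖ / 4) * (‖lam‖⁻¹) ^ 2 : ℝ)) * (Complex.exp (Complex.I * k * θ) *
        Complex.exp (-((√(‖μ‖ / 2) / ‖lam‖ : ℝ) * inner ℂ (planarCircle e (N.conjJ u e) θ) ζ)) *
        N.fourierApply hμ f φ
          (ζ + ((√(‖μ‖ / 2) / ‖lam‖ : ℝ) : ℂ) • planarCircle e (N.conjJ u e) θ)) := by
    intro θ
    rw [← Complex.ofReal_pow ‖N.R.symm (c (θ / ‖lam‖)).1‖, hnorm, hz, hR, inner_smul_left,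
      Complex.conj_ofReal, smul_smul, ← Complex.exp_add, ← mul_assoc (Complex.exp _), ← Complex.exp_add]
    congr 2
    · push_cast
      ring
    · rw [div_eq_mul_inv _ ‖lam‖, Complex.ofReal_mul]
  simp only [h3] at h2
  rw [intervalIntegral.integral_const_mul] at h2
  exact (mul_eq_zero.mp h2).resolve_left (Complex.exp_ne_zero _)

/-- The vanishing of the Fourier transform at compatible frequencies. -/
theorem NormalForm.isFourierTransform_zero_of_xray [Nontrivial 𝔳] (N : A.NormalForm μ n)
    (hμ : μ ≠ 0) {f : HTypeGroup A → ℂ} (hf : Integrable f) {lam : 𝔷} (hlam : lam ≠ 0) {k : ℤ}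
    (hk : inner ℝ lam μ = 2 * (k : ℝ) * ‖lam‖ ^ 3)
    (hI : ∀ ν : 𝔳, ‖ν‖ = 1 → A.xray ν lam f =ᵐ[volume] 0)
    (hG : (Module.finrank ℝ 𝔳, Module.finrank ℝ 𝔷) ≠ (2, 1) ∨ Odd k) :
    N.IsFourierTransform hμ f 0 := by
  have hl : 0 < ‖lam‖ := norm_pos_iff.mpr hlam
  have hm : 0 < ‖μ‖ := norm_pos_iff.mpr hμ
  have hE := N.nontrivial
  refine N.isFourierTransform_zero hμ (f := f) hf fun φ => ?_
  have hFc := N.continuous_fourierApply hμ (f := f) hf φ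
  have hFd := N.differentiable_fourierApply_line hμ (f := f) hf φ
  have hmean := N.integral_planarCircle_eq_zero hμ hf hlam hk hI φ
  set α : ℝ := √(‖μ‖ / 2) / ‖lam‖ with hα
  have hα0 : 0 < α := by positivity
  have hα2 : α ^ 2 = ‖μ‖ / (2 * ‖lam‖ ^ 2) := by
    rw [hα, div_pow, Real.sq_sqrt (by positivity)]
    field_simp
  -- The unit vector λ/|λ| splits into its component along μ, with cosine a, and the orthogonal rest
  -- κ; the former acts as ai and the latter antilinearly.
  set a : ℝ := inner ℝ lam μ / (‖lam‖ * ‖μ‖) with ha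
  set κ : 𝔷 := ‖lam‖⁻¹ • lam - (a / ‖μ‖) • μ with hκ
  have hu : ‖lam‖⁻¹ • lam = (a / ‖μ‖) • μ + κ := by rw [hκ]; abel
  have hperp : inner ℝ μ κ = 0 := by
    rw [hκ, inner_sub_right, real_inner_smul_right, real_inner_smul_right,
      real_inner_self_eq_norm_sq, real_inner_comm, ha]
    field_simp
    ring
  have hab : a ^ 2 + ‖κ‖ ^ 2 = 1 := by
    have h1 : ‖‖lam‖⁻¹ • lam‖ = 1 := by
      rw [norm_smul, norm_inv, norm_norm, inv_mul_cancel₀ hl.ne']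
    have h2 := norm_add_sq_real ((a / ‖μ‖) • μ) κ
    rw [← hu, h1, real_inner_smul_left, hperp, norm_smul, Real.norm_eq_abs, mul_pow, sq_abs,
      div_pow, div_mul_cancel₀ _ (by positivity)] at h2
    linarith
  have hka : (k : ℝ) = a * α ^ 2 := by
    rw [hα2, ha, hk]
    field_simp
  have hconj : ∀ e, N.conjJ (‖lam‖⁻¹ • lam) e = (a * Complex.I) • e + N.conjJ κ e := by
    intro e
    rw [hu, N.conjJ_add_left, N.conjJ_smul_left, N.conjJ_self, smul_smul]
    congr 2
    have : (‖μ‖ : ℂ) ≠ 0 := by exact_mod_cast hm.ne'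
    push_cast
    field_simp
  simp only [hconj] at hmean
  by_cases hκ0 : κ = 0
  · have haa : a = 1 ∨ a = -1 := by
      rw [hκ0, norm_zero] at hab
      exact mul_self_eq_one_iff.mp (by nlinarith)
    have hκe : ∀ e, N.conjJ κ e = 0 := fun e => by
      rw [← norm_eq_zero, N.norm_conjJ, hκ0, norm_zero, zero_mul]
    simp only [hκe, add_zero] at hmean
    have hcirc := circle_means_of_aligned haa hka hmean
    rcases hG with hG | hG
    · have hn : 1 < n := by
        by_contra hn
        have h0 : 0 < n := by
          have h1 : 0 < Module.finrank ℝ 𝔳 := Module.finrank_pos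
          rw [N.finrank_eq] at h1
          omega
        obtain rfl : n = 1 := by omega
        exact hG (Prod.ext N.finrank_eq (N.finrank_centre_of_one hμ))
      exact eq_zero_of_circle_means_of_one_lt_finrank hFd k.natAbs hα0.ne'
        (by rwa [finrank_euclideanSpace_fin]) hcirc
    · refine eq_zero_of_circle_means_of_odd hFd (Int.natAbs_odd.mpr hG) ?_ hcirc
      -- Here |a| = 1, so k = aα² gives α² = |k|, the value required by the parity argument.
      have h1 : ((k.natAbs : ℤ) : ℝ) = |(k : ℝ)| := by rw [Int.natCast_natAbs, Int.cast_abs]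
      rw [Int.cast_natCast] at h1
      rw [h1, hka, abs_mul, abs_of_nonneg (sq_nonneg α)]
      rcases haa with h | h <;> rw [h] <;> simp
  · exact eq_zero_of_transverse_means hFc hFd hα0 (norm_pos_iff.mpr hκ0) hab k (N.conjJ_add κ)
      (N.conjJ_smul hμ hperp) (N.conjJ_conjJ κ) (N.norm_conjJ κ) (N.inner_conjJ hμ hperp) hmean

end HTypeAlgebra

end

theorem theorem2p3 {𝔳 𝔷 : Type*}
    [NormedAddCommGroup 𝔳] [InnerProductSpace ℝ 𝔳] [FiniteDimensional ℝ 𝔳]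
    [MeasurableSpace 𝔳] [BorelSpace 𝔳] [Nontrivial 𝔳]
    [NormedAddCommGroup 𝔷] [InnerProductSpace ℝ 𝔷] [FiniteDimensional ℝ 𝔷]
    [MeasurableSpace 𝔷] [BorelSpace 𝔷]
    (A : HTypeAlgebra 𝔳 𝔷) (f : HTypeGroup A → ℂ) (hf : Integrable f)
    (Z : Set 𝔷) (hZ : Z ⊆ {0}ᶜ)
    (hI : ∀ ν : 𝔳, ‖ν‖ = 1 → ∀ lam ∈ Z, A.xray ν lam f =ᵐ[volume] 0) :
    ((Module.finrank ℝ 𝔳, Module.finrank ℝ 𝔷) ≠ (2, 1) →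
      ∀ (μ : 𝔷) (hμ : μ ≠ 0), (∃ lam ∈ Z, (lam, μ) ∈ compatible 𝔷) →
        ∀ (n : ℕ) (N : A.NormalForm μ n), N.IsFourierTransform hμ f 0) ∧
    ((Module.finrank ℝ 𝔳, Module.finrank ℝ 𝔷) = (2, 1) →
      ∀ (μ : 𝔷) (hμ : μ ≠ 0), (∃ lam ∈ Z, (lam, μ) ∈ compatibleOdd 𝔷) →
        ∀ (n : ℕ) (N : A.NormalForm μ n), N.IsFourierTransform hμ f 0) := by
  refine ⟨fun hG μ hμ => ?_, fun _ μ hμ => ?_⟩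
  · rintro ⟨lam, hlam, h0, _, k, hk⟩ n N
    exact N.isFourierTransform_zero_of_xray hμ hf h0 hk (fun ν hν => hI ν hν lam hlam) (Or.inl hG)
  · rintro ⟨lam, hlam, h0, _, k, hodd, hk⟩ n N
    exact N.isFourierTransform_zero_of_xray hμ hf h0 hk (fun ν hν => hI ν hν lam hlam) (Or.inr hodd)
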